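/- **Setting.** Let $M$ be a smooth manifold of dimension $n\ge 2$ with a projective structure $\boldsymbol p$: a class of torsion-free affine connections, any two related by $\nabla'_av^b=\nabla_av^b+\Upsilon_av^b+\Upsilon_cv^c\delta_a^b$ for some one-form $\Upsilon$. For $w\in\mathbb R$ let $\mathcal E(w)=\big((\Lambda^nTM)^2\big)^{w/(2n+2)}$, and write $\mathcal B(w)=\mathcal B\otimes\mathcal E(w)$. Let $\mathcal T^*=J^1\mathcal E(1)$ be the cotractor bundle, $\mathcal T$ its dual, $X^A\in\Gamma(\mathcal T(1))$ the jet projection $J^1\mathcal E(1)\to\mathcal E(1)$ and $Z_A{}^a:T^*M(1)\to\mathcal T^*$ its kernel. Choose $\nabla\in\boldsymbol p$, with curvature $[\nabla_a,\nabla_b]v^c=R_{ab}{}^c{}_dv^d$, Ricci tensor $R_{bd}=R_{cb}{}^c{}_d$ and projective Schouten tensor $P_{ab}$ given by $(n-1)P_{ab}=R_{ab}+\beta_{ab}$, $\beta_{ab}=P_{ba}-P_{ab}$. Let $Y_A:\mathcal E(1)\to\mathcal T^*$ be the splitting determined by $\nabla$ (the jets with $\nabla\sigma=0$), so that $\mathcal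 T^*\cong\mathcal E(1)\oplus T^*M(1)$. The tractor connection is $$\nabla_a(\sigma,\mu_b)=(\nabla_a\sigma-\mu_a,\ \nabla_a\mu_b+P_{ab}\sigma)$$ on $\mathcal T^*$, extended to tensor powers of $\mathcal T^*$ and $\mathcal T$, and coupled with $\nabla$ on $\mathcal E(w)$. The Thomas operator on tractor fields of weight $w$ is $\mathbb D_AV=wY_AV+Z_A{}^a\nabla_aV$, of weight $w-1$. The $W$-curvature is defined by $[\mathbb D_A,\mathbb D_B]V^C=W_{AB}{}^C{}_DV^D$, and for cotractor fields $W_{AB}\sharp T_{CD\cdots}=-W_{AB}{}^E{}_CT_{ED\cdots}-W_{AB}{}^E{}_DT_{CE\cdots}-\cdots$; likewise $\mathbb D_AW_{BC}\,\sharp$ is the action of $\mathbb D_AW_{BC}{}^E{}_F$. These objects do not depend on the choice of $\nabla\in\boldsymbol p$, apart from $Y_A$ and the quantities $R$, $P$, $\beta$. Round brackets around indices denote symmetrisation, and indices between vertical bars are excluded from it. Let $\mathcal T_{(2,2)}\subset\otimes^4\mathcal T^*$ be the bundle of tensors with $T_{BCDE}=T_{(BC)(DE)}$ and $T_{(BCD)E}=0$,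 and let $P_{(2,2)}=S_{(12)}\circ S_{(34)}\circ S_{[13]}\circ S_{[24]}$ be the Young projection, where $S_{(ij)}$ and $S_{[ij]}$ symmetrise and anti-symmetrise in positions $i,j$. The splitting operator is $$\mathcal L:\Gamma(S^2T^*M(4))\to\Gamma(\mathcal T_{(2,2)}),\qquad \mathcal L(k)_{BCDE}=P_{(2,2)}\big(\mathbb D_B\mathbb D_CK_{DE}\big),\qquad K_{DE}=Z_D{}^dZ_E{}^ek_{de}.$$ A weighted Killing tensor of rank $2$ is a smooth section $k$ of $S^2T^*M(4)$ with $\nabla_{(a}k_{bc)}=0$ (a condition independent of $\nabla\in\boldsymbol p$). **Theorem.** On an arbitrary projective manifold $(M,\boldsymbol p)$ of dimension $n\ge2$, the operator $\mathcal L$ is a well-defined map $\Gamma(S^2T^*M(4))\to\Gamma(\mathcal T_{(2,2)})$, independent of the choice of $\nabla\in\boldsymbol p$, and it restricts to a linear isomorphism from the space of weighted Killing tensors of rank $2$ onto the space of smooth sections $L_{DEAB}$ of $\mathcal T_{(2,2)}$ of weight zero that satisfy $$\begin{aligned} \mathbb D_CL_{DEAB}={}&X^F\big(W_{C(D}\sharp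 L_{E)FAB}+W_{C(A}\sharp L_{B)FED}\big)\\ &+X^F\big(W_{(D|(A}\sharp L_{B)F|E)C}+W_{(A|(D}\sharp L_{E)F|B)C}\big)\\ &-\tfrac16X^FX^G\big(\mathbb D_{(D}W_{E)C}\sharp L_{ABFG}+\mathbb D_{(A}W_{B)C}\sharp L_{DEFG}\big)\\ &-\tfrac13X^FX^G\big(\mathbb D_{(D}W_{E)(A}\sharp L_{B)CFG}+\mathbb D_{(A}W_{B)(D}\sharp L_{E)CFG}\big)\\ &-\tfrac16X^FX^G\big(\mathbb D_{(A}W_{|C(D}\sharp L_{E)|B)FG}+\mathbb D_{(D}W_{|C(A}\sharp L_{B)|E)FG}\big). \end{aligned}$$ -/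

import Mathlib

open scoped Manifold ContDiff
open VectorField

noncomputable section

namespace ProjTractor

/-! ### Affine connections and projective structures -/

/-- The model space of an `n`-manifold. -/
abbrev Eucl (n : ℕ) : Type := EuclideanSpace ℝ (Fin n)

/-- The `a`-th standard basis vector of the model space. -/
def basisVec (n : ℕ) (a : Fin n) : Eucl n := EuclideanSpace.single a 1

/-- Tractor indices: `0` is the slot of `σ ∈ ℰ(1)`, and `a.succ` are the slots of its first
derivatives. -/
abbrev Idx (n : ℕ) : Type := Fin (n + 1)

/-- A smooth torsion-free affine connection on `M`. -/
structure AffineConnection (n : ℕ) (M : Type*) [TopologicalSpace M] [ChartedSpace (Eucl n) M]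
    [IsManifold (𝓡 n) ∞ M] where
  cov : CovariantDerivative (𝓡 n) (Eucl n) (TangentSpace (𝓡 n) : M → Type _)
  smooth : CovariantDerivative.ContMDiffCovariantDerivative cov ∞
  torsion_free : ∀ x : M, cov.torsion x = 0

section Manifold

variable {n : ℕ} {M : Type*} [TopologicalSpace M] [ChartedSpace (Eucl n) M]
  [IsManifold (𝓡 n) ∞ M]

/-- `∇'` and `∇` are projectively equivalent: there is a smooth one-form `Υ` with
`∇'_u v = ∇_u v + Υ(u) v + Υ(v) u`. -/
def ProjEquiv (nab nab' : AffineConnection n M) : Prop :=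
  ∃ Υ : (x : M) → TangentSpace (𝓡 n) x →L[ℝ] ℝ,
    (∀ v : (x : M) → TangentSpace (𝓡 n) x,
      ContMDiff (𝓡 n) ((𝓡 n).prod 𝓘(ℝ, Eucl n)) ∞
          (fun x => (⟨x, v x⟩ : TangentBundle (𝓡 n) M)) →
        ContMDiff (𝓡 n) 𝓘(ℝ, ℝ) ∞ (fun x => Υ x (v x))) ∧
    ∀ (v : (x : M) → TangentSpace (𝓡 n) x) (x : M),
      MDifferentiableAt (𝓡 n) ((𝓡 n).prod 𝓘(ℝ, Eucl n))
          (fun x => (⟨x, v x⟩ : TangentBundle (𝓡 n) M)) x →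
        ∀ u : TangentSpace (𝓡 n) x,
          nab'.cov v x u = nab.cov v x u + Υ x u • v x + Υ x (v x) • u

variable (n M) in
/-- A projective structure: one equivalence class of projectively related torsion-free
connections. -/
structure ProjectiveStructure where
  carrier : Set (AffineConnection n M)
  nonempty : carrier.Nonempty
  isClass : ∀ nab ∈ carrier, ∀ nab', nab' ∈ carrier ↔ ProjEquiv nab nab'

/-! ### Local expressions of a connection in a chart

All local expressions are functions of the coordinates `y ∈ φ.target`. -/

variable (n M) in
/-- The charts of the given atlas. -/
abbrev Chart : Type _ := atlas (Eucl n) M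

/-- The partial derivative `∂_a f`. -/
def pd (a : Fin n) (f : Eucl n → ℝ) (y : Eucl n) : ℝ := fderiv ℝ f y (basisVec n a)

/-- The coordinate vector field `∂_a` of the chart `φ`. -/
def coordField (φ : Chart n M) (a : Fin n) : (x : M) → TangentSpace (𝓡 n) x :=
  mpullback (𝓡 n) 𝓘(ℝ, Eucl n) φ.1 (fun _ => basisVec n a)

/-- The components of a tangent vector at `x` in the chart `φ`. -/
def vecComp (φ : Chart n M) (x : M) (v : TangentSpace (𝓡 n) x) : Eucl n :=
  mfderiv (𝓡 n) 𝓘(ℝ, Eucl n) φ.1 x v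

/-- Christoffel symbols: `∇_{∂_a} ∂_b = Γ_{ab}^c ∂_c`. -/
def christoffel (nab : AffineConnection n M) (φ : Chart n M) (a b c : Fin n) (y : Eucl n) : ℝ :=
  vecComp φ (φ.1.symm y)
    (nab.cov (coordField φ b) (φ.1.symm y) (coordField φ a (φ.1.symm y))) c

/-- The curvature `R_{ab}{}^c{}_d`, with `[∇_a, ∇_b] v^c = R_{ab}{}^c{}_d v^d`. -/
def curvature (nab : AffineConnection n M) (φ : Chart n M) (a b c d : Fin n) (y : Eucl n) : ℝ :=
  pd a (christoffel nab φ b d c) y - pd b (christoffel nab φ a d c) y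
    + ∑ e, (christoffel nab φ a e c y * christoffel nab φ b d e y
        - christoffel nab φ b e c y * christoffel nab φ a d e y)

/-- The Ricci curvature `R_{bd} = R_{cb}{}^c{}_d`. -/
def ricci (nab : AffineConnection n M) (φ : Chart n M) (b d : Fin n) (y : Eucl n) : ℝ :=
  ∑ c, curvature nab φ c b c d y

/-- The projective Schouten tensor `P_{ab}`: the solution of
`(n - 1) P_{ab} = R_{ab} + β_{ab}`, `β_{ab} = P_{ba} - P_{ab}`. -/
def schouten (nab : AffineConnection n M) (φ : Chart n M) (a b : Fin n) (y : Eucl n) : ℝ :=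
  (n * ricci nab φ a b y + ricci nab φ b a y) / ((n : ℝ) ^ 2 - 1)

/-- The connection form of `ℰ(1)` in the trivialisation of the chart:
`∇_a τ = ∂_a τ + w θ_a τ` for sections `τ` of `ℰ(w)`, where `θ_a = Γ_{ac}^c / (n + 1)`. -/
def densityForm (nab : AffineConnection n M) (φ : Chart n M) (a : Fin n) (y : Eucl n) : ℝ :=
  (∑ c, christoffel nab φ a c c y) / (n + 1)

/-! ### The tractor connection and the Thomas operator in a chart

A cotractor, an element of `J¹ℰ(1)`, has in a chart the components
`(σ, ∂_1 σ, …, ∂_n σ)` of the jet of a local section `σ` of `ℰ(1)`. -/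

/-- The canonical tractor `X^A`, the projection `J¹ℰ(1) → ℰ(1)`. -/
def canonX (A : Idx n) : ℝ := if A = 0 then 1 else 0

/-- The inclusion `Z_A{}^a : ℰ_a(1) → J¹ℰ(1)`. -/
def inclZ (A : Idx n) (a : Fin n) : ℝ := if A = a.succ then 1 else 0

/-- The splitting `Y_A : ℰ(1) → J¹ℰ(1)` determined by `∇`: it sends `σ` at a point to the
jet there with this value and with `∇ σ = 0`. -/
def splitY (nab : AffineConnection n M) (φ : Chart n M) (A : Idx n) (y : Eucl n) : ℝ :=
  Fin.cases 1 (fun a => - densityForm nab φ a y) A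

/-- The top slot `σ = X^A V_A ∈ ℰ(1)` of a cotractor field. -/
def topSlot (V : Idx n → Eucl n → ℝ) (y : Eucl n) : ℝ := V 0 y

/-- The bottom slot `μ_b = W^A{}_b V_A ∈ ℰ_b(1)` of a cotractor field in the splitting
of `∇`; for the jet of `σ` it is `∇_b σ`. -/
def bottomSlot (nab : AffineConnection n M) (φ : Chart n M) (V : Idx n → Eucl n → ℝ)
    (b : Fin n) (y : Eucl n) : ℝ :=
  V b.succ y - splitY nab φ b.succ y * V 0 y

/-- The cotractor connection: in the splitting of `∇`,
`∇_a (σ, μ_b) = (∇_a σ - μ_a, ∇_a μ_b + P_{ab} σ)`. -/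
def cotractorNabla (nab : AffineConnection n M) (φ : Chart n M) (V : Idx n → Eucl n → ℝ)
    (a : Fin n) (B : Idx n) (y : Eucl n) : ℝ :=
  let σ := topSlot V
  let μ := bottomSlot nab φ V
  let σ' : ℝ := pd a σ y + densityForm nab φ a y * σ y - μ a y
  let μ' : Fin n → ℝ := fun b =>
    pd a (μ b) y - ∑ c, christoffel nab φ a b c y * μ c y + densityForm nab φ a y * μ b y
      + schouten nab φ a b y * σ y
  splitY nab φ B y * σ' + ∑ b, inclZ B b * μ' b

/-- The coefficients `ω_{aB}{}^C` of the cotractor connection: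
`∇_a V_B = ∂_a V_B - ω_{aB}{}^C V_C`. -/
def tractorForm (nab : AffineConnection n M) (φ : Chart n M) (a : Fin n) (B C : Idx n)
    (y : Eucl n) : ℝ :=
  - cotractorNabla nab φ (fun D _ => if D = C then 1 else 0) a B y

variable (n) in
/-- Components, in one chart, of a tractor field with `r` lower and `s` upper indices. -/
abbrev TractorComp (r s : ℕ) : Type :=
  (Fin r → Idx n) → (Fin s → Idx n) → Eucl n → ℝ

/-- The tractor connection on tractor fields of weight `w`, coupled with `∇` on `ℰ(w)`. -/
def tractorNabla (nab : AffineConnection n M) (φ : Chart n M) (w : ℝ) {r s : ℕ}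
    (T : TractorComp n r s) (a : Fin n) : TractorComp n r s :=
  fun B C y =>
    pd a (T B C) y + w * densityForm nab φ a y * T B C y
      - ∑ i, ∑ H, tractorForm nab φ a (B i) H y * T (Function.update B i H) C y
      + ∑ i, ∑ H, tractorForm nab φ a H (C i) y * T B (Function.update C i H) y

open Classical in
/-- The Thomas operator on tractor fields of weight `w`, `𝔻_A T = w Y_A T + Z_A{}^a ∇_a T`;
the new lower index comes first. The components are set to `0` outside the range of the
chart. -/
def thomasD (nab : AffineConnection n M) (φ : Chart n M) (w : ℝ) {r s : ℕ}
    (T : TractorComp n r s) : TractorComp n (r + 1) s :=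
  fun B C y =>
    if y ∈ φ.1.target then
      w * splitY nab φ (B 0) y * T (Fin.tail B) C y
        + ∑ a, inclZ (B 0) a * tractorNabla nab φ w T a (Fin.tail B) C y
    else 0

/-- The `D`-th element of the tractor frame of the chart, as a field with one upper index. -/
def frame (D : Idx n) : TractorComp n 0 1 := fun _ C _ => if C 0 = D then 1 else 0

/-- The `W`-curvature `W_{AB}{}^C{}_D`, defined by `[𝔻_A, 𝔻_B] V^C = W_{AB}{}^C{}_D V^D`.
The lower indices are listed as `![A, B, D]`. -/
def curvW (nab : AffineConnection n M) (φ : Chart n M) : TractorComp n 3 1 :=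
  fun B C y =>
    thomasD nab φ (-1) (thomasD nab φ 0 (frame (B 2))) ![B 0, B 1] C y
      - thomasD nab φ (-1) (thomasD nab φ 0 (frame (B 2))) ![B 1, B 0] C y

/-- The derivative `𝔻_A W_{BC}{}^E{}_F` of the `W`-curvature, which has weight `-2`.
The lower indices are listed as `![A, B, C, F]`. -/
def derivW (nab : AffineConnection n M) (φ : Chart n M) : TractorComp n 4 1 :=
  thomasD nab φ (-2) (curvW nab φ)

/-! ### Algebra of four-index cotractors -/

/-- The action `N ♯ T` of an endomorphism `N^E{}_C = N E C`:
`N ♯ T_{C D ⋯} = - N^E{}_C T_{E D ⋯} - N^E{}_D T_{C E ⋯} - ⋯`. -/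
def sharp (N : Idx n → Idx n → ℝ) {r : ℕ} (T : (Fin r → Idx n) → ℝ) (J : Fin r → Idx n) : ℝ :=
  - ∑ i, ∑ E, N E (J i) * T (Function.update J i E)

/-- Symmetrisation in positions `i` and `j`. -/
def symmPos {r : ℕ} (i j : Fin r) (T : (Fin r → Idx n) → ℝ) (J : Fin r → Idx n) : ℝ :=
  (T J + T (J ∘ Equiv.swap i j)) / 2

/-- Anti-symmetrisation in positions `i` and `j`. -/
def altPos {r : ℕ} (i j : Fin r) (T : (Fin r → Idx n) → ℝ) (J : Fin r → Idx n) : ℝ :=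
  (T J - T (J ∘ Equiv.swap i j)) / 2

/-- The Young projection `P_{(2,2)} = S_{(12)} ∘ S_{(34)} ∘ S_{[13]} ∘ S_{[24]}`. -/
def young22 (T : (Fin 4 → Idx n) → ℝ) : (Fin 4 → Idx n) → ℝ :=
  symmPos 0 1 (symmPos 2 3 (altPos 0 2 (altPos 1 3 T)))

/-- Young symmetry `(2,2)`: `T_{BCDE} = T_{(BC)(DE)}` and `T_{(BCD)E} = 0`. -/
def HasYoung22 (T : (Fin 4 → Idx n) → ℝ) : Prop :=
  (∀ B C D E, T ![B, C, D, E] = T ![C, B, D, E]) ∧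
  (∀ B C D E, T ![B, C, D, E] = T ![B, C, E, D]) ∧
  (∀ B C D E, T ![B, C, D, E] + T ![C, D, B, E] + T ![D, B, C, E] = 0)

/-- Symmetrisation of a pair of indices. -/
def sym {ι : Type*} (f : ι → ι → ℝ) (a b : ι) : ℝ := (f a b + f b a) / 2

/-! ### Global sections, given by their components in all charts -/

/-- The coordinate change from the chart `φ` to the chart `ψ`. -/
def coordChange (φ ψ : Chart n M) (y : Eucl n) : Eucl n := ψ.1 (φ.1.symm y)

/-- The Jacobian `J_a{}^b = ∂_a (coordChange φ ψ)^b`. -/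
def jacobian (φ ψ : Chart n M) (y : Eucl n) : Matrix (Fin n) (Fin n) ℝ :=
  Matrix.of fun a b => fderiv ℝ (coordChange φ ψ) y (basisVec n a) b

/-- The transition function of `ℰ(1)`: since `ℰ(1)` is the root of order `2n + 2` of
`(Λⁿ TM)²`, sections satisfy `σ_φ = |det J|^{-1/(n+1)} σ_ψ`. -/
def densityTrans (φ ψ : Chart n M) (y : Eucl n) : ℝ :=
  |(jacobian φ ψ y).det| ^ (-1 / ((n : ℝ) + 1))

/-- The transition matrix of `J¹ℰ(1)`, `V_A^φ = ∑ B, (cotractorTrans φ ψ y A B) V_B^ψ`: it is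
obtained by differentiating `σ_φ = ρ σ_ψ`, so that `∂_a σ_φ = (∂_a ρ) σ_ψ + ρ J_a{}^b ∂_b σ_ψ`. -/
def cotractorTrans (φ ψ : Chart n M) (y : Eucl n) (A B : Idx n) : ℝ :=
  Fin.cases (Fin.cases (densityTrans φ ψ y) (fun _ => 0) B)
    (fun a => Fin.cases (pd a (densityTrans φ ψ) y)
      (fun b => densityTrans φ ψ y * jacobian φ ψ y a b) B) A

/-- The part of the range of `φ` on which the coordinate change to `ψ` is defined. -/
def overlap (φ ψ : Chart n M) : Set (Eucl n) := (φ.1.symm.trans ψ.1).source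

variable (n M) in
/-- Components in all charts of a two-index covariant tensor. -/
abbrev TensorFamily : Type _ := Chart n M → Fin n → Fin n → Eucl n → ℝ

variable (n M) in
/-- Components in all charts of a four-index cotractor field. -/
abbrev CotractorFamily : Type _ := Chart n M → (Fin 4 → Idx n) → Eucl n → ℝ

/-- `k` is a smooth section of `S²T*M(w)`. (Components are normalised to vanish outside
the range of the chart, so that each section is given by exactly one family.) -/
structure IsSymTensor (w : ℝ) (k : TensorFamily n M) : Prop where
  symm : ∀ φ a b y, k φ a b y = k φ b a y
  smooth : ∀ φ a b, ContDiffOn ℝ ∞ (k φ a b) φ.1.target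
  zero_off : ∀ φ a b, ∀ y ∉ φ.1.target, k φ a b y = 0
  trans : ∀ φ ψ, ∀ y ∈ overlap φ ψ, ∀ a b,
    k φ a b y = densityTrans φ ψ y ^ w *
      ∑ c, ∑ d, jacobian φ ψ y a c * jacobian φ ψ y b d * k ψ c d (coordChange φ ψ y)

/-- `L` is a smooth section of weight zero of the tractor bundle `𝒯_{(2,2)} ⊆ ⊗⁴ 𝒯*`. -/
structure IsYoungTractor (L : CotractorFamily n M) : Prop where
  young : ∀ φ y, HasYoung22 (fun J => L φ J y)
  smooth : ∀ φ J, ContDiffOn ℝ ∞ (L φ J) φ.1.target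
  zero_off : ∀ φ J, ∀ y ∉ φ.1.target, L φ J y = 0
  trans : ∀ φ ψ, ∀ y ∈ overlap φ ψ, ∀ J,
    L φ J y = ∑ H : Fin 4 → Idx n,
      (∏ i, cotractorTrans φ ψ y (J i) (H i)) * L ψ H (coordChange φ ψ y)

/-! ### Killing tensors, the splitting operator, and the prolonged equation -/

/-- The covariant derivative `∇_a k_{bc}` of a section of `S²T*M(w)`. -/
def tensorNabla (nab : AffineConnection n M) (φ : Chart n M) (w : ℝ)
    (k : Fin n → Fin n → Eucl n → ℝ) (a b c : Fin n) (y : Eucl n) : ℝ :=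
  pd a (k b c) y + w * densityForm nab φ a y * k b c y
    - ∑ d, christoffel nab φ a b d y * k d c y - ∑ d, christoffel nab φ a c d y * k b d y

/-- The Killing equation `∇_{(a} k_{bc)} = 0` for sections `k` of `S²T*M(4)`. -/
def KillingEq (nab : AffineConnection n M) (k : TensorFamily n M) : Prop :=
  ∀ φ, ∀ y ∈ φ.1.target, ∀ a b c,
    tensorNabla nab φ 4 (k φ) a b c y + tensorNabla nab φ 4 (k φ) b c a y
      + tensorNabla nab φ 4 (k φ) c a b y = 0

/-- `K_{AB} = Z_A{}^a Z_B{}^b k_{ab}`, which has weight `2` if `k` has weight `4`. -/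
def tractorOf (k : Fin n → Fin n → Eucl n → ℝ) : TractorComp n 2 0 :=
  fun B _ y => ∑ a, ∑ b, inclZ (B 0) a * inclZ (B 1) b * k a b y

/-- The splitting operator `ℒ(k)_{BCDE} = P_{(2,2)} (𝔻_B 𝔻_C K_{DE})`. -/
def splitting (nab : AffineConnection n M) (k : TensorFamily n M) : CotractorFamily n M :=
  fun φ J y =>
    young22 (fun J' => thomasD nab φ 1 (thomasD nab φ 2 (tractorOf (k φ))) J' ![] y) J

/-- `𝔻_C L_{DEAB}` for a cotractor field `L` of weight zero. -/
def derivL (nab : AffineConnection n M) (L : CotractorFamily n M) (φ : Chart n M)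
    (C D E A B : Idx n) (y : Eucl n) : ℝ :=
  thomasD nab φ 0 (s := 0) (fun J _ => L φ J) ![C, D, E, A, B] ![] y

/-- `W_{PQ} ♯ L_{GHIJ}`. -/
def wSharp (nab : AffineConnection n M) (L : CotractorFamily n M) (φ : Chart n M) (y : Eucl n)
    (P Q G H I J : Idx n) : ℝ :=
  sharp (fun U V => curvW nab φ ![P, Q, V] ![U] y) (fun J' => L φ J' y) ![G, H, I, J]

/-- `(𝔻_R W_{PQ}) ♯ L_{GHIJ}`. -/
def dwSharp (nab : AffineConnection n M) (L : CotractorFamily n M) (φ : Chart n M) (y : Eucl n)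
    (R P Q G H I J : Idx n) : ℝ :=
  sharp (fun U V => derivW nab φ ![R, P, Q, V] ![U] y) (fun J' => L φ J' y) ![G, H, I, J]

/-- Contraction `X^F f_F`. -/
def contrX (f : Idx n → ℝ) : ℝ := ∑ F, canonX F * f F

/-- Contraction `X^F X^G f_{FG}`. -/
def contrXX (f : Idx n → Idx n → ℝ) : ℝ := ∑ F, ∑ G, canonX F * canonX G * f F G

/-- The right-hand side of the prolonged equation. Round brackets in the comments denote
symmetrisation, and vertical bars enclose indices left out of it. -/
def prolongRHS (nab : AffineConnection n M) (L : CotractorFamily n M) (φ : Chart n M)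
    (C D E A B : Idx n) (y : Eucl n) : ℝ :=
  let W := wSharp nab L φ y
  let DW := dwSharp nab L φ y
  -- X^F (W_{C(D} ♯ L_{E)FAB} + W_{C(A} ♯ L_{B)FED})
  contrX (fun F =>
      sym (fun D E => W C D E F A B) D E
      + sym (fun A B => W C A B F E D) A B)
  -- X^F (W_{(D|(A} ♯ L_{B)F|E)C} + W_{(A|(D} ♯ L_{E)F|B)C})
  + contrX (fun F =>
      sym (fun D E => sym (fun A B => W D A B F E C) A B) D E
      + sym (fun A B => sym (fun D E => W A D E F B C) D E) A B)
  -- X^F X^G (𝔻_{(D} W_{E)C} ♯ L_{ABFG} + 𝔻_{(A} W_{B)C} ♯ L_{DEFG})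
  - 1 / 6 * contrXX (fun F G =>
      sym (fun D E => DW D E C A B F G) D E
      + sym (fun A B => DW A B C D E F G) A B)
  -- X^F X^G (𝔻_{(D} W_{E)(A} ♯ L_{B)CFG} + 𝔻_{(A} W_{B)(D} ♯ L_{E)CFG})
  - 1 / 3 * contrXX (fun F G =>
      sym (fun D E => sym (fun A B => DW D E A B C F G) A B) D E
      + sym (fun A B => sym (fun D E => DW A B D E C F G) D E) A B)
  -- X^F X^G (𝔻_{(A} W_{|C(D} ♯ L_{E)|B)FG} + 𝔻_{(D} W_{|C(A} ♯ L_{B)|E)FG})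
  - 1 / 6 * contrXX (fun F G =>
      sym (fun A B => sym (fun D E => DW A C D E B F G) D E) A B
      + sym (fun D E => sym (fun A B => DW D C A B E F G) A B) D E)

/-- The prolonged equation for sections `L` of `𝒯_{(2,2)}`. -/
def ProlongEq (nab : AffineConnection n M) (L : CotractorFamily n M) : Prop :=
  ∀ φ, ∀ y ∈ φ.1.target, ∀ C D E A B,
    derivL nab L φ C D E A B y = prolongRHS nab L φ C D E A B y

/-- `k` is a weighted Killing tensor of rank two of the projective structure `p`. -/
def IsKillingTensor (p : ProjectiveStructure n M) (k : TensorFamily n M) : Prop :=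
  IsSymTensor 4 k ∧ ∀ nab ∈ p.carrier, KillingEq nab k

/-- `L` is a weight zero section of `𝒯_{(2,2)}` which solves the prolonged equation. -/
def IsProlongSolution (p : ProjectiveStructure n M) (L : CotractorFamily n M) : Prop :=
  IsYoungTractor L ∧ ∀ nab ∈ p.carrier, ProlongEq nab L

end Manifold

end ProjTractor

end

/-!
In a chart, a cotractor field of weight `w` and rank `r` is a tensor field on the cone over the
chart, homogeneous of degree `w + r` under the Euler field, and the Thomas operator becomes the
covariant derivative of an affine connection on the cone (`coneForm`, `thomasD_eq`). The index `0`
is the direction of the Euler field, so contraction with `X` means setting an index to `0`. This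
connection is torsion-free (`coneForm_symm`), its curvature is the `W`-curvature (`curvW_eq`), which
`X` annihilates in each lower index, and its coefficients are Thomas's projective parameters and
their Ricci tensor, which depend on the projective structure alone (`ProjEquiv.coneForm_eq`). The
curvature is trace-free (`trace_curv_coneForm`). Trace-freeness determines the connection among
those of the same shape, and so forces its transformation law under coordinate changes
(`isGauge_coneForm`). Hence `𝔻𝔻K` is a well-defined cotractor field, and so is its Young projection
(`isYoungTractor_splitting`, `splitting_eq`).

For a section `k` of `S²T*M(4)`, the Killing equation says that the cyclic sum of `𝔻_A K_{BC}`
vanishes (`killingEq_iff_cyclic`); all the algebra of Killing tensors on an affine space is then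
available, up to curvature. Homogeneity gives `X^A L_{ABCD} = 3/4 𝔻_B K_{CD}` and
`X^A X^B L_{ABCD} = 3/2 K_{CD}` for `L = 𝓛(k)`. The commutators of two neighbouring derivatives in
`𝔻𝔻𝔻K` involve the curvature and `𝔻K`, and the derivative of the curvature and `K`
(`IsConeKilling.jet₃_commutator`, `IsConeKilling.jet₃_commutator_deriv`). Expressed through
contractions of `L` with `X`, together with the cyclic identity these imply the prolonged equation
by linear algebra in the components of `𝔻𝔻𝔻K` (`prolong_algebra`, `prolongEq_splitting`).

Conversely, let `L` solve the prolonged equation and put `K_{AB} = 2/3 X^D X^E L_{DEAB}`. The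
contraction of the right-hand side with `X^D X^E` vanishes (`prolongRHS_zero_zero`), so that
`𝔻_A K_{BC} = 4/3 X^E L_{AEBC}`, whose cyclic sum is zero: `K` comes from a Killing tensor `k`. The
contraction of the right-hand side with a single `X` need not vanish, but it is a sum of tensors in
`Λ² ⊗ S²`, which the Young projection kills (`young22_prolongRHS_zero`). Therefore the Young
projections of `𝔻𝔻K` and of `4/3 L` agree, and the latter is `L`, which gives `𝓛(k) = L`
(`splitting_toKilling`).
-/

noncomputable section

set_option linter.unusedSectionVars false

/-! ### Homogeneous calculus on the cone -/



namespace ProjTractor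

open scoped Kronecker

variable {n : ℕ} {ι κ l : Type*} [Fintype ι] [DecidableEq ι] [Fintype κ] [DecidableEq κ]
  [Fintype l] [DecidableEq l]

/-- The derivative in the direction `A` of the homogeneous function `exp (m s) * f y` of degree `m`
in coordinates `(s, y)` of the cone, restricted to `s = 0`: here `∂_0` is the Euler field `∂/∂s`,
which multiplies by the degree, and `∂_{a+1}` is the coordinate derivative `∂_a`. -/
def coneD (m : ℝ) (A : Idx n) (f : Eucl n → ℝ) (y : Eucl n) : ℝ :=
  Fin.cases (m * f y) (fun a => pd a f y) A

@[simp] lemma coneD_zero (m : ℝ) (f : Eucl n → ℝ) (y : Eucl n) : coneD m 0 f y = m * f y := rfl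

@[simp] lemma coneD_succ (m : ℝ) (a : Fin n) (f : Eucl n → ℝ) (y : Eucl n) :
    coneD m a.succ f y = pd a f y := rfl

lemma pd_congr {U : Set (Eucl n)} (hU : IsOpen U) {f g : Eucl n → ℝ} (h : ∀ y ∈ U, f y = g y)
    {y : Eucl n} (hy : y ∈ U) (a : Fin n) : pd a f y = pd a g y := by
  unfold pd
  rw [Filter.EventuallyEq.fderiv_eq (Filter.eventuallyEq_of_mem (hU.mem_nhds hy) h)]

lemma coneD_congr {U : Set (Eucl n)} (hU : IsOpen U) {f g : Eucl n → ℝ} (h : ∀ y ∈ U, f y = g y)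
    {y : Eucl n} (hy : y ∈ U) (m : ℝ) (A : Idx n) : coneD m A f y = coneD m A g y := by
  refine Fin.cases ?_ (fun a => ?_) A
  · simp [h y hy]
  · exact pd_congr hU h hy a

lemma diffAt_of_contDiffOn {U : Set (Eucl n)} (hU : IsOpen U) {f : Eucl n → ℝ}
    (hf : ContDiffOn ℝ ∞ f U) {y : Eucl n} (hy : y ∈ U) : DifferentiableAt ℝ f y :=
  (hf.contDiffAt (hU.mem_nhds hy)).differentiableAt (by simp)

lemma pd_add {f g : Eucl n → ℝ} {y : Eucl n} (hf : DifferentiableAt ℝ f y)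
    (hg : DifferentiableAt ℝ g y) (a : Fin n) :
    pd a (fun z => f z + g z) y = pd a f y + pd a g y := by
  simp [pd, fderiv_fun_add hf hg]

lemma pd_sub {f g : Eucl n → ℝ} {y : Eucl n} (hf : DifferentiableAt ℝ f y)
    (hg : DifferentiableAt ℝ g y) (a : Fin n) :
    pd a (fun z => f z - g z) y = pd a f y - pd a g y := by
  simp [pd, fderiv_fun_sub hf hg]

lemma pd_mul {f g : Eucl n → ℝ} {y : Eucl n} (hf : DifferentiableAt ℝ f y)
    (hg : DifferentiableAt ℝ g y) (a : Fin n) :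
    pd a (fun z => f z * g z) y = pd a f y * g y + f y * pd a g y := by
  simp [pd, fderiv_fun_mul hf hg]
  ring

@[simp] lemma pd_const (c : ℝ) (y : Eucl n) (a : Fin n) : pd a (fun _ => c) y = 0 := by
  simp [pd]

lemma pd_const_mul {f : Eucl n → ℝ} {y : Eucl n} (hf : DifferentiableAt ℝ f y) (c : ℝ)
    (a : Fin n) : pd a (fun z => c * f z) y = c * pd a f y := by
  rw [pd_mul (by fun_prop) hf]
  simp

lemma pd_sum {s : Type*} (t : Finset s) {f : s → Eucl n → ℝ} {y : Eucl n}
    (hf : ∀ i ∈ t, DifferentiableAt ℝ (f i) y) (a : Fin n) :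
    pd a (fun z => ∑ i ∈ t, f i z) y = ∑ i ∈ t, pd a (f i) y := by
  simp [pd, fderiv_fun_sum hf]

lemma contDiffOn_pd {U : Set (Eucl n)} (hU : IsOpen U) {f : Eucl n → ℝ}
    (hf : ContDiffOn ℝ ∞ f U) (a : Fin n) : ContDiffOn ℝ ∞ (pd a f) U :=
  (hf.fderiv_of_isOpen hU (m := ∞) (by simp)).clm_apply contDiffOn_const

lemma pd_comm {U : Set (Eucl n)} (hU : IsOpen U) {f : Eucl n → ℝ}
    (hf : ContDiffOn ℝ ∞ f U) {y : Eucl n} (hy : y ∈ U) (a b : Fin n) :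
    pd a (pd b f) y = pd b (pd a f) y := by
  have hs : IsSymmSndFDerivAt ℝ f y :=
    (hf.contDiffAt (hU.mem_nhds hy)).isSymmSndFDerivAt (by simpa using ENat.LEInfty.out)
  have hd : DifferentiableAt ℝ (fderiv ℝ f) y :=
    ((hf.fderiv_of_isOpen hU (m := ∞) (by simp)).contDiffAt (hU.mem_nhds hy)).differentiableAt
      (by simp)
  have key : ∀ c d : Fin n, pd c (pd d f) y
      = fderiv ℝ (fderiv ℝ f) y (basisVec n c) (basisVec n d) := by
    intro c d
    unfold pd
    rw [fderiv_clm_apply hd (by fun_prop)]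
    simp
  rw [key, key]
  exact hs.eq _ _

lemma coneD_sub {f g : Eucl n → ℝ} {y : Eucl n} (hf : DifferentiableAt ℝ f y)
    (hg : DifferentiableAt ℝ g y) (m : ℝ) (A : Idx n) :
    coneD m A (fun z => f z - g z) y = coneD m A f y - coneD m A g y := by
  refine Fin.cases ?_ (fun a => ?_) A
  · simp [mul_sub]
  · exact pd_sub hf hg a

lemma coneD_add {f g : Eucl n → ℝ} {y : Eucl n} (hf : DifferentiableAt ℝ f y)
    (hg : DifferentiableAt ℝ g y) (m : ℝ) (A : Idx n) :
    coneD m A (fun z => f z + g z) y = coneD m A f y + coneD m A g y := by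
  refine Fin.cases ?_ (fun a => ?_) A
  · simp [mul_add]
  · exact pd_add hf hg a

lemma coneD_const_mul {f : Eucl n → ℝ} {y : Eucl n} (hf : DifferentiableAt ℝ f y) (c m : ℝ)
    (A : Idx n) : coneD m A (fun z => c * f z) y = c * coneD m A f y := by
  refine Fin.cases ?_ (fun a => ?_) A
  · simp only [coneD_zero]; ring
  · exact pd_const_mul hf c a

lemma coneD_mul {f g : Eucl n → ℝ} {y : Eucl n} (hf : DifferentiableAt ℝ f y)
    (hg : DifferentiableAt ℝ g y) (m m' : ℝ) (A : Idx n) :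
    coneD (m + m') A (fun z => f z * g z) y = coneD m A f y * g y + f y * coneD m' A g y := by
  refine Fin.cases ?_ (fun a => ?_) A
  · simp only [coneD_zero]; ring
  · exact pd_mul hf hg a

lemma coneD_sum {s : Type*} (t : Finset s) {f : s → Eucl n → ℝ} {y : Eucl n}
    (hf : ∀ i ∈ t, DifferentiableAt ℝ (f i) y) (m : ℝ) (A : Idx n) :
    coneD m A (fun z => ∑ i ∈ t, f i z) y = ∑ i ∈ t, coneD m A (f i) y := by
  refine Fin.cases ?_ (fun a => ?_) A
  · simp [Finset.mul_sum]
  · exact pd_sum t hf a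

lemma contDiffOn_coneD {U : Set (Eucl n)} (hU : IsOpen U) {f : Eucl n → ℝ}
    (hf : ContDiffOn ℝ ∞ f U) (m : ℝ) (A : Idx n) : ContDiffOn ℝ ∞ (coneD m A f) U := by
  refine Fin.cases ?_ (fun a => ?_) A
  · exact contDiffOn_const.mul hf
  · exact contDiffOn_pd hU hf a

lemma coneD_comm {U : Set (Eucl n)} (hU : IsOpen U) {f : Eucl n → ℝ}
    (hf : ContDiffOn ℝ ∞ f U) {y : Eucl n} (hy : y ∈ U) (m : ℝ) (A B : Idx n) :
    coneD m A (coneD m B f) y = coneD m B (coneD m A f) y := by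
  have hd := diffAt_of_contDiffOn hU hf hy
  refine Fin.cases ?_ (fun a => ?_) A <;> refine Fin.cases ?_ (fun b => ?_) B
  · rfl
  · exact (pd_const_mul hd m b).symm
  · exact pd_const_mul hd m a
  · exact pd_comm hU hf hy a b

/-! ### Connections on trivialised bundles over the cone -/

/-- A matrix-valued function with smooth entries. -/
def SmoothMat (U : Set (Eucl n)) (X : Eucl n → Matrix ι κ ℝ) : Prop :=
  ∀ i j, ContDiffOn ℝ ∞ (fun y => X y i j) U

/-- The entrywise derivative of a matrix-valued function, all of whose entries have cone
degree `m`. -/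
def matD (m : ℝ) (A : Idx n) (X : Eucl n → Matrix ι κ ℝ) (y : Eucl n) : Matrix ι κ ℝ :=
  Matrix.of fun i j => coneD m A (fun z => X z i j) y

lemma SmoothMat.mul {U : Set (Eucl n)} {X : Eucl n → Matrix ι κ ℝ} {Y : Eucl n → Matrix κ l ℝ}
    (hX : SmoothMat U X) (hY : SmoothMat U Y) : SmoothMat U (fun y => X y * Y y) := fun i j => by
  simp only [Matrix.mul_apply]
  exact ContDiffOn.sum fun k _ => (hX i k).mul (hY k j)

lemma SmoothMat.sub {U : Set (Eucl n)} {X Y : Eucl n → Matrix ι κ ℝ}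
    (hX : SmoothMat U X) (hY : SmoothMat U Y) : SmoothMat U (fun y => X y - Y y) := fun i j => by
  simpa only [Matrix.sub_apply] using (hX i j).sub (hY i j)

lemma SmoothMat.matD {U : Set (Eucl n)} (hU : IsOpen U) {X : Eucl n → Matrix ι κ ℝ}
    (hX : SmoothMat U X) (m : ℝ) (A : Idx n) : SmoothMat U (matD m A X) := fun i j =>
  contDiffOn_coneD hU (hX i j) m A

lemma SmoothMat.diffAt {U : Set (Eucl n)} (hU : IsOpen U) {X : Eucl n → Matrix ι κ ℝ}
    (hX : SmoothMat U X) {y : Eucl n} (hy : y ∈ U) (i : ι) (j : κ) :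
    DifferentiableAt ℝ (fun z => X z i j) y := diffAt_of_contDiffOn hU (hX i j) hy

section

variable {U : Set (Eucl n)} (hU : IsOpen U) {y : Eucl n} (hy : y ∈ U)
include hU hy

lemma matD_congr {X Y : Eucl n → Matrix ι κ ℝ} (h : ∀ y ∈ U, X y = Y y) (m : ℝ) (A : Idx n) :
    matD m A X y = matD m A Y y := by
  ext i j
  have h' : ∀ z ∈ U, X z i j = Y z i j := fun z hz => by rw [h z hz]
  exact coneD_congr hU h' hy m A

lemma matD_sub {X Y : Eucl n → Matrix ι κ ℝ} (hX : SmoothMat U X) (hY : SmoothMat U Y) (m : ℝ)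
    (A : Idx n) : matD m A (fun z => X z - Y z) y = matD m A X y - matD m A Y y := by
  ext i j
  exact coneD_sub (hX.diffAt hU hy i j) (hY.diffAt hU hy i j) m A

lemma matD_add {X Y : Eucl n → Matrix ι κ ℝ} (hX : SmoothMat U X) (hY : SmoothMat U Y) (m : ℝ)
    (A : Idx n) : matD m A (fun z => X z + Y z) y = matD m A X y + matD m A Y y := by
  ext i j
  exact coneD_add (hX.diffAt hU hy i j) (hY.diffAt hU hy i j) m A

lemma matD_mul {X : Eucl n → Matrix ι κ ℝ} {Y : Eucl n → Matrix κ l ℝ} (hX : SmoothMat U X)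
    (hY : SmoothMat U Y) (m : ℝ) (A : Idx n) :
    matD m A (fun z => X z * Y z) y = matD 0 A X y * Y y + X y * matD m A Y y := by
  ext i j
  simp only [matD, Matrix.of_apply, Matrix.mul_apply, Matrix.add_apply]
  rw [← Finset.sum_add_distrib]
  refine (coneD_sum Finset.univ (f := fun k z => X z i k * Y z k j)
    (fun k _ => (hX.diffAt hU hy i k).mul (hY.diffAt hU hy k j)) m A).trans ?_
  refine Finset.sum_congr rfl fun k _ => ?_
  have := coneD_mul (hX.diffAt hU hy i k) (hY.diffAt hU hy k j) 0 m A
  rwa [zero_add] at this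

lemma matD_comm {X : Eucl n → Matrix ι κ ℝ} (hX : SmoothMat U X) (m : ℝ) (A B : Idx n) :
    matD m A (matD m B X) y = matD m B (matD m A X) y := by
  ext i j
  exact coneD_comm hU (hX i j) hy m A B

end

/-- The covariant derivative `∂_A T - 𝒜_A T` of a section `T` of cone degree `m`. -/
def covD (m : ℝ) (𝒜 : Idx n → Eucl n → Matrix ι ι ℝ) (A : Idx n) (T : Eucl n → Matrix ι κ ℝ)
    (y : Eucl n) : Matrix ι κ ℝ :=
  matD m A T y - 𝒜 A y * T y

/-- The curvature form `∂_A 𝒜_B - ∂_B 𝒜_A - [𝒜_A, 𝒜_B]`. -/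
def curv (𝒜 : Idx n → Eucl n → Matrix ι ι ℝ) (A B : Idx n) (y : Eucl n) : Matrix ι ι ℝ :=
  matD 0 A (𝒜 B) y - matD 0 B (𝒜 A) y - (𝒜 A y * 𝒜 B y - 𝒜 B y * 𝒜 A y)

/-- The covariant derivative `∂_A N - [𝒜_A, N]` of a field of endomorphisms of degree `0`. -/
def endD (𝒜 : Idx n → Eucl n → Matrix ι ι ℝ) (A : Idx n) (N : Eucl n → Matrix ι ι ℝ)
    (y : Eucl n) : Matrix ι ι ℝ :=
  matD 0 A N y - (𝒜 A y * N y - N y * 𝒜 A y)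

/-- The connection form on a tensor product of two bundles. -/
def kronSum (X : Matrix ι ι ℝ) (Y : Matrix κ κ ℝ) : Matrix (ι × κ) (ι × κ) ℝ :=
  X ⊗ₖ (1 : Matrix κ κ ℝ) + (1 : Matrix ι ι ℝ) ⊗ₖ Y

lemma kronSum_add (X X' : Matrix ι ι ℝ) (Y Y' : Matrix κ κ ℝ) :
    kronSum (X + X') (Y + Y') = kronSum X Y + kronSum X' Y' := by
  simp only [kronSum, Matrix.add_kronecker, Matrix.kronecker_add]
  abel

lemma kronSum_sub (X X' : Matrix ι ι ℝ) (Y Y' : Matrix κ κ ℝ) :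
    kronSum (X - X') (Y - Y') = kronSum X Y - kronSum X' Y' := by
  rw [eq_sub_iff_add_eq, ← kronSum_add, sub_add_cancel, sub_add_cancel]

lemma kronSum_commutator (X X' : Matrix ι ι ℝ) (Y Y' : Matrix κ κ ℝ) :
    kronSum X Y * kronSum X' Y' - kronSum X' Y' * kronSum X Y
      = kronSum (X * X' - X' * X) (Y * Y' - Y' * Y) := by
  rw [kronSum_sub]
  simp only [kronSum, add_mul, mul_add, ← Matrix.mul_kronecker_mul, one_mul, mul_one]
  abel

lemma kronSum_mul_apply (X : Matrix ι ι ℝ) (Y : Matrix κ κ ℝ) (T : Matrix (ι × κ) l ℝ) (i : ι)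
    (j : κ) (k : l) : (kronSum X Y * T) (i, j) k
      = ∑ i', X i i' * T (i', j) k + ∑ j', Y j j' * T (i, j') k := by
  simp only [kronSum, add_mul, Matrix.add_apply, Matrix.mul_apply, Matrix.kroneckerMap_apply,
    Fintype.sum_prod_type, Matrix.one_apply]
  simp [Finset.sum_add_distrib]

lemma SmoothMat.kronSum {U : Set (Eucl n)} {X : Eucl n → Matrix ι ι ℝ} {Y : Eucl n → Matrix κ κ ℝ}
    (hX : SmoothMat U X) (hY : SmoothMat U Y) : SmoothMat U (fun y => kronSum (X y) (Y y)) := by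
  rintro ⟨i, j⟩ ⟨i', j'⟩
  simp only [ProjTractor.kronSum, Matrix.add_apply, Matrix.kroneckerMap_apply]
  exact ((hX i i').mul contDiffOn_const).add (contDiffOn_const.mul (hY j j'))

section

variable {U : Set (Eucl n)} (hU : IsOpen U) {y : Eucl n} (hy : y ∈ U)

include hU in
lemma SmoothMat.covD {𝒜 : Idx n → Eucl n → Matrix ι ι ℝ} {T : Eucl n → Matrix ι κ ℝ}
    (h𝒜 : ∀ A, SmoothMat U (𝒜 A)) (hT : SmoothMat U T) (m : ℝ) (A : Idx n) :
    SmoothMat U (covD m 𝒜 A T) := (hT.matD hU m A).sub ((h𝒜 A).mul hT)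

include hU in
lemma SmoothMat.curv {𝒜 : Idx n → Eucl n → Matrix ι ι ℝ}
    (h𝒜 : ∀ A, SmoothMat U (𝒜 A)) (A B : Idx n) : SmoothMat U (curv 𝒜 A B) :=
  (((h𝒜 B).matD hU 0 A).sub ((h𝒜 A).matD hU 0 B)).sub
    (((h𝒜 A).mul (h𝒜 B)).sub ((h𝒜 B).mul (h𝒜 A)))

include hU hy

lemma matD_kronSum {X : Eucl n → Matrix ι ι ℝ} {Y : Eucl n → Matrix κ κ ℝ}
    (hX : SmoothMat U X) (hY : SmoothMat U Y) (A : Idx n) :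
    matD 0 A (fun z => kronSum (X z) (Y z)) y = kronSum (matD 0 A X y) (matD 0 A Y y) := by
  ext ⟨i, j⟩ ⟨i', j'⟩
  simp only [matD, kronSum, Matrix.of_apply, Matrix.add_apply, Matrix.kroneckerMap_apply]
  have hX' := hX.diffAt hU hy i i'
  have hY' := hY.diffAt hU hy j j'
  rw [coneD_add (hX'.mul_const _) (hY'.const_mul _), coneD_const_mul hY']
  simp only [mul_comm _ ((1 : Matrix κ κ ℝ) j j')]
  rw [coneD_const_mul hX']

lemma curv_kronSum {𝒜 : Idx n → Eucl n → Matrix ι ι ℝ} {ℬ : Idx n → Eucl n → Matrix κ κ ℝ}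
    (h𝒜 : ∀ A, SmoothMat U (𝒜 A)) (hℬ : ∀ A, SmoothMat U (ℬ A)) (A B : Idx n) :
    curv (fun C z => kronSum (𝒜 C z) (ℬ C z)) A B y = kronSum (curv 𝒜 A B y) (curv ℬ A B y) := by
  simp only [curv]
  rw [matD_kronSum hU hy (h𝒜 B) (hℬ B), matD_kronSum hU hy (h𝒜 A) (hℬ A), kronSum_commutator]
  simp only [kronSum_sub]

lemma endD_kronSum {𝒜 : Idx n → Eucl n → Matrix ι ι ℝ} {ℬ : Idx n → Eucl n → Matrix κ κ ℝ}
    {X : Eucl n → Matrix ι ι ℝ} {Y : Eucl n → Matrix κ κ ℝ}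
    (hX : SmoothMat U X) (hY : SmoothMat U Y) (A : Idx n) :
    endD (fun C z => kronSum (𝒜 C z) (ℬ C z)) A (fun z => kronSum (X z) (Y z)) y
      = kronSum (endD 𝒜 A X y) (endD ℬ A Y y) := by
  simp only [endD]
  rw [matD_kronSum hU hy hX hY, kronSum_commutator, ← kronSum_sub]

/-- The Ricci identity: second covariant derivatives commute up to the curvature. -/
lemma covD_commutator {𝒜 : Idx n → Eucl n → Matrix ι ι ℝ} {T : Eucl n → Matrix ι κ ℝ}
    (h𝒜 : ∀ A, SmoothMat U (𝒜 A)) (hT : SmoothMat U T) (m : ℝ) (A B : Idx n) :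
    covD m 𝒜 A (covD m 𝒜 B T) y - covD m 𝒜 B (covD m 𝒜 A T) y = - (curv 𝒜 A B y * T y) := by
  have key : ∀ A B, covD m 𝒜 A (covD m 𝒜 B T) y
      = matD m A (matD m B T) y - (matD 0 A (𝒜 B) y * T y + 𝒜 B y * matD m A T y)
        - 𝒜 A y * (matD m B T y - 𝒜 B y * T y) := by
    intro A B
    unfold covD
    rw [matD_sub hU hy (hT.matD hU m B) ((h𝒜 B).mul hT), matD_mul hU hy (h𝒜 B) hT]
  rw [key, key, matD_comm hU hy hT m B A]
  simp only [curv, Matrix.mul_sub, Matrix.sub_mul, Matrix.mul_assoc]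
  abel

lemma covD_mul {𝒜 : Idx n → Eucl n → Matrix ι ι ℝ} {N : Eucl n → Matrix ι ι ℝ}
    {T : Eucl n → Matrix ι κ ℝ} (hN : SmoothMat U N) (hT : SmoothMat U T) (m : ℝ) (A : Idx n) :
    covD m 𝒜 A (fun z => N z * T z) y = endD 𝒜 A N y * T y + N y * covD m 𝒜 A T y := by
  simp only [covD, endD]
  rw [matD_mul hU hy hN hT]
  simp only [Matrix.mul_sub, Matrix.sub_mul, Matrix.mul_assoc]
  abel

end

end ProjTractor

namespace ProjTractor

/-! ### Christoffel symbols in the charts of the atlas -/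

variable {n : ℕ} {M : Type*} [TopologicalSpace M] [ChartedSpace (Eucl n) M]
  [IsManifold (𝓡 n) ∞ M]

lemma chart_contMDiffAt (φ : Chart n M) {x : M} (hx : x ∈ φ.1.source) :
    ContMDiffAt (𝓡 n) 𝓘(ℝ, Eucl n) ∞ φ.1 x :=
  contMDiffAt_of_mem_maximalAtlas (IsManifold.subset_maximalAtlas φ.2) hx

lemma chart_symm_contMDiffAt (φ : Chart n M) {y : Eucl n} (hy : y ∈ φ.1.target) :
    ContMDiffAt 𝓘(ℝ, Eucl n) (𝓡 n) ∞ φ.1.symm y :=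
  contMDiffAt_symm_of_mem_maximalAtlas (IsManifold.subset_maximalAtlas φ.2) hy

lemma chart_mdifferentiable (φ : Chart n M) :
    φ.1.MDifferentiable (𝓡 n) 𝓘(ℝ, Eucl n) :=
  mdifferentiable_of_mem_atlas φ.2

lemma chart_mfderiv_isInvertible (φ : Chart n M) {x : M} (hx : x ∈ φ.1.source) :
    (mfderiv (𝓡 n) 𝓘(ℝ, Eucl n) φ.1 x).IsInvertible :=
  ⟨(chart_mdifferentiable φ).mfderiv hx, rfl⟩

lemma coordField_contMDiffAt (φ : Chart n M) (a : Fin n) {x : M} (hx : x ∈ φ.1.source) :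
    ContMDiffAt (𝓡 n) ((𝓡 n).prod 𝓘(ℝ, Eucl n)) ∞
      (fun x => (⟨x, coordField φ a x⟩ : TangentBundle (𝓡 n) M)) x := by
  refine ContMDiffAt.mpullback_vectorField_preimage (n := ∞) (m := ∞) ?_ (chart_contMDiffAt φ hx)
    (chart_mfderiv_isInvertible φ hx) (by simp)
  exact contMDiffAt_vectorSpace_iff_contDiffAt.2 contDiffAt_const

lemma coordField_mdifferentiableAt (φ : Chart n M) (a : Fin n) {x : M} (hx : x ∈ φ.1.source) :
    MDifferentiableAt (𝓡 n) ((𝓡 n).prod 𝓘(ℝ, Eucl n))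
      (fun x => (⟨x, coordField φ a x⟩ : TangentBundle (𝓡 n) M)) x :=
  (coordField_contMDiffAt φ a hx).mdifferentiableAt (by simp)

@[simp] lemma vecComp_coordField (φ : Chart n M) (a : Fin n) {x : M} (hx : x ∈ φ.1.source) :
    vecComp φ x (coordField φ a x) = basisVec n a := by
  unfold vecComp coordField
  exact (chart_mfderiv_isInvertible φ hx).self_apply_inverse _

lemma vecComp_injective (φ : Chart n M) {x : M} (hx : x ∈ φ.1.source) :
    Function.Injective (vecComp φ x) :=
  (chart_mdifferentiable φ).mfderiv_injective hx

lemma basisVec_apply (a b : Fin n) : basisVec n a b = if b = a then 1 else 0 := by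
  simp only [basisVec, PiLp.single_apply]

lemma eucl_sum_basisVec (v : Eucl n) : v = ∑ a, v a • basisVec n a := by
  ext i
  simp [basisVec_apply]

lemma vecComp_add (φ : Chart n M) (x : M) (u v : TangentSpace (𝓡 n) x) :
    vecComp φ x (u + v) = vecComp φ x u + vecComp φ x v :=
  (mfderiv (𝓡 n) 𝓘(ℝ, Eucl n) φ.1 x).map_add u v

lemma vecComp_smul (φ : Chart n M) (x : M) (c : ℝ) (v : TangentSpace (𝓡 n) x) :
    vecComp φ x (c • v) = c • vecComp φ x v :=
  (mfderiv (𝓡 n) 𝓘(ℝ, Eucl n) φ.1 x).map_smul c v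

lemma vecComp_sum (φ : Chart n M) (x : M) {s : Type*} (t : Finset s)
    (v : s → TangentSpace (𝓡 n) x) :
    vecComp φ x (∑ i ∈ t, v i) = ∑ i ∈ t, vecComp φ x (v i) :=
  map_sum (mfderiv (𝓡 n) 𝓘(ℝ, Eucl n) φ.1 x) v t

/-- A tangent vector is the combination of the coordinate fields with its components. -/
lemma eq_sum_coordField (φ : Chart n M) {x : M} (hx : x ∈ φ.1.source) (v : TangentSpace (𝓡 n) x) :
    v = ∑ a, vecComp φ x v a • coordField φ a x := by
  apply vecComp_injective φ hx
  rw [vecComp_sum]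
  simp only [vecComp_smul, vecComp_coordField φ _ hx]
  exact eucl_sum_basisVec _

/-- A local frame field of a chart can be extended to a global smooth vector field near each
point of the chart. -/
lemma exists_smooth_extension [T2Space M] (φ : Chart n M) (a : Fin n) {x : M}
    (hx : x ∈ φ.1.source) :
    ∃ σ : (x : M) → TangentSpace (𝓡 n) x,
      ContMDiff (𝓡 n) ((𝓡 n).prod 𝓘(ℝ, Eucl n)) ∞
        (fun x => (⟨x, σ x⟩ : TangentBundle (𝓡 n) M)) ∧
      ∀ᶠ z in nhds x, σ z = coordField φ a z := by
  obtain ⟨χ, -, hχ⟩ := (SmoothBumpFunction.nhds_basis_tsupport (I := 𝓡 n) x).mem_iff.1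
    (φ.1.open_source.mem_nhds hx)
  refine ⟨fun z => χ z • coordField φ a z, fun z => ?_, ?_⟩
  · by_cases hz : z ∈ tsupport χ
    · exact ContMDiffAt.smul_section χ.contMDiffAt (coordField_contMDiffAt φ a (hχ hz))
    · have h0 : (fun z => (⟨z, χ z • coordField φ a z⟩ : TangentBundle (𝓡 n) M)) =ᶠ[nhds z]
          fun z => (⟨z, 0⟩ : TangentBundle (𝓡 n) M) := by
        filter_upwards [notMem_tsupport_iff_eventuallyEq.1 hz] with w hw
        rw [hw]
        simp
      exact (Bundle.contMDiff_zeroSection ℝ (TangentSpace (𝓡 n) : M → Type _))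
        |>.contMDiffAt.congr_of_eventuallyEq h0
  · filter_upwards [χ.eventuallyEq_one] with z hz
    rw [hz]
    simp

lemma vecComp_contMDiffAt (φ : Chart n M) {x : M} (hx : x ∈ φ.1.source)
    {Z : (x : M) → TangentSpace (𝓡 n) x}
    (hZ : ContMDiffAt (𝓡 n) ((𝓡 n).prod 𝓘(ℝ, Eucl n)) ∞
      (fun x => (⟨x, Z x⟩ : TangentBundle (𝓡 n) M)) x) :
    ContMDiffAt (𝓡 n) 𝓘(ℝ, Eucl n) ∞ (fun z => vecComp φ z (Z z)) x := by
  have hφ : ContMDiffOn (𝓡 n) 𝓘(ℝ, Eucl n) ∞ φ.1 φ.1.source := fun z hz =>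
    (chart_contMDiffAt φ hz).contMDiffWithinAt
  have h1 := hφ.contMDiffOn_tangentMapWithin (m := ∞) (by simp) φ.1.open_source.uniqueMDiffOn
  have ho : IsOpen (Bundle.TotalSpace.proj ⁻¹' φ.1.source : Set (TangentBundle (𝓡 n) M)) :=
    φ.1.open_source.preimage (FiberBundle.continuous_proj (Eucl n) (TangentSpace (𝓡 n)))
  have h2 := (h1.contMDiffAt (x := ⟨x, Z x⟩) (ho.mem_nhds hx)).comp x hZ
  have h3 := (contMDiff_snd_tangentBundle_modelSpace (n := ∞) (Eucl n)
    𝓘(ℝ, Eucl n)).contMDiffAt.comp x h2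
  refine h3.congr_of_eventuallyEq ?_
  filter_upwards [φ.1.open_source.mem_nhds hx] with z hz
  simp only [Function.comp, tangentMapWithin, vecComp]
  rw [mfderivWithin_of_isOpen φ.1.open_source hz]

lemma cov_congr (nab : AffineConnection n M) {σ σ' : (x : M) → TangentSpace (𝓡 n) x} {x : M}
    (hσ : MDifferentiableAt (𝓡 n) ((𝓡 n).prod 𝓘(ℝ, Eucl n))
      (fun x => (⟨x, σ x⟩ : TangentBundle (𝓡 n) M)) x)
    (hσ' : MDifferentiableAt (𝓡 n) ((𝓡 n).prod 𝓘(ℝ, Eucl n))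
      (fun x => (⟨x, σ' x⟩ : TangentBundle (𝓡 n) M)) x)
    (h : ∀ᶠ z in nhds x, σ z = σ' z) : nab.cov σ x = nab.cov σ' x :=
  nab.cov.isCovariantDerivativeOnUniv.congr_of_eventuallyEq hσ hσ' Filter.univ_mem h

lemma cov_coordField_contMDiffAt [T2Space M] (nab : AffineConnection n M) (φ : Chart n M)
    (a b : Fin n) {x : M} (hx : x ∈ φ.1.source) :
    ContMDiffAt (𝓡 n) ((𝓡 n).prod 𝓘(ℝ, Eucl n)) ∞
      (fun x => (⟨x, nab.cov (coordField φ b) x (coordField φ a x)⟩ : TangentBundle (𝓡 n) M))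
      x := by
  obtain ⟨σ, hσ, hσe⟩ := exists_smooth_extension φ b hx
  have h1 := nab.smooth.contMDiff.contMDiff (σ := σ) (by simpa using hσ.contMDiffOn)
  have h2 := ContMDiffAt.clm_bundle_apply (h1.contMDiffAt Filter.univ_mem)
    (coordField_contMDiffAt φ a hx)
  refine h2.congr_of_eventuallyEq ?_
  filter_upwards [hσe.eventually_nhds, φ.1.open_source.mem_nhds hx] with z hz hzs
  have : nab.cov (coordField φ b) z = nab.cov σ z :=
    cov_congr nab (coordField_mdifferentiableAt φ b hzs) ((hσ z).mdifferentiableAt (by simp))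
      (hz.mono fun _ h => h.symm)
  rw [this]

/-- Christoffel symbols are smooth. -/
lemma contDiffOn_christoffel [T2Space M] (nab : AffineConnection n M) (φ : Chart n M)
    (a b c : Fin n) : ContDiffOn ℝ ∞ (christoffel nab φ a b c) φ.1.target := by
  intro y hy
  have hx := φ.1.map_target hy
  have h1 := vecComp_contMDiffAt φ hx (cov_coordField_contMDiffAt nab φ a b hx)
  have h2 := (h1.comp y (chart_symm_contMDiffAt φ hy)).contDiffAt
  exact ((contDiffAt_euclidean.1 h2) c).contDiffWithinAt

/-- Christoffel symbols of a torsion-free connection are symmetric. -/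
lemma christoffel_symm (nab : AffineConnection n M) (φ : Chart n M) (a b c : Fin n)
    {y : Eucl n} (hy : y ∈ φ.1.target) :
    christoffel nab φ a b c y = christoffel nab φ b a c y := by
  have hx := φ.1.map_target hy
  have h := nab.cov.torsion_apply (coordField_mdifferentiableAt φ a hx)
    (coordField_mdifferentiableAt φ b hx)
  have hb : mlieBracket (𝓡 n) (coordField φ a) (coordField φ b) (φ.1.symm y) = 0 := by
    have : IsManifold (𝓡 n) (minSmoothness ℝ 2) M := by
      rw [minSmoothness_of_isRCLikeNormedField]
      infer_instance
    have hc : ∀ c : Fin n, MDifferentiableAt 𝓘(ℝ, Eucl n) (𝓘(ℝ, Eucl n).prod 𝓘(ℝ, Eucl n))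
        (fun z => (⟨z, basisVec n c⟩ : TangentBundle 𝓘(ℝ, Eucl n) (Eucl n)))
        (φ.1 (φ.1.symm y)) := fun c =>
      (contMDiffAt_vectorSpace_iff_contDiffAt (n := 1).2 contDiffAt_const).mdifferentiableAt
        one_ne_zero
    refine (mpullback_mlieBracket (n := ∞) (hc a) (hc b) (chart_contMDiffAt φ hx)
      (by simpa using ENat.LEInfty.out)).symm.trans ?_
    have e := congrFun (mlieBracketWithin_eq_lieBracketWithin (𝕜 := ℝ) (V := fun _ => basisVec n a)
      (W := fun _ => basisVec n b) (s := Set.univ)) (φ.1 (φ.1.symm y))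
    have e' : lieBracketWithin ℝ (fun _ => basisVec n a) (fun _ => basisVec n b) Set.univ
      (φ.1 (φ.1.symm y)) = 0 := by simp [lieBracketWithin]
    have e2 := congrFun (mlieBracketWithin_univ (I := 𝓘(ℝ, Eucl n)) (V := fun _ => basisVec n a)
      (W := fun _ => basisVec n b)) (φ.1 (φ.1.symm y))
    exact (congrArg (mfderiv (𝓡 n) 𝓘(ℝ, Eucl n) φ.1 (φ.1.symm y)).inverse
      (e2.symm.trans (e.trans e'))).trans (map_zero _)
  rw [nab.torsion_free, hb, sub_zero] at h
  have h' := sub_eq_zero.1 h.symm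
  unfold christoffel
  rw [h']

/-- Projectively equivalent connections have Christoffel symbols related by a one-form. -/
lemma ProjEquiv.exists_christoffel {nab nab' : AffineConnection n M} (h : ProjEquiv nab nab')
    (φ : Chart n M) {y : Eucl n} (hy : y ∈ φ.1.target) :
    ∃ u : Fin n → ℝ, ∀ a b c, christoffel nab' φ a b c y = christoffel nab φ a b c y
      + u a * (if c = b then 1 else 0) + u b * (if c = a then 1 else 0) := by
  obtain ⟨Υ, -, h⟩ := h
  have hx := φ.1.map_target hy
  refine ⟨fun a => Υ _ (coordField φ a (φ.1.symm y)), fun a b c => ?_⟩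
  unfold christoffel
  rw [h _ _ (coordField_mdifferentiableAt φ b hx)]
  simp only [vecComp_add, vecComp_smul, vecComp_coordField φ _ hx]
  simp [basisVec_apply]

/-! ### Coordinate changes -/

lemma mem_overlap {φ ψ : Chart n M} {y : Eucl n} :
    y ∈ overlap φ ψ ↔ y ∈ φ.1.target ∧ φ.1.symm y ∈ ψ.1.source := by
  simp [overlap]

lemma isOpen_overlap (φ ψ : Chart n M) : IsOpen (overlap φ ψ) :=
  (φ.1.symm.trans ψ.1).open_source

lemma coordChange_mem_overlap {φ ψ : Chart n M} {y : Eucl n} (hy : y ∈ overlap φ ψ) :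
    coordChange φ ψ y ∈ overlap ψ φ := by
  rw [mem_overlap] at hy ⊢
  refine ⟨ψ.1.map_source hy.2, ?_⟩
  rw [coordChange, ψ.1.left_inv hy.2]
  exact φ.1.map_target hy.1

lemma coordChange_coordChange {φ ψ : Chart n M} {y : Eucl n} (hy : y ∈ overlap φ ψ) :
    coordChange ψ φ (coordChange φ ψ y) = y := by
  rw [mem_overlap] at hy
  rw [coordChange, coordChange, ψ.1.left_inv hy.2, φ.1.right_inv hy.1]

lemma coordChange_contDiffAt {φ ψ : Chart n M} {y : Eucl n} (hy : y ∈ overlap φ ψ) :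
    ContDiffAt ℝ ∞ (coordChange φ ψ) y := by
  rw [mem_overlap] at hy
  exact ((chart_contMDiffAt ψ hy.2).comp y (chart_symm_contMDiffAt φ hy.1)).contDiffAt

lemma contDiffOn_coordChange (φ ψ : Chart n M) : ContDiffOn ℝ ∞ (coordChange φ ψ) (overlap φ ψ) :=
  fun _ hy => (coordChange_contDiffAt hy).contDiffWithinAt

lemma jacobian_apply (φ ψ : Chart n M) {y : Eucl n} (hy : y ∈ overlap φ ψ) (a b : Fin n) :
    jacobian φ ψ y a b = pd a (fun z => coordChange φ ψ z b) y := by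
  have hd := (coordChange_contDiffAt hy).differentiableAt (by simp)
  have := ((EuclideanSpace.proj (𝕜 := ℝ) b : Eucl n →L[ℝ] ℝ).hasFDerivAt.comp y
    hd.hasFDerivAt).fderiv
  simp only [Function.comp_def, EuclideanSpace.coe_proj] at this
  rw [pd, this]
  rfl

lemma contDiffOn_jacobian (φ ψ : Chart n M) (a b : Fin n) :
    ContDiffOn ℝ ∞ (fun y => jacobian φ ψ y a b) (overlap φ ψ) := by
  refine (contDiffOn_pd (isOpen_overlap φ ψ) (f := fun z => coordChange φ ψ z b) ?_ a).congr
    fun y hy => jacobian_apply φ ψ hy a b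
  exact contDiffOn_euclidean.1 (contDiffOn_coordChange φ ψ) b

/-- The derivatives of the Jacobian are symmetric. -/
lemma pd_jacobian_symm (φ ψ : Chart n M) {y : Eucl n} (hy : y ∈ overlap φ ψ) (a b c : Fin n) :
    pd a (fun z => jacobian φ ψ z b c) y = pd b (fun z => jacobian φ ψ z a c) y := by
  have ho := isOpen_overlap φ ψ
  rw [pd_congr ho (fun z hz => jacobian_apply φ ψ hz b c) hy,
    pd_congr ho (fun z hz => jacobian_apply φ ψ hz a c) hy]
  exact pd_comm ho (contDiffOn_euclidean.1 (contDiffOn_coordChange φ ψ) c) hy a b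

/-- The chain rule for functions pulled back along a coordinate change. -/
lemma pd_comp_coordChange {φ ψ : Chart n M} {y : Eucl n} (hy : y ∈ overlap φ ψ)
    {f : Eucl n → ℝ} (hf : DifferentiableAt ℝ f (coordChange φ ψ y)) (a : Fin n) :
    pd a (fun z => f (coordChange φ ψ z)) y
      = ∑ b, jacobian φ ψ y a b * pd b f (coordChange φ ψ y) := by
  have hd := (coordChange_contDiffAt hy).differentiableAt (by simp)
  have h := fderiv_comp y hf hd
  simp only [Function.comp_def] at h
  rw [pd, h, ContinuousLinearMap.comp_apply,
    eucl_sum_basisVec (fderiv ℝ (coordChange φ ψ) y (basisVec n a)), map_sum]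
  simp [jacobian, pd]

/-- The Jacobians of a coordinate change and of its inverse are inverse matrices. -/
lemma jacobian_mul_jacobian {φ ψ : Chart n M} {y : Eucl n} (hy : y ∈ overlap φ ψ) :
    jacobian φ ψ y * jacobian ψ φ (coordChange φ ψ y) = 1 := by
  ext a b
  have hy' := coordChange_mem_overlap hy
  have hd : DifferentiableAt ℝ (fun z => coordChange ψ φ z b) (coordChange φ ψ y) :=
    (contDiffAt_euclidean.1 (coordChange_contDiffAt hy') b).differentiableAt (by simp)
  have h := pd_comp_coordChange hy hd a
  rw [Matrix.mul_apply]
  simp only [jacobian_apply ψ φ hy']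
  rw [← h, pd_congr (isOpen_overlap φ ψ) (g := fun z => z b)
    (fun z hz => by rw [coordChange_coordChange hz]) hy]
  have : pd a (fun z : Eucl n => z b) y = basisVec n a b := by
    have h2 := ((EuclideanSpace.proj (𝕜 := ℝ) b : Eucl n →L[ℝ] ℝ).hasFDerivAt (x := y)).fderiv
    simp only [EuclideanSpace.coe_proj] at h2
    rw [pd, h2]
    rfl
  rw [this, basisVec_apply, Matrix.one_apply]
  simp [eq_comm]

/-- The components of a tangent vector in two charts. -/
lemma vecComp_change (φ ψ : Chart n M) {x : M} (hx : x ∈ φ.1.source) (hx' : x ∈ ψ.1.source)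
    (v : TangentSpace (𝓡 n) x) (d : Fin n) :
    vecComp ψ x v d = ∑ c, vecComp φ x v c * jacobian φ ψ (φ.1 x) c d := by
  have hy : φ.1 x ∈ overlap φ ψ := by
    rw [mem_overlap, φ.1.left_inv hx]
    exact ⟨φ.1.map_source hx, hx'⟩
  have hd := (coordChange_contDiffAt hy).differentiableAt (by simp)
  have h1 : mfderiv (𝓡 n) 𝓘(ℝ, Eucl n) ψ.1 x
      = mfderiv (𝓡 n) 𝓘(ℝ, Eucl n) (coordChange φ ψ ∘ φ.1) x := by
    refine Filter.EventuallyEq.mfderiv_eq ?_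
    filter_upwards [φ.1.open_source.mem_nhds hx] with z hz
    simp [coordChange, φ.1.left_inv hz]
  rw [mfderiv_comp x hd.mdifferentiableAt ((chart_mdifferentiable φ).mdifferentiableAt hx)] at h1
  have h2 : vecComp ψ x v = fderiv ℝ (coordChange φ ψ) (φ.1 x) (vecComp φ x v) := by
    unfold vecComp
    rw [h1, mfderiv_eq_fderiv]
    rfl
  rw [h2, eucl_sum_basisVec (vecComp φ x v), map_sum]
  simp [jacobian, basisVec_apply]

lemma coordField_change (φ ψ : Chart n M) (b : Fin n) {x : M} (hx : x ∈ φ.1.source)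
    (hx' : x ∈ ψ.1.source) :
    coordField φ b x = ∑ c, jacobian φ ψ (φ.1 x) b c • coordField ψ c x := by
  conv_lhs => rw [eq_sum_coordField ψ hx' (coordField φ b x)]
  refine Finset.sum_congr rfl fun c _ => ?_
  rw [vecComp_change φ ψ hx hx', vecComp_coordField φ b hx]
  simp [basisVec_apply]

lemma cov_sum_smul (nab : AffineConnection n M) {s : Type*} (t : Finset s) (g : s → M → ℝ)
    (Z : s → (x : M) → TangentSpace (𝓡 n) x) {x : M}
    (hg : ∀ i, MDifferentiableAt (𝓡 n) 𝓘(ℝ, ℝ) (g i) x)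
    (hZ : ∀ i, MDifferentiableAt (𝓡 n) ((𝓡 n).prod 𝓘(ℝ, Eucl n))
      (fun x => (⟨x, Z i x⟩ : TangentBundle (𝓡 n) M)) x) (u : TangentSpace (𝓡 n) x) :
    nab.cov (fun z => ∑ i ∈ t, g i z • Z i z) x u
      = ∑ i ∈ t, (g i x • nab.cov (Z i) x u
          + mvfderiv (𝓡 n) (g i) x u • Z i x) := by
  classical
  induction t using Finset.induction_on with
  | empty =>
    have h := congrFun (CovariantDerivative.zero nab.cov) x
    have h' := congrArg (fun L => L u) h
    simp only [Finset.sum_empty]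
    exact h'
  | insert i t hi ih =>
    simp only [Finset.sum_insert hi]
    rw [← ih]
    have h1 := (hg i).smul_section (hZ i)
    have h2 := MDifferentiableAt.sum_section (s := t)
      (fun j (_ : j ∈ t) => (hg j).smul_section (hZ j))
    have h := nab.cov.isCovariantDerivativeOnUniv.add h1 h2
    have h' := DFunLike.congr_fun h u
    have h3 := nab.cov.isCovariantDerivativeOnUniv.leibniz (hZ i) (hg i)
    have h4 := DFunLike.congr_fun h3 u
    exact h'.trans (congrArg₂ (· + ·) h4 rfl)

/-- The transformation law of Christoffel symbols under coordinate changes. -/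
lemma christoffel_change (nab : AffineConnection n M) {φ ψ : Chart n M} {y : Eucl n}
    (hy : y ∈ overlap φ ψ) (a b d : Fin n) :
    ∑ c, christoffel nab φ a b c y * jacobian φ ψ y c d
      = pd a (fun z => jacobian φ ψ z b d) y
        + ∑ e, ∑ f, jacobian φ ψ y a e * jacobian φ ψ y b f
          * christoffel nab ψ e f d (coordChange φ ψ y) := by
  have hy' := mem_overlap.1 hy
  have hx := φ.1.map_target hy'.1
  set x := φ.1.symm y with hxdef
  have hφx : φ.1 x = y := φ.1.right_inv hy'.1
  have hψ : ψ.1.symm (coordChange φ ψ y) = x := ψ.1.left_inv hy'.2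
  have hJ : ∀ c, DifferentiableAt ℝ (fun z => jacobian φ ψ z b c) y := fun c =>
    diffAt_of_contDiffOn (isOpen_overlap φ ψ) (contDiffOn_jacobian φ ψ b c) hy
  have hJ' : ∀ c, MDifferentiableAt 𝓘(ℝ, Eucl n) 𝓘(ℝ, ℝ) (fun z => jacobian φ ψ z b c)
      (φ.1 x) := fun c => by rw [hφx]; exact (hJ c).mdifferentiableAt
  have hφd := (chart_mdifferentiable φ).mdifferentiableAt hx
  have hg : ∀ c, MDifferentiableAt (𝓡 n) 𝓘(ℝ, ℝ) (fun z => jacobian φ ψ (φ.1 z) b c) x :=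
    fun c => (hJ' c).comp x hφd
  have hZ := fun c => coordField_mdifferentiableAt ψ c hy'.2
  have h1 : nab.cov (coordField φ b) x
      = nab.cov (fun z => ∑ c, jacobian φ ψ (φ.1 z) b c • coordField ψ c z) x := by
    refine cov_congr nab (coordField_mdifferentiableAt φ b hx)
      (MDifferentiableAt.sum_section fun c _ => (hg c).smul_section (hZ c)) ?_
    filter_upwards [φ.1.open_source.mem_nhds hx, ψ.1.open_source.mem_nhds hy'.2] with z hz hz'
    exact coordField_change φ ψ b hz hz'
  have h2 : ∀ c, mvfderiv (𝓡 n) (fun z => jacobian φ ψ (φ.1 z) b c) x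
      (coordField φ a x) = pd a (fun z => jacobian φ ψ z b c) y := by
    intro c
    have h3 := mfderiv_comp x (hJ' c) hφd
    have h4 : mfderiv (𝓡 n) 𝓘(ℝ, ℝ) (fun z => jacobian φ ψ (φ.1 z) b c) x
      = mfderiv (𝓡 n) 𝓘(ℝ, ℝ) ((fun z => jacobian φ ψ z b c) ∘ φ.1) x := rfl
    change mfderiv (𝓡 n) 𝓘(ℝ, ℝ) (fun z => jacobian φ ψ (φ.1 z) b c) x (coordField φ a x) = _
    rw [h4, h3, mfderiv_eq_fderiv, hφx]
    change fderiv ℝ (fun z => jacobian φ ψ z b c) y (vecComp φ x (coordField φ a x)) = _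
    rw [vecComp_coordField φ a hx]
    rfl
  have h5 := vecComp_change φ ψ hx hy'.2 (nab.cov (coordField φ b) x (coordField φ a x)) d
  rw [hφx] at h5
  change ∑ c, vecComp φ x (nab.cov (coordField φ b) x (coordField φ a x)) c * _ = _
  rw [← h5, h1, cov_sum_smul nab _ _ _ hg hZ, vecComp_sum]
  simp only [vecComp_add, vecComp_smul, h2]
  have h6 : ∀ f, vecComp ψ x (nab.cov (coordField ψ f) x (coordField φ a x)) d
      = ∑ e, jacobian φ ψ y a e * christoffel nab ψ e f d (coordChange φ ψ y) := by
    intro f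
    rw [coordField_change φ ψ a hx hy'.2, map_sum, vecComp_sum, hφx]
    unfold christoffel
    rw [hψ, WithLp.ofLp_sum, Finset.sum_apply]
    refine Finset.sum_congr rfl fun e _ => ?_
    rw [map_smul, vecComp_smul]
    rfl
  rw [WithLp.ofLp_sum, Finset.sum_apply]
  simp only [PiLp.add_apply, PiLp.smul_apply, smul_eq_mul, h6, hφx,
    vecComp_coordField ψ _ hy'.2, basisVec_apply, Finset.sum_add_distrib, Finset.mul_sum]
  rw [add_comm, Finset.sum_comm]
  congr 1
  · simp
  · refine Finset.sum_congr rfl fun e _ => Finset.sum_congr rfl fun f _ => ?_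
    ring

end ProjTractor

namespace ProjTractor

variable {n : ℕ} {M : Type*} [TopologicalSpace M] [ChartedSpace (Eucl n) M]
  [IsManifold (𝓡 n) ∞ M]

/-! ### The tractor connection in a chart -/

/-- Thomas's projective parameters: the trace-free part of the Christoffel symbols, which only
depends on the projective class. -/
def thomasCoeff (nab : AffineConnection n M) (φ : Chart n M) (a b c : Fin n) (y : Eucl n) : ℝ :=
  christoffel nab φ a b c y - densityForm nab φ a y * (if c = b then 1 else 0)
    - densityForm nab φ b y * (if c = a then 1 else 0)

/-- The Ricci tensor formed from Thomas's projective parameters. -/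
def thomasRicci (nab : AffineConnection n M) (φ : Chart n M) (a b : Fin n) (y : Eucl n) : ℝ :=
  ∑ c, pd c (thomasCoeff nab φ a b c) y
    - ∑ c, ∑ e, thomasCoeff nab φ a e c y * thomasCoeff nab φ c b e y

lemma contDiffOn_densityForm [T2Space M] (nab : AffineConnection n M) (φ : Chart n M)
    (a : Fin n) : ContDiffOn ℝ ∞ (densityForm nab φ a) φ.1.target :=
  (ContDiffOn.sum fun c _ => contDiffOn_christoffel nab φ a c c).div_const _

lemma contDiffOn_thomasCoeff [T2Space M] (nab : AffineConnection n M) (φ : Chart n M)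
    (a b c : Fin n) : ContDiffOn ℝ ∞ (thomasCoeff nab φ a b c) φ.1.target :=
  ((contDiffOn_christoffel nab φ a b c).sub
    ((contDiffOn_densityForm nab φ a).mul contDiffOn_const)).sub
    ((contDiffOn_densityForm nab φ b).mul contDiffOn_const)

lemma contDiffOn_thomasRicci [T2Space M] (nab : AffineConnection n M) (φ : Chart n M)
    (a b : Fin n) : ContDiffOn ℝ ∞ (thomasRicci nab φ a b) φ.1.target :=
  (ContDiffOn.sum fun c _ => contDiffOn_pd φ.1.open_target
    (contDiffOn_thomasCoeff nab φ a b c) c).sub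
    (ContDiffOn.sum fun c _ => ContDiffOn.sum fun e _ =>
      (contDiffOn_thomasCoeff nab φ a e c).mul (contDiffOn_thomasCoeff nab φ c b e))

lemma densityForm_mul (nab : AffineConnection n M) (φ : Chart n M) (a : Fin n) (y : Eucl n) :
    ((n : ℝ) + 1) * densityForm nab φ a y = ∑ c, christoffel nab φ a c c y := by
  rw [densityForm, mul_div_cancel₀]
  positivity

lemma thomasCoeff_symm (nab : AffineConnection n M) (φ : Chart n M) (a b c : Fin n)
    {y : Eucl n} (hy : y ∈ φ.1.target) :
    thomasCoeff nab φ a b c y = thomasCoeff nab φ b a c y := by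
  rw [thomasCoeff, thomasCoeff, christoffel_symm nab φ a b c hy]
  ring

lemma thomasCoeff_trace (nab : AffineConnection n M) (φ : Chart n M) (a : Fin n) (y : Eucl n) :
    ∑ c, thomasCoeff nab φ a c c y = 0 := by
  simp only [thomasCoeff, Finset.sum_sub_distrib, ← densityForm_mul]
  simp
  ring

lemma thomasCoeff_trace_left (nab : AffineConnection n M) (φ : Chart n M) (a : Fin n)
    {y : Eucl n} (hy : y ∈ φ.1.target) : ∑ c, thomasCoeff nab φ c a c y = 0 := by
  rw [← thomasCoeff_trace nab φ a y]
  exact Finset.sum_congr rfl fun c _ => thomasCoeff_symm nab φ c a c hy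

lemma thomasRicci_symm (nab : AffineConnection n M) (φ : Chart n M) (a b : Fin n)
    {y : Eucl n} (hy : y ∈ φ.1.target) :
    thomasRicci nab φ a b y = thomasRicci nab φ b a y := by
  unfold thomasRicci
  congr 1
  · exact Finset.sum_congr rfl fun c _ =>
      pd_congr φ.1.open_target (fun z hz => thomasCoeff_symm nab φ a b c hz) hy c
  · rw [Finset.sum_comm]
    refine Finset.sum_congr rfl fun c _ => Finset.sum_congr rfl fun e _ => ?_
    rw [thomasCoeff_symm nab φ a c e hy, thomasCoeff_symm nab φ e b c hy]
    ring

lemma ProjEquiv.thomasCoeff_eq {nab nab' : AffineConnection n M} (h : ProjEquiv nab nab')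
    (φ : Chart n M) (a b c : Fin n) {y : Eucl n} (hy : y ∈ φ.1.target) :
    thomasCoeff nab' φ a b c y = thomasCoeff nab φ a b c y := by
  obtain ⟨u, hu⟩ := h.exists_christoffel φ hy
  have hθ : ∀ a, densityForm nab' φ a y = densityForm nab φ a y + u a := by
    intro a
    have h1 := densityForm_mul nab' φ a y
    have h2 := densityForm_mul nab φ a y
    simp only [hu, Finset.sum_add_distrib, ← h2] at h1
    simp only [if_true, mul_one, Finset.sum_const, Finset.card_univ, Fintype.card_fin,
      nsmul_eq_mul, mul_ite, mul_zero, Finset.sum_ite_eq', Finset.mem_univ] at h1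
    have h3 : ((n : ℝ) + 1) ≠ 0 := by positivity
    apply mul_left_cancel₀ h3
    linarith
  simp only [thomasCoeff, hθ, hu]
  ring

lemma ProjEquiv.thomasRicci_eq {nab nab' : AffineConnection n M} (h : ProjEquiv nab nab')
    (φ : Chart n M) (a b : Fin n) {y : Eucl n} (hy : y ∈ φ.1.target) :
    thomasRicci nab' φ a b y = thomasRicci nab φ a b y := by
  unfold thomasRicci
  congr 1
  · exact Finset.sum_congr rfl fun c _ =>
      pd_congr φ.1.open_target (fun z hz => h.thomasCoeff_eq φ a b c hz) hy c
  · simp only [h.thomasCoeff_eq φ _ _ _ hy]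

lemma christoffel_eq_thomasCoeff (nab : AffineConnection n M) (φ : Chart n M) (a b c : Fin n)
    (y : Eucl n) : christoffel nab φ a b c y = thomasCoeff nab φ a b c y
      + densityForm nab φ a y * (if c = b then 1 else 0)
      + densityForm nab φ b y * (if c = a then 1 else 0) := by
  rw [thomasCoeff]; ring

lemma ricci_eq [T2Space M] (nab : AffineConnection n M) (φ : Chart n M) (b d : Fin n)
    {y : Eucl n} (hy : y ∈ φ.1.target) :
    ricci nab φ b d y = thomasRicci nab φ b d y + pd d (densityForm nab φ b) y
      - n * pd b (densityForm nab φ d) y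
      + (n - 1) * (∑ e, densityForm nab φ e y * thomasCoeff nab φ b d e y
          + densityForm nab φ b y * densityForm nab φ d y) := by
  have hU := φ.1.open_target
  have hθ := fun a => diffAt_of_contDiffOn hU (contDiffOn_densityForm nab φ a) hy
  have hT := fun a b c => diffAt_of_contDiffOn hU (contDiffOn_thomasCoeff nab φ a b c) hy
  have hΓ := fun a b c => diffAt_of_contDiffOn hU (contDiffOn_christoffel nab φ a b c) hy
  have h1 : ∑ c, pd c (christoffel nab φ b d c) y = ∑ c, pd c (thomasCoeff nab φ b d c) y
      + pd d (densityForm nab φ b) y + pd b (densityForm nab φ d) y := by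
    have h : ∀ c, pd c (christoffel nab φ b d c) y = pd c (thomasCoeff nab φ b d c) y
        + pd c (densityForm nab φ b) y * (if c = d then 1 else 0)
        + pd c (densityForm nab φ d) y * (if c = b then 1 else 0) := by
      intro c
      have d1 := hT b d c
      have d2 := hθ b
      have d3 := hθ d
      rw [pd_congr hU (fun z _ => christoffel_eq_thomasCoeff nab φ b d c z) hy,
        pd_add (by fun_prop) (by fun_prop), pd_add (by fun_prop) (by fun_prop),
        pd_mul (by fun_prop) (by fun_prop), pd_mul (by fun_prop) (by fun_prop)]
      simp
    simp only [h, Finset.sum_add_distrib]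
    simp
  have h2 : ∑ c, pd b (christoffel nab φ c d c) y = (n + 1) * pd b (densityForm nab φ d) y := by
    rw [← pd_const_mul (hθ d), pd_congr hU (fun z _ => densityForm_mul nab φ d z) hy,
      pd_sum _ fun c _ => hΓ d c c]
    exact Finset.sum_congr rfl fun c _ =>
      pd_congr hU (fun z hz => christoffel_symm nab φ c d c hz) hy b
  have h3 : ∑ c, ∑ e, christoffel nab φ c e c y * christoffel nab φ b d e y
      = (n + 1) * (∑ e, densityForm nab φ e y * thomasCoeff nab φ b d e y
          + 2 * (densityForm nab φ b y * densityForm nab φ d y)) := by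
    have h : ∀ e, ∑ c, christoffel nab φ c e c y = (n + 1) * densityForm nab φ e y := fun e => by
      rw [densityForm_mul]
      exact Finset.sum_congr rfl fun c _ => christoffel_symm nab φ c e c hy
    rw [Finset.sum_comm]
    simp only [← Finset.sum_mul, h, christoffel_eq_thomasCoeff nab φ b d, mul_add,
      Finset.sum_add_distrib]
    simp only [mul_ite, mul_one, mul_zero, Finset.sum_ite_eq', Finset.mem_univ,
      if_true, Finset.mul_sum, mul_assoc]
    ring
  have h4 : ∑ c, ∑ e, christoffel nab φ b e c y * christoffel nab φ c d e y
      = ∑ c, ∑ e, thomasCoeff nab φ b e c y * thomasCoeff nab φ c d e y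
        + 2 * ∑ e, densityForm nab φ e y * thomasCoeff nab φ b d e y
        + (n + 3) * (densityForm nab φ b y * densityForm nab φ d y) := by
    simp only [christoffel_eq_thomasCoeff, mul_add, add_mul, Finset.sum_add_distrib]
    have t1 := thomasCoeff_trace nab φ b y
    have t2 := thomasCoeff_trace_left nab φ d hy
    simp only [mul_ite, ite_mul, mul_one, mul_zero, zero_mul, Finset.sum_ite_eq',
      Finset.sum_ite_eq, Finset.mem_univ, if_true, Finset.sum_const, Finset.card_univ,
      Fintype.card_fin, nsmul_eq_mul]
    have t3 : ∑ c, ∑ e, (if c = b then densityForm nab φ e y * thomasCoeff nab φ c d e y else 0)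
        = ∑ e, densityForm nab φ e y * thomasCoeff nab φ b d e y := by
      rw [Finset.sum_comm]
      simp
    rw [t3, ← Finset.mul_sum, ← Finset.sum_mul, t1, t2]
    simp only [mul_comm (thomasCoeff nab φ b d _ y)]
    ring
  unfold ricci curvature thomasRicci
  simp only [Finset.sum_add_distrib, Finset.sum_sub_distrib]
  rw [h1, h2, h3, h4]
  ring

/-- The left-hand side is the Schouten tensor after passing from the splitting of the cotractor
bundle by `∇` to its splitting by the chart. The right-hand side depends on the projective class
alone. -/
lemma schouten_eq [T2Space M] (hn : 2 ≤ n) (nab : AffineConnection n M) (φ : Chart n M)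
    (a b : Fin n) {y : Eucl n} (hy : y ∈ φ.1.target) :
    schouten nab φ a b y + pd a (densityForm nab φ b) y
      - ∑ c, christoffel nab φ a b c y * densityForm nab φ c y
      + densityForm nab φ a y * densityForm nab φ b y = thomasRicci nab φ a b y / (n - 1) := by
  have hn' : (2 : ℝ) ≤ n := by exact_mod_cast hn
  have h1 : (n : ℝ) - 1 ≠ 0 := by linarith
  have h2 : (n : ℝ) ^ 2 - 1 ≠ 0 := by nlinarith
  have h3 : ∑ c, christoffel nab φ a b c y * densityForm nab φ c y
      = ∑ e, densityForm nab φ e y * thomasCoeff nab φ a b e y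
        + 2 * (densityForm nab φ a y * densityForm nab φ b y) := by
    simp only [christoffel_eq_thomasCoeff, add_mul, Finset.sum_add_distrib]
    simp only [mul_ite, ite_mul, mul_one, mul_zero, zero_mul, Finset.sum_ite_eq', Finset.mem_univ,
      if_true, mul_comm (thomasCoeff _ _ _ _ _ _)]
    ring
  rw [schouten, ricci_eq nab φ a b hy, ricci_eq nab φ b a hy, thomasRicci_symm nab φ b a hy, h3]
  simp only [thomasCoeff_symm nab φ b a _ hy]
  field_simp
  ring

lemma splitY_zero (nab : AffineConnection n M) (φ : Chart n M) (y : Eucl n) :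
    splitY nab φ 0 y = 1 := rfl

lemma splitY_succ (nab : AffineConnection n M) (φ : Chart n M) (a : Fin n) (y : Eucl n) :
    splitY nab φ a.succ y = - densityForm nab φ a y := rfl

lemma inclZ_zero (a : Fin n) : inclZ (0 : Idx n) a = 0 := by
  simp [inclZ, (Fin.succ_ne_zero a).symm]

lemma inclZ_succ (a b : Fin n) : inclZ a.succ b = if a = b then 1 else 0 := by
  simp [inclZ, Fin.succ_inj]

lemma tractorForm_zero (nab : AffineConnection n M) (φ : Chart n M) (a : Fin n) (C : Idx n)
    (y : Eucl n) : tractorForm nab φ a 0 C y = if C = a.succ then 1 else 0 := by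
  have e : topSlot (fun (D : Idx n) (_ : Eucl n) => if D = C then (1 : ℝ) else 0)
      = fun _ => if 0 = C then 1 else 0 := rfl
  simp only [tractorForm, cotractorNabla, e, bottomSlot, pd_const, splitY_zero, splitY_succ,
    inclZ_zero, zero_mul, Finset.sum_const_zero]
  simp only [eq_comm (a := C)]
  ring

lemma tractorForm_succ_zero [T2Space M] (hn : 2 ≤ n) (nab : AffineConnection n M) (φ : Chart n M)
    (a b : Fin n) {y : Eucl n} (hy : y ∈ φ.1.target) :
    tractorForm nab φ a b.succ 0 y = - (thomasRicci nab φ a b y / (n - 1)) := by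
  have e : topSlot (fun (D : Idx n) (_ : Eucl n) => if D = 0 then (1 : ℝ) else 0)
      = fun _ => 1 := by
    funext z
    simp [topSlot]
  have e' : bottomSlot nab φ (fun (D : Idx n) (_ : Eucl n) => if D = 0 then (1 : ℝ) else 0)
      = densityForm nab φ := by
    funext b z
    simp [bottomSlot, splitY_succ]
  rw [← schouten_eq hn nab φ a b hy]
  simp only [tractorForm, cotractorNabla, e, e', pd_const, splitY_succ,
    inclZ_succ, ite_mul, one_mul, zero_mul, Finset.sum_ite_eq, Finset.mem_univ, if_true]
  ring

lemma tractorForm_succ_succ (nab : AffineConnection n M) (φ : Chart n M) (a b c : Fin n)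
    (y : Eucl n) : tractorForm nab φ a b.succ c.succ y = thomasCoeff nab φ a b c y := by
  have e : topSlot (fun (D : Idx n) (_ : Eucl n) => if D = c.succ then (1 : ℝ) else 0)
      = fun _ => 0 := by
    funext z
    simp [topSlot, (Fin.succ_ne_zero c).symm]
  have e' : bottomSlot nab φ (fun (D : Idx n) (_ : Eucl n) => if D = c.succ then (1 : ℝ) else 0)
      = fun b _ => if b = c then 1 else 0 := by
    funext b z
    have h0 : ((0 : Idx n) = c.succ) = False := eq_false (Fin.succ_ne_zero c).symm
    by_cases h : b = c
    · subst h
      simp only [bottomSlot, splitY_succ, h0, if_true, if_false, mul_zero, sub_zero]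
    · have h' : (b.succ = c.succ) = False := eq_false fun hh => h (Fin.succ_injective n hh)
      simp only [bottomSlot, splitY_succ, h0, h, h', if_false, mul_zero, sub_zero]
  simp only [tractorForm, cotractorNabla, e, e', pd_const, splitY_succ]
  simp only [inclZ_succ, ite_mul, one_mul, zero_mul, Finset.sum_ite_eq, Finset.sum_ite_eq',
    Finset.mem_univ, if_true, mul_ite, mul_one, mul_zero, thomasCoeff]
  have h1 : (if b = c then densityForm nab φ a y else 0)
      = if c = b then densityForm nab φ a y else 0 := by simp only [eq_comm]
  have h2 : (if a = c then (1 : ℝ) else 0) = if c = a then 1 else 0 := by simp only [eq_comm]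
  rw [h1, h2]
  generalize densityForm nab φ a y = p
  generalize densityForm nab φ b y = q
  generalize christoffel nab φ a b c y = r
  by_cases hb : c = b
  · by_cases ha : c = a
    · simp only [if_pos hb, if_pos ha]
      ring
    · simp only [if_pos hb, if_neg ha]
      ring
  · by_cases ha : c = a
    · simp only [if_neg hb, if_pos ha]
      ring
    · simp only [if_neg hb, if_neg ha]
      ring

/-- The connection form of the Thomas operator, regarded as an affine connection on the cone
over `M`: the rows are the lower, the columns the upper indices. The Euler direction acts by
the identity, so that a cotractor field of rank `r` and weight `w` has cone degree `w + r`. -/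
def coneForm (nab : AffineConnection n M) (φ : Chart n M) (A : Idx n) (y : Eucl n) :
    Matrix (Idx n) (Idx n) ℝ :=
  Matrix.of fun B C => Fin.cases (if B = C then 1 else 0) (fun a => tractorForm nab φ a B C y) A

lemma coneForm_zero (nab : AffineConnection n M) (φ : Chart n M) (y : Eucl n) :
    coneForm nab φ 0 y = 1 := by
  ext B C
  simp [coneForm, Matrix.one_apply]

lemma coneForm_succ (nab : AffineConnection n M) (φ : Chart n M) (a : Fin n) (y : Eucl n)
    (B C : Idx n) : coneForm nab φ a.succ y B C = tractorForm nab φ a B C y := rfl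

lemma coneForm_apply_zero (nab : AffineConnection n M) (φ : Chart n M) (A : Idx n) (y : Eucl n)
    (C : Idx n) : coneForm nab φ A y 0 C = if C = A then 1 else 0 := by
  refine Fin.cases ?_ (fun a => ?_) A
  · rw [coneForm_zero, Matrix.one_apply]
    simp [eq_comm]
  · rw [coneForm_succ, tractorForm_zero]

/-- The connection on the cone is torsion-free. -/
lemma coneForm_symm [T2Space M] (hn : 2 ≤ n) (nab : AffineConnection n M) (φ : Chart n M)
    {y : Eucl n} (hy : y ∈ φ.1.target) (A B C : Idx n) :
    coneForm nab φ A y B C = coneForm nab φ B y A C := by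
  refine Fin.cases ?_ (fun a => ?_) A <;> refine Fin.cases ?_ (fun b => ?_) B
  · rfl
  · rw [coneForm_apply_zero, coneForm_zero, Matrix.one_apply]
    simp [eq_comm]
  · rw [coneForm_apply_zero, coneForm_zero, Matrix.one_apply]
    simp [eq_comm]
  · refine Fin.cases ?_ (fun c => ?_) C
    · rw [coneForm_succ, coneForm_succ, tractorForm_succ_zero hn nab φ a b hy,
        tractorForm_succ_zero hn nab φ b a hy, thomasRicci_symm nab φ a b hy]
    · rw [coneForm_succ, coneForm_succ, tractorForm_succ_succ, tractorForm_succ_succ,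
        thomasCoeff_symm nab φ a b c hy]

lemma smoothMat_coneForm [T2Space M] (hn : 2 ≤ n) (nab : AffineConnection n M) (φ : Chart n M)
    (A : Idx n) : SmoothMat φ.1.target (coneForm nab φ A) := by
  intro B C
  refine Fin.cases ?_ (fun a => ?_) A
  · simp only [coneForm_zero]
    exact contDiffOn_const
  · simp only [coneForm_succ]
    refine Fin.cases ?_ (fun b => ?_) B
    · simp only [tractorForm_zero]
      exact contDiffOn_const
    · refine Fin.cases ?_ (fun c => ?_) C
      · exact ((contDiffOn_thomasRicci nab φ a b).div_const _).neg.congr fun y hy =>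
          tractorForm_succ_zero hn nab φ a b hy
      · simp only [tractorForm_succ_succ]
        exact contDiffOn_thomasCoeff nab φ a b c

/-- The tractor connection only depends on the projective structure. -/
lemma ProjEquiv.coneForm_eq [T2Space M] (hn : 2 ≤ n) {nab nab' : AffineConnection n M}
    (h : ProjEquiv nab nab') (φ : Chart n M) (A : Idx n) {y : Eucl n} (hy : y ∈ φ.1.target) :
    coneForm nab' φ A y = coneForm nab φ A y := by
  ext B C
  refine Fin.cases ?_ (fun a => ?_) A
  · rw [coneForm_zero, coneForm_zero]
  · rw [coneForm_succ, coneForm_succ]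
    refine Fin.cases ?_ (fun b => ?_) B
    · rw [tractorForm_zero, tractorForm_zero]
    · refine Fin.cases ?_ (fun c => ?_) C
      · rw [tractorForm_succ_zero hn _ _ _ _ hy, tractorForm_succ_zero hn _ _ _ _ hy,
          h.thomasRicci_eq φ a b hy]
      · rw [tractorForm_succ_succ, tractorForm_succ_succ, h.thomasCoeff_eq φ a b c hy]

/-- The Thomas operator is the covariant derivative of the cone, on tensors which are homogeneous
of degree the weight plus the number of lower minus the number of upper indices. -/
lemma thomasD_eq (nab : AffineConnection n M) (φ : Chart n M) (w : ℝ) {r s : ℕ}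
    (T : TractorComp n r s) {y : Eucl n} (hy : y ∈ φ.1.target) (B : Fin (r + 1) → Idx n)
    (C : Fin s → Idx n) :
    thomasD nab φ w T B C y = coneD (w + r - s) (B 0) (T (Fin.tail B) C) y
      - ∑ i, ∑ H, coneForm nab φ (B 0) y (Fin.tail B i) H
          * T (Function.update (Fin.tail B) i H) C y
      + ∑ i, ∑ H, coneForm nab φ (B 0) y H (C i)
          * T (Fin.tail B) (Function.update C i H) y := by
  rw [thomasD, if_pos hy]
  generalize B 0 = A
  generalize Fin.tail B = B'
  refine Fin.cases ?_ (fun a => ?_) A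
  · simp only [splitY_zero, inclZ_zero, coneForm_zero, Matrix.one_apply, coneD_zero, zero_mul,
      Finset.sum_const_zero, ite_mul, one_mul, Finset.sum_ite_eq, Finset.sum_ite_eq',
      Finset.mem_univ, if_true, Function.update_eq_self, Finset.sum_const, Finset.card_univ,
      Fintype.card_fin, nsmul_eq_mul]
    ring
  · simp only [splitY_succ, inclZ_succ, ite_mul, one_mul, zero_mul, Finset.sum_ite_eq,
      Finset.mem_univ, if_true, tractorNabla, coneD_succ, coneForm_succ]
    ring

end ProjTractor

namespace ProjTractor

open scoped Kronecker

/-! ### Gauge transformations of connections -/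

section Gauge

variable {n : ℕ} {ι κ l : Type*} [Fintype ι] [DecidableEq ι] [Fintype κ] [DecidableEq κ]
  [Fintype l] [DecidableEq l]
  {U : Set (Eucl n)} (hU : IsOpen U) {y : Eucl n} (hy : y ∈ U)

/-- The pullback of a connection form along a map `F` of the base, where `N` is the Jacobian of
the corresponding map of cones. -/
def pullForm (N : Eucl n → Matrix (Idx n) (Idx n) ℝ) (F : Eucl n → Eucl n)
    (𝒜 : Idx n → Eucl n → Matrix ι ι ℝ) (A : Idx n) (y : Eucl n) : Matrix ι ι ℝ :=
  ∑ E, N y A E • 𝒜 E (F y)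

lemma kronSum_pullForm (N : Eucl n → Matrix (Idx n) (Idx n) ℝ) (F : Eucl n → Eucl n)
    (𝒜 : Idx n → Eucl n → Matrix ι ι ℝ) (ℬ : Idx n → Eucl n → Matrix κ κ ℝ) (A : Idx n)
    (y : Eucl n) : pullForm N F (fun E z => kronSum (𝒜 E z) (ℬ E z)) A y
      = kronSum (pullForm N F 𝒜 A y) (pullForm N F ℬ A y) := by
  ext ⟨i, j⟩ ⟨i', j'⟩
  simp only [pullForm, kronSum, Matrix.sum_apply, Matrix.smul_apply, Matrix.add_apply,
    Matrix.kroneckerMap_apply, smul_eq_mul, Finset.sum_mul, Finset.mul_sum,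
    ← Finset.sum_add_distrib]
  exact Finset.sum_congr rfl fun E _ => by ring

/-- `𝒩` transforms the connection form `X` into the connection form `𝒜` on `U`. -/
def IsGauge (U : Set (Eucl n)) (𝒩 : Eucl n → Matrix ι ι ℝ)
    (𝒜 X : Idx n → Eucl n → Matrix ι ι ℝ) : Prop :=
  ∀ y ∈ U, ∀ A, 𝒜 A y * 𝒩 y = matD 0 A 𝒩 y + 𝒩 y * X A y

include hU hy

lemma IsGauge.curv_mul {𝒩 : Eucl n → Matrix ι ι ℝ} {𝒜 X : Idx n → Eucl n → Matrix ι ι ℝ}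
    (h : IsGauge U 𝒩 𝒜 X) (h𝒩 : SmoothMat U 𝒩) (h𝒜 : ∀ A, SmoothMat U (𝒜 A))
    (hX : ∀ A, SmoothMat U (X A)) (A B : Idx n) :
    curv 𝒜 A B y * 𝒩 y = 𝒩 y * curv X A B y := by
  have key : ∀ A B, matD 0 A (𝒜 B) y * 𝒩 y
      = matD 0 A (matD 0 B 𝒩) y + (matD 0 A 𝒩 y * X B y + 𝒩 y * matD 0 A (X B) y)
        - 𝒜 B y * matD 0 A 𝒩 y := by
    intro A B
    have e := matD_congr hU hy (fun z hz => h z hz B) 0 A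
    rw [matD_mul hU hy (h𝒜 B) h𝒩, matD_add hU hy (h𝒩.matD hU 0 B) (h𝒩.mul (hX B)),
      matD_mul hU hy h𝒩 (hX B)] at e
    rw [← e]
    abel
  have h' : ∀ A, matD 0 A 𝒩 y = 𝒜 A y * 𝒩 y - 𝒩 y * X A y := fun A => by
    rw [h y hy A]
    abel
  have e : curv 𝒜 A B y * 𝒩 y = matD 0 A (𝒜 B) y * 𝒩 y - matD 0 B (𝒜 A) y * 𝒩 y
      - (𝒜 A y * 𝒜 B y - 𝒜 B y * 𝒜 A y) * 𝒩 y := by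
    simp only [curv, Matrix.sub_mul]
  rw [e, key, key, matD_comm hU hy h𝒩 0 B A, h' A, h' B, curv]
  noncomm_ring

lemma matD_kronecker {X : Eucl n → Matrix ι ι ℝ} {Y : Eucl n → Matrix κ κ ℝ}
    (hX : SmoothMat U X) (hY : SmoothMat U Y) (A : Idx n) :
    matD 0 A (fun z => X z ⊗ₖ Y z) y = matD 0 A X y ⊗ₖ Y y + X y ⊗ₖ matD 0 A Y y := by
  ext ⟨i, j⟩ ⟨i', j'⟩
  simp only [matD, Matrix.of_apply, Matrix.add_apply, Matrix.kroneckerMap_apply]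
  have := coneD_mul (hX.diffAt hU hy i i') (hY.diffAt hU hy j j') 0 0 A
  rwa [zero_add] at this

omit hy in
lemma IsGauge.kronecker {𝒩 : Eucl n → Matrix ι ι ℝ} {𝒜 X : Idx n → Eucl n → Matrix ι ι ℝ}
    {ℳ : Eucl n → Matrix κ κ ℝ} {ℬ Y : Idx n → Eucl n → Matrix κ κ ℝ}
    (h : IsGauge U 𝒩 𝒜 X) (h' : IsGauge U ℳ ℬ Y) (h𝒩 : SmoothMat U 𝒩) (hℳ : SmoothMat U ℳ) :
    IsGauge U (fun z => 𝒩 z ⊗ₖ ℳ z) (fun A z => kronSum (𝒜 A z) (ℬ A z))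
      (fun A z => kronSum (X A z) (Y A z)) := by
  intro y hy A
  rw [matD_kronecker hU hy h𝒩 hℳ]
  simp only [kronSum, add_mul, mul_add, ← Matrix.mul_kronecker_mul, one_mul, mul_one, h y hy,
    h' y hy, Matrix.add_kronecker, Matrix.kronecker_add]
  abel

omit hy in
lemma SmoothMat.kronecker {X : Eucl n → Matrix ι ι ℝ} {Y : Eucl n → Matrix κ κ ℝ}
    (hX : SmoothMat U X) (hY : SmoothMat U Y) : SmoothMat U (fun z => X z ⊗ₖ Y z) := by
  rintro ⟨i, j⟩ ⟨i', j'⟩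
  exact (hX i i').mul (hY j j')

/-- The covariant derivative is compatible with gauge transformations. -/
lemma IsGauge.covD {𝒩 : Eucl n → Matrix ι ι ℝ} {𝒜 X : Idx n → Eucl n → Matrix ι ι ℝ}
    (h : IsGauge U 𝒩 𝒜 X) (h𝒩 : SmoothMat U 𝒩) {T T' : Eucl n → Matrix ι κ ℝ}
    (hT' : SmoothMat U T') (hT : ∀ z ∈ U, T z = 𝒩 z * T' z) (m : ℝ) (A : Idx n) :
    covD m 𝒜 A T y = 𝒩 y * covD m X A T' y := by
  simp only [ProjTractor.covD]
  rw [matD_congr hU hy hT, matD_mul hU hy h𝒩 hT', hT y hy, ← Matrix.mul_assoc, h y hy A,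
    Matrix.mul_sub, Matrix.add_mul, Matrix.mul_assoc]
  abel

end Gauge

variable {n : ℕ} {M : Type*} [TopologicalSpace M] [ChartedSpace (Eucl n) M]
  [IsManifold (𝓡 n) ∞ M]

/-! ### The transition functions of the density and tractor bundles -/

lemma jacobian_det_ne_zero {φ ψ : Chart n M} {y : Eucl n} (hy : y ∈ overlap φ ψ) :
    (jacobian φ ψ y).det ≠ 0 := by
  have h := congrArg Matrix.det (jacobian_mul_jacobian hy)
  rw [Matrix.det_mul, Matrix.det_one] at h
  exact left_ne_zero_of_mul_eq_one h

lemma contDiffOn_jacobian_det (φ ψ : Chart n M) :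
    ContDiffOn ℝ ∞ (fun y => (jacobian φ ψ y).det) (overlap φ ψ) := by
  simp only [Matrix.det_apply]
  exact ContDiffOn.sum fun σ _ => ContDiffOn.const_smul _
    (contDiffOn_prod fun i _ => contDiffOn_jacobian φ ψ _ _)

lemma densityTrans_eq {φ ψ : Chart n M} {y : Eucl n} (hy : y ∈ overlap φ ψ) :
    densityTrans φ ψ y
      = Real.exp (-1 / ((n : ℝ) + 1) * Real.log (jacobian φ ψ y).det) := by
  rw [densityTrans, Real.rpow_def_of_pos (abs_pos.2 (jacobian_det_ne_zero hy)), Real.log_abs,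
    mul_comm]

lemma contDiffOn_densityTrans (φ ψ : Chart n M) :
    ContDiffOn ℝ ∞ (densityTrans φ ψ) (overlap φ ψ) :=
  (Real.contDiff_exp.comp_contDiffOn (contDiffOn_const.mul
    ((contDiffOn_jacobian_det φ ψ).log fun _ hy => jacobian_det_ne_zero hy))).congr
    fun _ hy => densityTrans_eq hy

/-- The logarithmic derivative of the transition function of `ℰ(1)`. -/
def densityLogDeriv (φ ψ : Chart n M) (a : Fin n) (y : Eucl n) : ℝ :=
  pd a (fun z => -1 / ((n : ℝ) + 1) * Real.log (jacobian φ ψ z).det) y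

lemma pd_densityTrans {φ ψ : Chart n M} {y : Eucl n} (hy : y ∈ overlap φ ψ) (a : Fin n) :
    pd a (densityTrans φ ψ) y = densityTrans φ ψ y * densityLogDeriv φ ψ a y := by
  have ho := isOpen_overlap φ ψ
  rw [pd_congr ho (fun z hz => densityTrans_eq hz) hy, densityTrans_eq hy, densityLogDeriv, pd, pd,
    fderiv_exp]
  · simp
  · exact diffAt_of_contDiffOn ho (contDiffOn_const.mul
      ((contDiffOn_jacobian_det φ ψ).log fun _ hy => jacobian_det_ne_zero hy)) hy

lemma contDiffOn_densityLogDeriv (φ ψ : Chart n M) (a : Fin n) :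
    ContDiffOn ℝ ∞ (densityLogDeriv φ ψ a) (overlap φ ψ) :=
  contDiffOn_pd (isOpen_overlap φ ψ) (contDiffOn_const.mul
    ((contDiffOn_jacobian_det φ ψ).log fun _ hy => jacobian_det_ne_zero hy)) a

lemma pd_densityLogDeriv_symm {φ ψ : Chart n M} {y : Eucl n} (hy : y ∈ overlap φ ψ) (a b : Fin n) :
    pd a (densityLogDeriv φ ψ b) y = pd b (densityLogDeriv φ ψ a) y :=
  pd_comm (isOpen_overlap φ ψ) (contDiffOn_const.mul
    ((contDiffOn_jacobian_det φ ψ).log fun _ hy => jacobian_det_ne_zero hy)) hy a b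

/-- Jacobi's formula for the derivative of a determinant. -/
lemma pd_det {X : Eucl n → Matrix (Fin n) (Fin n) ℝ} {y : Eucl n}
    (hX : ∀ i j, DifferentiableAt ℝ (fun z => X z i j) y) (a : Fin n) :
    pd a (fun z => (X z).det) y
      = ((X y).adjugate * Matrix.of fun i j => pd a (fun z => X z i j) y).trace := by
  have hp : ∀ σ : Equiv.Perm (Fin n), DifferentiableAt ℝ (fun z => ∏ i, X z (σ i) i) y := fun σ =>
    (HasFDerivAt.finsetProd fun i _ => (hX (σ i) i).hasFDerivAt).differentiableAt
  have h1 : pd a (fun z => (X z).det) y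
      = ∑ σ : Equiv.Perm (Fin n), ∑ i, (Equiv.Perm.sign σ : ℝ)
        * ((∏ j ∈ Finset.univ.erase i, X y (σ j) j) * pd a (fun z => X z (σ i) i) y) := by
    simp only [Matrix.det_apply']
    rw [pd_sum _ fun σ _ => (hp σ).const_mul _]
    refine Finset.sum_congr rfl fun σ _ => ?_
    rw [pd_const_mul (hp σ), ← Finset.mul_sum]
    congr 1
    rw [pd, fderiv_finsetProd fun i _ => hX (σ i) i]
    simp [pd]
  rw [h1, Finset.sum_comm, Matrix.trace]
  refine Finset.sum_congr rfl fun i _ => ?_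
  rw [Matrix.diag_apply, Matrix.mul_apply]
  have h2 := congrFun (Matrix.cramer_eq_adjugate_mulVec (X y)
    fun k => pd a (fun z => X z k i) y) i
  rw [Matrix.cramer_apply, Matrix.det_apply', Matrix.mulVec, dotProduct] at h2
  simp only [Matrix.of_apply]
  rw [← h2]
  refine Finset.sum_congr rfl fun σ _ => ?_
  congr 1
  rw [← Finset.mul_prod_erase _ _ (Finset.mem_univ i), Matrix.updateCol_self, mul_comm]
  congr 1
  refine Finset.prod_congr rfl fun j hj => ?_
  rw [Matrix.updateCol_ne (Finset.ne_of_mem_erase hj)]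

lemma densityLogDeriv_eq {φ ψ : Chart n M} {y : Eucl n} (hy : y ∈ overlap φ ψ) (a : Fin n) :
    ((n : ℝ) + 1) * densityLogDeriv φ ψ a y = - (jacobian ψ φ (coordChange φ ψ y)
      * Matrix.of fun i j => pd a (fun z => jacobian φ ψ z i j) y).trace := by
  have ho := isOpen_overlap φ ψ
  have hd := jacobian_det_ne_zero hy
  have hX : ∀ i j, DifferentiableAt ℝ (fun z => jacobian φ ψ z i j) y := fun i j =>
    diffAt_of_contDiffOn ho (contDiffOn_jacobian φ ψ i j) hy
  have hdd := diffAt_of_contDiffOn ho (contDiffOn_jacobian_det φ ψ) hy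
  have h1 : densityLogDeriv φ ψ a y = -1 / ((n : ℝ) + 1)
      * ((jacobian φ ψ y).det⁻¹ * pd a (fun z => (jacobian φ ψ z).det) y) := by
    rw [densityLogDeriv, pd_const_mul (hdd.log hd), pd, fderiv.log hdd hd]
    simp [pd]
  have h2 : (jacobian φ ψ y).adjugate
      = (jacobian φ ψ y).det • jacobian ψ φ (coordChange φ ψ y) := by
    have := congrArg ((jacobian φ ψ y).adjugate * ·) (jacobian_mul_jacobian hy)
    simp only [← Matrix.mul_assoc, Matrix.adjugate_mul, Matrix.mul_one] at this
    rw [← this, Matrix.smul_mul, Matrix.one_mul]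
  rw [h1, pd_det hX, h2, Matrix.smul_mul, Matrix.trace_smul, smul_eq_mul, inv_mul_cancel_left₀ hd]
  have : ((n : ℝ) + 1) ≠ 0 := by positivity
  field_simp

end ProjTractor

namespace ProjTractor

open scoped Kronecker

variable {n : ℕ} {M : Type*} [TopologicalSpace M] [ChartedSpace (Eucl n) M]
  [IsManifold (𝓡 n) ∞ M] {ι κ : Type*} [Fintype ι] [DecidableEq ι] [Fintype κ] [DecidableEq κ]

/-! ### Coordinate changes of the cone -/

/-- The Jacobian of the coordinate change of cones. The transition matrix of the cotractor
bundle is its product with the transition function of `ℰ(1)`. -/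
def coneJac (φ ψ : Chart n M) (y : Eucl n) : Matrix (Idx n) (Idx n) ℝ :=
  Matrix.of fun A B => Fin.cases (if B = 0 then 1 else 0)
    (fun a => Fin.cases (densityLogDeriv φ ψ a y) (fun b => jacobian φ ψ y a b) B) A

lemma coneJac_zero (φ ψ : Chart n M) (y : Eucl n) (B : Idx n) :
    coneJac φ ψ y 0 B = if B = 0 then 1 else 0 := rfl

lemma coneJac_succ_zero (φ ψ : Chart n M) (y : Eucl n) (a : Fin n) :
    coneJac φ ψ y a.succ 0 = densityLogDeriv φ ψ a y := rfl

lemma coneJac_succ_succ (φ ψ : Chart n M) (y : Eucl n) (a b : Fin n) :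
    coneJac φ ψ y a.succ b.succ = jacobian φ ψ y a b := rfl

lemma cotractorTrans_eq {φ ψ : Chart n M} {y : Eucl n} (hy : y ∈ overlap φ ψ) (A B : Idx n) :
    cotractorTrans φ ψ y A B = densityTrans φ ψ y * coneJac φ ψ y A B := by
  refine Fin.cases ?_ (fun a => ?_) A <;> refine Fin.cases ?_ (fun b => ?_) B
  · rw [coneJac_zero]
    simp [cotractorTrans]
  · rw [coneJac_zero]
    simp [cotractorTrans]
  · rw [coneJac_succ_zero, ← pd_densityTrans hy]
    rfl
  · rfl

lemma smoothMat_coneJac (φ ψ : Chart n M) : SmoothMat (overlap φ ψ) (coneJac φ ψ) := by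
  intro A B
  refine Fin.cases ?_ (fun a => ?_) A
  · simp only [coneJac_zero]
    exact contDiffOn_const
  · refine Fin.cases ?_ (fun b => ?_) B
    · exact contDiffOn_densityLogDeriv φ ψ a
    · exact contDiffOn_jacobian φ ψ a b

lemma matD_coneJac_zero (φ ψ : Chart n M) (y : Eucl n) (A B : Idx n) :
    matD 0 A (coneJac φ ψ) y 0 B = 0 := by
  rw [matD, Matrix.of_apply]
  refine Fin.cases ?_ (fun a => ?_) A
  · simp
  · simp only [coneJac_zero, coneD_succ, pd_const]

/-- The derivatives of the Jacobian of a coordinate change of cones are symmetric. -/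
lemma matD_coneJac_symm {φ ψ : Chart n M} {y : Eucl n} (hy : y ∈ overlap φ ψ) (A B C : Idx n) :
    matD 0 A (coneJac φ ψ) y B C = matD 0 B (coneJac φ ψ) y A C := by
  have h0 : ∀ B C, matD 0 0 (coneJac φ ψ) y B C = 0 := fun B C => by simp [matD]
  refine Fin.cases ?_ (fun a => ?_) A <;> refine Fin.cases ?_ (fun b => ?_) B
  · rfl
  · rw [h0, matD_coneJac_zero]
  · rw [h0, matD_coneJac_zero]
  · refine Fin.cases ?_ (fun c => ?_) C
    · exact pd_densityLogDeriv_symm hy a b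
    · exact pd_jacobian_symm φ ψ hy a b c

lemma coneJac_det_ne_zero {φ ψ : Chart n M} {y : Eucl n} (hy : y ∈ overlap φ ψ) :
    (coneJac φ ψ y).det ≠ 0 := by
  rw [Matrix.det_succ_row_zero, Finset.sum_eq_single 0]
  · have : (coneJac φ ψ y).submatrix Fin.succ (Fin.succAbove 0) = jacobian φ ψ y := by
      ext a b
      simp [coneJac_succ_succ]
    rw [this, coneJac_zero]
    simpa using jacobian_det_ne_zero hy
  · intro B _ hB
    simp [coneJac_zero, hB]
  · simp

/-- The chain rule for homogeneous functions on the cone. -/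
lemma coneD_comp_coordChange {φ ψ : Chart n M} {y : Eucl n} (hy : y ∈ overlap φ ψ)
    {f : Eucl n → ℝ} (hf : DifferentiableAt ℝ f (coordChange φ ψ y)) (m : ℕ) (A : Idx n) :
    coneD m A (fun z => densityTrans φ ψ z ^ m * f (coordChange φ ψ z)) y
      = densityTrans φ ψ y ^ m
        * ∑ E, coneJac φ ψ y A E * coneD m E f (coordChange φ ψ y) := by
  have hρ := diffAt_of_contDiffOn (isOpen_overlap φ ψ) (contDiffOn_densityTrans φ ψ) hy
  have hF := (coordChange_contDiffAt hy).differentiableAt (by simp)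
  have hfF : DifferentiableAt ℝ (fun z => f (coordChange φ ψ z)) y :=
    DifferentiableAt.fun_comp' y hf hF
  refine Fin.cases ?_ (fun a => ?_) A
  · simp [coneJac_zero]
    ring
  · have hpow : pd a (fun z => densityTrans φ ψ z ^ m) y
        = m * densityLogDeriv φ ψ a y * densityTrans φ ψ y ^ m := by
      have h1 : pd a (fun z => densityTrans φ ψ z ^ m) y
          = m * densityTrans φ ψ y ^ (m - 1) * pd a (densityTrans φ ψ) y := by
        rw [pd, fderiv_fun_pow m hρ]
        simp [pd]
      rw [h1, pd_densityTrans hy]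
      rcases m with _ | m
      · simp
      · simp only [Nat.add_sub_cancel, pow_succ]
        ring
    rw [coneD_succ, pd_mul (f := fun z => densityTrans φ ψ z ^ m) (hρ.fun_pow m) hfF,
      hpow, pd_comp_coordChange hy hf, Fin.sum_univ_succ]
    simp only [coneJac_succ_zero, coneJac_succ_succ, coneD_zero, coneD_succ]
    ring

lemma matD_comp_coordChange {φ ψ : Chart n M} {y : Eucl n} (hy : y ∈ overlap φ ψ)
    {X : Eucl n → Matrix ι κ ℝ} {U : Set (Eucl n)} (hU : IsOpen U) (hX : SmoothMat U X)
    (hyU : coordChange φ ψ y ∈ U) (m : ℕ) (A : Idx n) :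
    matD m A (fun z => densityTrans φ ψ z ^ m • X (coordChange φ ψ z)) y
      = densityTrans φ ψ y ^ m
        • ∑ E, coneJac φ ψ y A E • matD m E X (coordChange φ ψ y) := by
  ext i j
  simp only [matD, Matrix.of_apply, Matrix.smul_apply, Matrix.sum_apply, smul_eq_mul]
  exact coneD_comp_coordChange hy (hX.diffAt hU hyU i j) m A

lemma matD_zero_comp_coordChange {φ ψ : Chart n M} {y : Eucl n} (hy : y ∈ overlap φ ψ)
    {X : Eucl n → Matrix ι κ ℝ} {U : Set (Eucl n)} (hU : IsOpen U) (hX : SmoothMat U X)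
    (hyU : coordChange φ ψ y ∈ U) (A : Idx n) :
    matD 0 A (fun z => X (coordChange φ ψ z)) y
      = ∑ E, coneJac φ ψ y A E • matD 0 E X (coordChange φ ψ y) := by
  simpa using matD_comp_coordChange hy hU hX hyU 0 A

lemma coordChange_mem_target {φ ψ : Chart n M} {y : Eucl n} (hy : y ∈ overlap φ ψ) :
    coordChange φ ψ y ∈ ψ.1.target :=
  (mem_overlap.1 (coordChange_mem_overlap hy)).1

lemma SmoothMat.comp_coordChange {φ ψ : Chart n M} {X : Eucl n → Matrix ι κ ℝ}
    (hX : SmoothMat ψ.1.target X) :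
    SmoothMat (overlap φ ψ) (fun z => X (coordChange φ ψ z)) := fun i j =>
  (hX i j).comp (contDiffOn_coordChange φ ψ) fun _ hz => coordChange_mem_target hz

lemma smoothMat_sum {U : Set (Eucl n)} {s : Type*} (t : Finset s)
    {X : s → Eucl n → Matrix ι κ ℝ} (hX : ∀ i, SmoothMat U (X i)) :
    SmoothMat U (fun y => ∑ i ∈ t, X i y) := fun i j => by
  simp only [Matrix.sum_apply]
  exact ContDiffOn.sum fun k _ => hX k i j

lemma SmoothMat.smul {U : Set (Eucl n)} {f : Eucl n → ℝ} {X : Eucl n → Matrix ι κ ℝ}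
    (hf : ContDiffOn ℝ ∞ f U) (hX : SmoothMat U X) : SmoothMat U (fun y => f y • X y) :=
  fun i j => hf.mul (hX i j)

lemma smoothMat_pullForm {φ ψ : Chart n M} {𝒜 : Idx n → Eucl n → Matrix ι ι ℝ}
    (h𝒜 : ∀ A, SmoothMat ψ.1.target (𝒜 A)) (A : Idx n) :
    SmoothMat (overlap φ ψ) (pullForm (coneJac φ ψ) (coordChange φ ψ) 𝒜 A) :=
  smoothMat_sum _ fun E => SmoothMat.smul (smoothMat_coneJac φ ψ A E) (h𝒜 E).comp_coordChange

/-- Forming the curvature commutes with pullbacks. -/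
lemma curv_pullForm {φ ψ : Chart n M} {y : Eucl n} (hy : y ∈ overlap φ ψ)
    {𝒜 : Idx n → Eucl n → Matrix ι ι ℝ} (h𝒜 : ∀ A, SmoothMat ψ.1.target (𝒜 A)) (A B : Idx n) :
    curv (pullForm (coneJac φ ψ) (coordChange φ ψ) 𝒜) A B y
      = ∑ E, ∑ G, (coneJac φ ψ y A E * coneJac φ ψ y B G) • curv 𝒜 E G (coordChange φ ψ y) := by
  have ho := isOpen_overlap φ ψ
  have key : ∀ A B, matD 0 A (pullForm (coneJac φ ψ) (coordChange φ ψ) 𝒜 B) y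
      = ∑ G, matD 0 A (coneJac φ ψ) y B G • 𝒜 G (coordChange φ ψ y)
        + ∑ E, ∑ G, (coneJac φ ψ y A E * coneJac φ ψ y B G)
          • matD 0 E (𝒜 G) (coordChange φ ψ y) := by
    intro A B
    ext i j
    have hd : ∀ G, DifferentiableAt ℝ (fun z => 𝒜 G (coordChange φ ψ z) i j) y := fun G =>
      (h𝒜 G).comp_coordChange.diffAt ho hy i j
    have hN := fun G => (smoothMat_coneJac φ ψ).diffAt ho hy B G
    have e : matD 0 A (pullForm (coneJac φ ψ) (coordChange φ ψ) 𝒜 B) y i j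
        = coneD 0 A (fun z => ∑ G, coneJac φ ψ z B G * 𝒜 G (coordChange φ ψ z) i j) y := by
      simp [matD, pullForm, Matrix.sum_apply]
    have e2 : ∀ G, coneD 0 A (fun z => 𝒜 G (coordChange φ ψ z) i j) y
        = ∑ E, coneJac φ ψ y A E * matD 0 E (𝒜 G) (coordChange φ ψ y) i j := fun G => by
      have := congrFun (congrFun (matD_zero_comp_coordChange hy ψ.1.open_target (h𝒜 G)
        (coordChange_mem_target hy) A) i) j
      simpa [Matrix.sum_apply, matD] using this
    rw [e, coneD_sum Finset.univ (f := fun G z => coneJac φ ψ z B G * 𝒜 G (coordChange φ ψ z) i j)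
      fun G _ => (hN G).mul (hd G)]
    have e3 : ∀ G, coneD 0 A (fun z => coneJac φ ψ z B G * 𝒜 G (coordChange φ ψ z) i j) y
        = matD 0 A (coneJac φ ψ) y B G * 𝒜 G (coordChange φ ψ y) i j
          + coneJac φ ψ y B G
            * ∑ E, coneJac φ ψ y A E * matD 0 E (𝒜 G) (coordChange φ ψ y) i j := fun G => by
      have := coneD_mul (hN G) (hd G) 0 0 A
      rw [zero_add] at this
      rw [this, e2]
      rfl
    simp only [e3, Finset.sum_add_distrib, Matrix.add_apply, Matrix.sum_apply, Matrix.smul_apply,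
      smul_eq_mul]
    congr 1
    rw [Finset.sum_comm]
    refine Finset.sum_congr rfl fun G _ => ?_
    rw [Finset.mul_sum]
    exact Finset.sum_congr rfl fun E _ => by ring
  have hmul : ∀ A B, pullForm (coneJac φ ψ) (coordChange φ ψ) 𝒜 A y
      * pullForm (coneJac φ ψ) (coordChange φ ψ) 𝒜 B y
      = ∑ E, ∑ G, (coneJac φ ψ y A E * coneJac φ ψ y B G)
        • (𝒜 E (coordChange φ ψ y) * 𝒜 G (coordChange φ ψ y)) := by
    intro A B
    simp only [pullForm, Finset.sum_mul, Finset.mul_sum, Matrix.smul_mul, Matrix.mul_smul,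
      smul_smul]
    rw [Finset.sum_comm]
    simp only [mul_comm]
  rw [curv, key, key, hmul, hmul]
  simp only [curv, smul_sub, Finset.sum_sub_distrib, matD_coneJac_symm hy B A]
  rw [Finset.sum_comm (f := fun E G => (coneJac φ ψ y B E * coneJac φ ψ y A G)
      • matD 0 E (𝒜 G) (coordChange φ ψ y)),
    Finset.sum_comm (f := fun E G => (coneJac φ ψ y B E * coneJac φ ψ y A G)
      • (𝒜 E (coordChange φ ψ y) * 𝒜 G (coordChange φ ψ y)))]
  simp only [mul_comm (coneJac φ ψ y B _)]
  abel

/-- The transformation law of the connection form of `ℰ(1)`. -/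
lemma densityForm_change (nab : AffineConnection n M) {φ ψ : Chart n M} {y : Eucl n}
    (hy : y ∈ overlap φ ψ) (a : Fin n) :
    densityForm nab φ a y = ∑ e, jacobian φ ψ y a e * densityForm nab ψ e (coordChange φ ψ y)
      - densityLogDeriv φ ψ a y := by
  set J := jacobian φ ψ y with hJ
  set K := jacobian ψ φ (coordChange φ ψ y) with hK
  let G : Matrix (Fin n) (Fin n) ℝ := Matrix.of fun b c => christoffel nab φ a b c y
  let D : Matrix (Fin n) (Fin n) ℝ := Matrix.of fun b c => pd a (fun z => jacobian φ ψ z b c) y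
  let X : Matrix (Fin n) (Fin n) ℝ :=
    Matrix.of fun b c => ∑ e, J a e * christoffel nab ψ e b c (coordChange φ ψ y)
  have hJK : J * K = 1 := jacobian_mul_jacobian hy
  have hKJ : K * J = 1 := mul_eq_one_comm.1 hJK
  have h : G * J = D + J * X := by
    ext b d
    have := christoffel_change nab hy a b d
    simp only [Matrix.mul_apply, Matrix.add_apply, G, D, X, Matrix.of_apply]
    rw [this, Finset.sum_comm]
    congr 1
    refine Finset.sum_congr rfl fun f _ => ?_
    rw [Finset.mul_sum]
    exact Finset.sum_congr rfl fun e _ => by ring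
  have ht : G.trace = (K * D).trace + X.trace := by
    have e : G = D * K + J * X * K := by
      rw [← Matrix.add_mul, ← h, Matrix.mul_assoc, hJK, Matrix.mul_one]
    rw [e, Matrix.trace_add, Matrix.trace_mul_comm D K, Matrix.trace_mul_comm (J * X) K,
      ← Matrix.mul_assoc, hKJ, Matrix.one_mul]
  have h1 : G.trace = ((n : ℝ) + 1) * densityForm nab φ a y := (densityForm_mul nab φ a y).symm
  have h2 : X.trace = ((n : ℝ) + 1)
      * ∑ e, J a e * densityForm nab ψ e (coordChange φ ψ y) := by
    rw [Finset.mul_sum]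
    simp only [Matrix.trace, Matrix.diag_apply, X, Matrix.of_apply]
    rw [Finset.sum_comm]
    refine Finset.sum_congr rfl fun e _ => ?_
    rw [mul_left_comm, densityForm_mul, Finset.mul_sum]
  have h3 := densityLogDeriv_eq hy a
  have h4 : ((n : ℝ) + 1) ≠ 0 := by positivity
  apply mul_left_cancel₀ h4
  rw [← h1, ht, h2, mul_sub, h3]
  ring

/-- The transformation law of Thomas's projective parameters. -/
lemma thomasCoeff_change (nab : AffineConnection n M) {φ ψ : Chart n M} {y : Eucl n}
    (hy : y ∈ overlap φ ψ) (a b d : Fin n) :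
    ∑ c, thomasCoeff nab φ a b c y * jacobian φ ψ y c d
      = pd a (fun z => jacobian φ ψ z b d) y
        + ∑ e, ∑ f, jacobian φ ψ y a e * jacobian φ ψ y b f
          * thomasCoeff nab ψ e f d (coordChange φ ψ y)
        + densityLogDeriv φ ψ a y * jacobian φ ψ y b d
        + densityLogDeriv φ ψ b y * jacobian φ ψ y a d := by
  have h := christoffel_change nab hy a b d
  have ha := densityForm_change nab hy a
  have hb := densityForm_change nab hy b
  simp only [christoffel_eq_thomasCoeff, add_mul, mul_add, Finset.sum_add_distrib] at h
  simp only [mul_ite, mul_one, mul_zero, ite_mul, zero_mul, Finset.sum_ite_eq, Finset.sum_ite_eq',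
    Finset.mem_univ, if_true] at h
  have e1 : ∑ e, jacobian φ ψ y a e * jacobian φ ψ y b d
        * densityForm nab ψ e (coordChange φ ψ y)
      = (∑ e, jacobian φ ψ y a e * densityForm nab ψ e (coordChange φ ψ y))
        * jacobian φ ψ y b d := by
    rw [Finset.sum_mul]
    exact Finset.sum_congr rfl fun e _ => by ring
  have e2 : ∑ e, ∑ f, (if d = e then jacobian φ ψ y a e * jacobian φ ψ y b f
        * densityForm nab ψ f (coordChange φ ψ y) else 0)
      = (∑ f, jacobian φ ψ y b f * densityForm nab ψ f (coordChange φ ψ y))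
        * jacobian φ ψ y a d := by
    rw [Finset.sum_comm, Finset.sum_mul]
    refine Finset.sum_congr rfl fun f _ => ?_
    rw [Finset.sum_ite_eq, if_pos (Finset.mem_univ _)]
    ring
  rw [e1, e2] at h
  rw [ha, hb] at h
  linarith

/-- The trace of the curvature of a connection form with the shape of a tractor connection. It
determines the entries `𝒜 b.succ y d.succ 0` in the slots of the Schouten tensor as soon as
`n ≠ 1`. -/
lemma trace_curv [T2Space M] (nab : AffineConnection n M) (φ : Chart n M) {U : Set (Eucl n)}
    (hU : IsOpen U) (hUφ : U ⊆ φ.1.target) {𝒜 : Idx n → Eucl n → Matrix (Idx n) (Idx n) ℝ}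
    (h0 : ∀ y ∈ U, 𝒜 0 y = 1)
    (h1 : ∀ y ∈ U, ∀ a C, 𝒜 (Fin.succ a) y 0 C = if C = a.succ then 1 else 0)
    (h2 : ∀ y ∈ U, ∀ a b c, 𝒜 (Fin.succ a) y b.succ c.succ = thomasCoeff nab φ a b c y)
    {y : Eucl n} (hy : y ∈ U) (b d : Fin n) :
    ∑ C, curv 𝒜 C b.succ y d.succ C
      = thomasRicci nab φ b d y + (n - 1) * 𝒜 b.succ y d.succ 0 := by
  have hz : curv 𝒜 0 b.succ y = 0 := by
    have e : matD 0 b.succ (𝒜 0) y = 0 := by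
      rw [matD_congr hU hy (Y := fun _ => 1) h0]
      ext i j
      exact pd_const _ _ _
    have e' : matD 0 0 (𝒜 b.succ) y = 0 := by
      ext i j
      simp [matD]
    simp [curv, e, e', h0 y hy]
  have hc : ∀ c, curv 𝒜 c.succ b.succ y d.succ c.succ
      = pd c (thomasCoeff nab φ b d c) y - pd b (thomasCoeff nab φ c d c) y
        - (𝒜 c.succ y d.succ 0 * (if c = b then 1 else 0) - 𝒜 b.succ y d.succ 0
          + ∑ e, (thomasCoeff nab φ c d e y * thomasCoeff nab φ b e c y
            - thomasCoeff nab φ b d e y * thomasCoeff nab φ c e c y)) := by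
    intro c
    simp only [curv, matD, Matrix.sub_apply, Matrix.of_apply, Matrix.mul_apply, coneD_succ,
      Fin.sum_univ_succ, h1 y hy, h2 y hy, Finset.sum_sub_distrib, Fin.succ_inj, if_true]
    rw [pd_congr hU (fun z hz => h2 z hz b d c) hy, pd_congr hU (fun z hz => h2 z hz c d c) hy]
    ring
  rw [Fin.sum_univ_succ, hz]
  simp only [hc, Finset.sum_sub_distrib, Finset.sum_add_distrib]
  have t1 : ∑ c, pd b (thomasCoeff nab φ c d c) y = 0 := by
    rw [← pd_sum _ fun c _ => diffAt_of_contDiffOn φ.1.open_target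
      (contDiffOn_thomasCoeff nab φ c d c) (hUφ hy),
      pd_congr φ.1.open_target (fun z hz => thomasCoeff_trace_left nab φ d hz) (hUφ hy), pd_const]
  have t2 : ∑ c, ∑ e, thomasCoeff nab φ b d e y * thomasCoeff nab φ c e c y = 0 := by
    rw [Finset.sum_comm]
    simp only [← Finset.mul_sum, thomasCoeff_trace_left nab φ _ (hUφ hy), mul_zero,
      Finset.sum_const_zero]
  rw [t1, t2, thomasRicci]
  simp only [mul_ite, mul_one, mul_zero, Finset.sum_ite_eq', Finset.mem_univ, if_true,
    Finset.sum_const, Finset.card_univ, Fintype.card_fin, nsmul_eq_mul, Matrix.zero_apply,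
    mul_comm (thomasCoeff nab φ _ d _ y)]
  ring

end ProjTractor

namespace ProjTractor

open scoped Kronecker

variable {n : ℕ} {M : Type*} [TopologicalSpace M] [ChartedSpace (Eucl n) M]
  [IsManifold (𝓡 n) ∞ M] {ι κ : Type*} [Fintype ι] [DecidableEq ι] [Fintype κ] [DecidableEq κ]

/-! ### The symmetries of the tractor curvature -/

lemma curv_antisymm (𝒜 : Idx n → Eucl n → Matrix ι ι ℝ) (A B : Idx n) (y : Eucl n) :
    curv 𝒜 A B y = - curv 𝒜 B A y := by
  simp only [curv]
  abel

section

variable [T2Space M] (hn : 2 ≤ n) (nab : AffineConnection n M) (φ : Chart n M) {y : Eucl n}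
  (hy : y ∈ φ.1.target)
include hy

lemma curv_coneForm_zero_left (B : Idx n) : curv (coneForm nab φ) 0 B y = 0 := by
  have e : matD 0 B (coneForm nab φ 0) y = 0 := by
    rw [matD_congr φ.1.open_target hy (Y := fun _ => 1) fun z _ => coneForm_zero nab φ z]
    ext i j
    refine Fin.cases ?_ (fun b => ?_) B
    · simp [matD]
    · exact pd_const _ _ _
  have e' : matD 0 0 (coneForm nab φ B) y = 0 := by
    ext i j
    simp [matD]
  simp [curv, e, e', coneForm_zero]

lemma curv_coneForm_zero_right (A : Idx n) : curv (coneForm nab φ) A 0 y = 0 := by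
  rw [curv_antisymm, curv_coneForm_zero_left nab φ hy, neg_zero]

include hn

/-- The algebraic Bianchi identity. -/
lemma curv_coneForm_cyclic (A B D C : Idx n) :
    curv (coneForm nab φ) A B y D C + curv (coneForm nab φ) B D y A C
      + curv (coneForm nab φ) D A y B C = 0 := by
  have hd : ∀ A B D, matD 0 A (coneForm nab φ B) y D C = matD 0 A (coneForm nab φ D) y B C :=
    fun A B D => coneD_congr φ.1.open_target
      (fun z hz => coneForm_symm hn nab φ hz B D C) hy 0 A
  simp only [curv, Matrix.sub_apply, Matrix.mul_apply]
  rw [hd A B D, hd B D A, hd D A B]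
  have e : ∀ A B D : Idx n, ∑ E, coneForm nab φ A y D E * coneForm nab φ B y E C
      = ∑ E, coneForm nab φ D y A E * coneForm nab φ B y E C := fun A B D =>
    Finset.sum_congr rfl fun E _ => by rw [coneForm_symm hn nab φ hy A D E]
  rw [e A B D, e B A D, e B D A]
  ring

/-- The curvature annihilates the canonical tractor. -/
lemma curv_coneForm_apply_zero (A B C : Idx n) : curv (coneForm nab φ) A B y 0 C = 0 := by
  have h := curv_coneForm_cyclic hn nab φ hy A B 0 C
  rwa [curv_coneForm_zero_right nab φ hy, curv_coneForm_zero_left nab φ hy, Matrix.zero_apply,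
    Matrix.zero_apply, add_zero, add_zero] at h

/-- The curvature is trace-free; this normalisation determines the tractor connection. -/
lemma trace_curv_coneForm (B D : Idx n) : ∑ C, curv (coneForm nab φ) C B y D C = 0 := by
  refine Fin.cases ?_ (fun b => ?_) B
  · simp [curv_coneForm_zero_right nab φ hy]
  refine Fin.cases ?_ (fun d => ?_) D
  · simp [curv_coneForm_apply_zero hn nab φ hy]
  rw [trace_curv nab φ φ.1.open_target subset_rfl (fun z _ => coneForm_zero nab φ z)
    (fun z _ a C => coneForm_apply_zero nab φ a.succ z C)
    (fun z _ a b c => tractorForm_succ_succ nab φ a b c z) hy b d, coneForm_succ,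
    tractorForm_succ_zero hn nab φ b d hy]
  have hn' : (2 : ℝ) ≤ n := by exact_mod_cast hn
  have h1 : (n : ℝ) - 1 ≠ 0 := by linarith
  field_simp
  ring

end

/-! ### The tractor connection in different charts -/

lemma pullForm_coneForm_zero (nab : AffineConnection n M) (φ ψ : Chart n M) (y : Eucl n) :
    pullForm (coneJac φ ψ) (coordChange φ ψ) (coneForm nab ψ) 0 y = 1 := by
  simp [pullForm, coneJac_zero, coneForm_zero]

lemma pullForm_coneForm_apply_zero (nab : AffineConnection n M) (φ ψ : Chart n M) (y : Eucl n)
    (A D : Idx n) :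
    pullForm (coneJac φ ψ) (coordChange φ ψ) (coneForm nab ψ) A y 0 D = coneJac φ ψ y A D := by
  simp [pullForm, Matrix.sum_apply, coneForm_apply_zero]

lemma pullForm_coneForm_succ_succ (nab : AffineConnection n M) (φ ψ : Chart n M) (y : Eucl n)
    (a f d : Fin n) :
    pullForm (coneJac φ ψ) (coordChange φ ψ) (coneForm nab ψ) a.succ y f.succ d.succ
      = densityLogDeriv φ ψ a y * (if f = d then 1 else 0)
        + ∑ e, jacobian φ ψ y a e * thomasCoeff nab ψ e f d (coordChange φ ψ y) := by
  simp only [pullForm, Matrix.sum_apply, Matrix.smul_apply, smul_eq_mul, Fin.sum_univ_succ,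
    coneForm_zero, coneForm_succ, tractorForm_succ_succ, coneJac_succ_zero, coneJac_succ_succ,
    Matrix.one_apply, Fin.succ_inj]

/-- A trial connection form in the chart `φ`: it has the shape of the tractor connection, except
that its entries in the slots of the Schouten tensor are read off from the transformation law. -/
def trialForm (nab : AffineConnection n M) (φ ψ : Chart n M) (A : Idx n) (y : Eucl n) :
    Matrix (Idx n) (Idx n) ℝ :=
  Matrix.of fun B C => Fin.cases (if B = C then 1 else 0) (fun a =>
    Fin.cases (if C = a.succ then 1 else 0) (fun b =>
      Fin.cases
        (matD 0 a.succ (coneJac φ ψ) y b.succ 0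
          + (coneJac φ ψ y * pullForm (coneJac φ ψ) (coordChange φ ψ) (coneForm nab ψ) a.succ y)
            b.succ 0
          - ∑ c, thomasCoeff nab φ a b c y * coneJac φ ψ y c.succ 0)
        (fun c => thomasCoeff nab φ a b c y) C) B) A

lemma smoothMat_trialForm [T2Space M] (hn : 2 ≤ n) (nab : AffineConnection n M) (φ ψ : Chart n M)
    (A : Idx n) : SmoothMat (overlap φ ψ) (trialForm nab φ ψ A) := by
  have ho := isOpen_overlap φ ψ
  have hsub : overlap φ ψ ⊆ φ.1.target := fun z hz => (mem_overlap.1 hz).1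
  intro B C
  refine Fin.cases ?_ (fun a => ?_) A
  · exact contDiffOn_const
  refine Fin.cases ?_ (fun b => ?_) B
  · exact contDiffOn_const
  refine Fin.cases ?_ (fun c => ?_) C
  · exact (((smoothMat_coneJac φ ψ).matD ho 0 a.succ b.succ 0).add
      (((smoothMat_coneJac φ ψ).mul
        (smoothMat_pullForm (smoothMat_coneForm hn nab ψ) a.succ)) b.succ 0)).sub
      (ContDiffOn.sum fun c _ => ((contDiffOn_thomasCoeff nab φ a b c).mono hsub).mul
        (smoothMat_coneJac φ ψ c.succ 0))
  · exact (contDiffOn_thomasCoeff nab φ a b c).mono hsub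

lemma isGauge_trialForm (nab : AffineConnection n M) (φ ψ : Chart n M) :
    IsGauge (overlap φ ψ) (coneJac φ ψ) (trialForm nab φ ψ)
      (pullForm (coneJac φ ψ) (coordChange φ ψ) (coneForm nab ψ)) := by
  intro y hy A
  refine Fin.cases ?_ (fun a => ?_) A
  · have e1 : trialForm nab φ ψ 0 y = 1 := by
      ext B C
      simp [trialForm, Matrix.one_apply]
    have e2 : matD 0 0 (coneJac φ ψ) y = 0 := by
      ext i j
      simp [matD]
    rw [e1, e2, pullForm_coneForm_zero, one_mul, mul_one, zero_add]
  · ext B D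
    refine Fin.cases ?_ (fun b => ?_) B
    · have e1 : ∀ C, trialForm nab φ ψ a.succ y 0 C = if C = a.succ then 1 else 0 := fun C => rfl
      rw [Matrix.add_apply, matD_coneJac_zero, Matrix.mul_apply, Matrix.mul_apply]
      simp [e1, coneJac_zero, pullForm_coneForm_apply_zero]
    · have e1 : ∀ c : Fin n, trialForm nab φ ψ a.succ y b.succ c.succ = thomasCoeff nab φ a b c y :=
        fun c => rfl
      refine Fin.cases ?_ (fun d => ?_) D
      · rw [Matrix.mul_apply, Fin.sum_univ_succ]
        simp only [e1, coneJac_zero, if_true, mul_one]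
        have e2 : trialForm nab φ ψ a.succ y b.succ 0 = matD 0 a.succ (coneJac φ ψ) y b.succ 0
          + (coneJac φ ψ y * pullForm (coneJac φ ψ) (coordChange φ ψ) (coneForm nab ψ) a.succ y)
            b.succ 0
          - ∑ c, thomasCoeff nab φ a b c y * coneJac φ ψ y c.succ 0 := rfl
        rw [e2, Matrix.add_apply]
        ring
      · rw [Matrix.mul_apply, Fin.sum_univ_succ, Matrix.add_apply, Matrix.mul_apply,
          Fin.sum_univ_succ]
        simp only [e1, coneJac_zero, Fin.succ_ne_zero, if_false, mul_zero, zero_add,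
          coneJac_succ_zero, coneJac_succ_succ, pullForm_coneForm_apply_zero,
          pullForm_coneForm_succ_succ]
        rw [thomasCoeff_change nab hy a b d]
        have e3 : matD 0 a.succ (coneJac φ ψ) y b.succ d.succ
          = pd a (fun z => jacobian φ ψ z b d) y := rfl
        have e4 : ∑ f, jacobian φ ψ y b f * (densityLogDeriv φ ψ a y * (if f = d then 1 else 0)
            + ∑ e, jacobian φ ψ y a e * thomasCoeff nab ψ e f d (coordChange φ ψ y))
            = densityLogDeriv φ ψ a y * jacobian φ ψ y b d
              + ∑ e, ∑ f, jacobian φ ψ y a e * jacobian φ ψ y b f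
                * thomasCoeff nab ψ e f d (coordChange φ ψ y) := by
          simp only [mul_add, Finset.sum_add_distrib]
          congr 1
          · simp [mul_comm]
          · rw [Finset.sum_comm]
            refine Finset.sum_congr rfl fun f _ => ?_
            rw [Finset.mul_sum]
            exact Finset.sum_congr rfl fun e _ => by ring
        rw [e3, e4]
        ring

/-- Trace-freeness of a curvature is preserved by a change of frame. -/
lemma trace_conj_eq_zero {N N' : Matrix ι ι ℝ} (h : N' * N = 1) (X : ι → ι → Matrix ι ι ℝ)
    (hX : ∀ G H, ∑ E, X E G H E = 0) (B D : ι) :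
    ∑ C, (N * (∑ E, ∑ G, (N C E * N B G) • X E G) * N') D C = 0 := by
  have e : ∀ C, (N * (∑ E, ∑ G, (N C E * N B G) • X E G) * N') D C
      = ∑ E, ∑ G, N B G * ((N * X E G * N') D C * N C E) := by
    intro C
    simp only [Matrix.mul_sum, Matrix.sum_mul, Matrix.mul_smul, Matrix.smul_mul, Matrix.sum_apply,
      Matrix.smul_apply, smul_eq_mul]
    exact Finset.sum_congr rfl fun E _ => Finset.sum_congr rfl fun G _ => by ring
  simp only [e]
  rw [Finset.sum_comm]
  have e' : ∀ E, ∑ C, ∑ G, N B G * ((N * X E G * N') D C * N C E)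
      = ∑ G, N B G * ∑ H, N D H * X E G H E := by
    intro E
    rw [Finset.sum_comm]
    refine Finset.sum_congr rfl fun G _ => ?_
    rw [← Finset.mul_sum, ← Matrix.mul_apply, Matrix.mul_assoc, h, Matrix.mul_one,
      Matrix.mul_apply]
  simp only [e']
  rw [Finset.sum_comm]
  refine Finset.sum_eq_zero fun G _ => ?_
  rw [← Finset.mul_sum, Finset.sum_comm]
  simp only [← Finset.mul_sum, hX, mul_zero, Finset.sum_const_zero]

/-- The tractor connection forms of two charts are related by the transition functions of the
cotractor bundle. -/
theorem isGauge_coneForm [T2Space M] (hn : 2 ≤ n) (nab : AffineConnection n M) (φ ψ : Chart n M) :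
    IsGauge (overlap φ ψ) (coneJac φ ψ) (coneForm nab φ)
      (pullForm (coneJac φ ψ) (coordChange φ ψ) (coneForm nab ψ)) := by
  have ho := isOpen_overlap φ ψ
  have hsub : overlap φ ψ ⊆ φ.1.target := fun z hz => (mem_overlap.1 hz).1
  have hg := isGauge_trialForm nab φ ψ
  suffices h : ∀ y ∈ overlap φ ψ, ∀ A, coneForm nab φ A y = trialForm nab φ ψ A y by
    intro y hy A
    rw [h y hy A]
    exact hg y hy A
  intro y hy
  set N := coneJac φ ψ y with hN
  have hdet : IsUnit N.det := (coneJac_det_ne_zero hy).isUnit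
  -- The curvature of the trial form is conjugate to that of the connection in the chart `ψ`,
  -- so it has the same trace; this pins down the remaining entries.
  have hcurv : ∀ A B, curv (trialForm nab φ ψ) A B y
      = N * (∑ E, ∑ G, (N A E * N B G) • curv (coneForm nab ψ) E G (coordChange φ ψ y)) * N⁻¹ := by
    intro A B
    rw [← curv_pullForm hy (smoothMat_coneForm hn nab ψ),
      ← hg.curv_mul ho hy (smoothMat_coneJac φ ψ) (smoothMat_trialForm hn nab φ ψ)
        (fun A => smoothMat_pullForm (smoothMat_coneForm hn nab ψ) A) A B,
      Matrix.mul_nonsing_inv_cancel_right _ _ hdet]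
  have htr : ∀ B D, ∑ C, curv (trialForm nab φ ψ) C B y D C = 0 := by
    intro B D
    simp only [hcurv]
    exact trace_conj_eq_zero (Matrix.nonsing_inv_mul N hdet) _
      (fun G H => trace_curv_coneForm hn nab ψ (coordChange_mem_target hy) G H) B D
  have hn' : (2 : ℝ) ≤ n := by exact_mod_cast hn
  have h1 : (n : ℝ) - 1 ≠ 0 := by linarith
  intro A
  ext B C
  refine Fin.cases ?_ (fun a => ?_) A
  · rw [coneForm_zero]
    simp [trialForm, Matrix.one_apply]
  refine Fin.cases ?_ (fun b => ?_) B
  · rw [coneForm_apply_zero]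
    rfl
  refine Fin.cases ?_ (fun c => ?_) C
  · have h := trace_curv nab φ ho hsub (𝒜 := trialForm nab φ ψ)
      (fun z _ => by ext B C; simp [trialForm, Matrix.one_apply])
      (fun z _ a C => rfl) (fun z _ a b c => rfl) hy a b
    rw [htr] at h
    rw [coneForm_succ, tractorForm_succ_zero hn nab φ a b (hsub hy)]
    field_simp
    linarith
  · rw [coneForm_succ, tractorForm_succ_succ]
    rfl

end ProjTractor

namespace ProjTractor

open scoped Kronecker

variable {n : ℕ} {M : Type*} [TopologicalSpace M] [ChartedSpace (Eucl n) M]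
  [IsManifold (𝓡 n) ∞ M] {ι κ : Type*} [Fintype ι] [DecidableEq ι] [Fintype κ] [DecidableEq κ]

/-! ### The Thomas operator in matrix form -/

lemma kronSum_sum_mul (X : Matrix ι ι ℝ) (Y : Matrix κ κ ℝ) (f : ι × κ → ℝ) (i : ι) (j : κ) :
    ∑ p, kronSum X Y (i, j) p * f p = ∑ i', X i i' * f (i', j) + ∑ j', Y j j' * f (i, j') :=
  kronSum_mul_apply X Y (Matrix.of fun p (_ : Unit) => f p) i j ()

/-- All covariant derivatives of a field of degree `m`, collected into one field; the new index
comes first. -/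
def gradD (m : ℝ) (𝒜 : Idx n → Eucl n → Matrix ι ι ℝ) (T : Eucl n → Matrix ι κ ℝ) (y : Eucl n) :
    Matrix (Idx n × ι) κ ℝ :=
  Matrix.of fun p j => covD m 𝒜 p.1 T y p.2 j

lemma SmoothMat.gradD {U : Set (Eucl n)} (hU : IsOpen U) {𝒜 : Idx n → Eucl n → Matrix ι ι ℝ}
    {T : Eucl n → Matrix ι κ ℝ} (h𝒜 : ∀ A, SmoothMat U (𝒜 A)) (hT : SmoothMat U T) (m : ℝ) :
    SmoothMat U (gradD m 𝒜 T) := fun p j => hT.covD hU h𝒜 m p.1 p.2 j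

lemma gradD_congr {U : Set (Eucl n)} (hU : IsOpen U) {𝒜 𝒜' : Idx n → Eucl n → Matrix ι ι ℝ}
    {T T' : Eucl n → Matrix ι κ ℝ} (h𝒜 : ∀ y ∈ U, ∀ A, 𝒜 A y = 𝒜' A y) (hT : ∀ y ∈ U, T y = T' y)
    (m : ℝ) {y : Eucl n} (hy : y ∈ U) : gradD m 𝒜 T y = gradD m 𝒜' T' y := by
  ext ⟨A, i⟩ j
  simp only [gradD, Matrix.of_apply, covD]
  rw [matD_congr hU hy hT, h𝒜 y hy, hT y hy]

/-- Covariant differentiation commutes with the transition functions. -/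
lemma gradD_change {φ ψ : Chart n M} {𝒩 : Eucl n → Matrix ι ι ℝ}
    {𝒜 𝒜' : Idx n → Eucl n → Matrix ι ι ℝ}
    (hg : IsGauge (overlap φ ψ) 𝒩 𝒜 (pullForm (coneJac φ ψ) (coordChange φ ψ) 𝒜'))
    (h𝒩 : SmoothMat (overlap φ ψ) 𝒩) {T T' : Eucl n → Matrix ι κ ℝ}
    (hT' : SmoothMat ψ.1.target T') (m : ℕ)
    (hT : ∀ z ∈ overlap φ ψ,
      T z = densityTrans φ ψ z ^ m • (𝒩 z * T' (coordChange φ ψ z)))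
    {y : Eucl n} (hy : y ∈ overlap φ ψ) :
    gradD m 𝒜 T y = densityTrans φ ψ y ^ m
      • ((coneJac φ ψ y ⊗ₖ 𝒩 y) * gradD m 𝒜' T' (coordChange φ ψ y)) := by
  have ho := isOpen_overlap φ ψ
  have key : ∀ A, covD m 𝒜 A T y = densityTrans φ ψ y ^ m
      • (𝒩 y * ∑ E, coneJac φ ψ y A E • covD m 𝒜' E T' (coordChange φ ψ y)) := by
    intro A
    rw [hg.covD ho hy h𝒩
      (T' := fun z => densityTrans φ ψ z ^ m • T' (coordChange φ ψ z))
      (SmoothMat.smul ((contDiffOn_densityTrans φ ψ).pow m) hT'.comp_coordChange)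
      (fun z hz => by rw [hT z hz, Matrix.mul_smul]) m A, covD,
      matD_comp_coordChange hy ψ.1.open_target hT' (coordChange_mem_target hy), pullForm,
      Matrix.mul_smul, ← smul_sub, Matrix.mul_smul, Matrix.sum_mul, ← Finset.sum_sub_distrib]
    simp only [covD, smul_sub, Matrix.smul_mul]
  ext ⟨A, i⟩ j
  have := congrFun (congrFun (key A) i) j
  simp only [gradD, Matrix.of_apply]
  rw [this]
  simp only [Matrix.smul_apply, Matrix.mul_apply, Matrix.sum_apply, Matrix.kroneckerMap_apply,
    Fintype.sum_prod_type, Matrix.of_apply, smul_eq_mul, Finset.mul_sum]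
  rw [Finset.sum_comm]
  exact Finset.sum_congr rfl fun E _ => Finset.sum_congr rfl fun j' _ => by ring

section Forms

variable (nab : AffineConnection n M) (φ : Chart n M)

/-- The connection form on the second tensor power of the cotractor bundle. -/
def coneForm₂ (A : Idx n) (y : Eucl n) : Matrix (Idx n × Idx n) (Idx n × Idx n) ℝ :=
  kronSum (coneForm nab φ A y) (coneForm nab φ A y)

/-- The connection form on the third tensor power of the cotractor bundle. -/
def coneForm₃ (A : Idx n) (y : Eucl n) :
    Matrix (Idx n × Idx n × Idx n) (Idx n × Idx n × Idx n) ℝ :=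
  kronSum (coneForm nab φ A y) (coneForm₂ nab φ A y)

/-- The connection form on the fourth tensor power of the cotractor bundle. -/
def coneForm₄ (A : Idx n) (y : Eucl n) :
    Matrix (Idx n × Idx n × Idx n × Idx n) (Idx n × Idx n × Idx n × Idx n) ℝ :=
  kronSum (coneForm nab φ A y) (coneForm₃ nab φ A y)

/-- The components of a two-index cotractor field as a column. -/
def col₂ (T : TractorComp n 2 0) (y : Eucl n) : Matrix (Idx n × Idx n) Unit ℝ :=
  Matrix.of fun p _ => T ![p.1, p.2] ![] y

/-- The components of a three-index cotractor field as a column. -/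
def col₃ (T : TractorComp n 3 0) (y : Eucl n) : Matrix (Idx n × Idx n × Idx n) Unit ℝ :=
  Matrix.of fun p _ => T ![p.1, p.2.1, p.2.2] ![] y

/-- The components of a four-index cotractor field as a column. -/
def col₄ (T : TractorComp n 4 0) (y : Eucl n) : Matrix (Idx n × Idx n × Idx n × Idx n) Unit ℝ :=
  Matrix.of fun p _ => T ![p.1, p.2.1, p.2.2.1, p.2.2.2] ![] y

variable {φ} {y : Eucl n} (hy : y ∈ φ.1.target)
include hy

lemma thomasD_two (w : ℝ) (T : TractorComp n 2 0) (A B C : Idx n) :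
    thomasD nab φ w T ![A, B, C] ![] y = coneD (w + 2) A (T ![B, C] ![]) y
      - (∑ H, coneForm nab φ A y B H * T ![H, C] ![] y
        + ∑ H, coneForm nab φ A y C H * T ![B, H] ![] y) := by
  have e0 : ∀ H, Function.update ![B, C] 0 H = ![H, C] := fun H => by
    ext i; fin_cases i <;> rfl
  have e1 : ∀ H, Function.update ![B, C] 1 H = ![B, H] := fun H => by
    ext i; fin_cases i <;> rfl
  rw [thomasD_eq nab φ w T hy]
  have e : Fin.tail ![A, B, C] = ![B, C] := rfl
  simp [e, e0, e1, Fin.sum_univ_succ (n := 1)]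

lemma thomasD_three (w : ℝ) (T : TractorComp n 3 0) (A B C D : Idx n) :
    thomasD nab φ w T ![A, B, C, D] ![] y = coneD (w + 3) A (T ![B, C, D] ![]) y
      - (∑ H, coneForm nab φ A y B H * T ![H, C, D] ![] y
        + (∑ H, coneForm nab φ A y C H * T ![B, H, D] ![] y
        + ∑ H, coneForm nab φ A y D H * T ![B, C, H] ![] y)) := by
  have e0 : ∀ H, Function.update ![B, C, D] 0 H = ![H, C, D] := fun H => by
    ext i; fin_cases i <;> rfl
  have e1 : ∀ H, Function.update ![B, C, D] 1 H = ![B, H, D] := fun H => by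
    ext i; fin_cases i <;> rfl
  have e2 : ∀ H, Function.update ![B, C, D] 2 H = ![B, C, H] := fun H => by
    ext i; fin_cases i <;> rfl
  rw [thomasD_eq nab φ w T hy]
  have e : Fin.tail ![A, B, C, D] = ![B, C, D] := rfl
  rw [e, Fin.sum_univ_three]
  simp [e0, e1, e2, add_assoc]

lemma thomasD_four (w : ℝ) (T : TractorComp n 4 0) (A B C D E : Idx n) :
    thomasD nab φ w T ![A, B, C, D, E] ![] y = coneD (w + 4) A (T ![B, C, D, E] ![]) y
      - (∑ H, coneForm nab φ A y B H * T ![H, C, D, E] ![] y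
        + (∑ H, coneForm nab φ A y C H * T ![B, H, D, E] ![] y
        + (∑ H, coneForm nab φ A y D H * T ![B, C, H, E] ![] y
        + ∑ H, coneForm nab φ A y E H * T ![B, C, D, H] ![] y))) := by
  have e0 : ∀ H, Function.update ![B, C, D, E] 0 H = ![H, C, D, E] := fun H => by
    ext i; fin_cases i <;> rfl
  have e1 : ∀ H, Function.update ![B, C, D, E] 1 H = ![B, H, D, E] := fun H => by
    ext i; fin_cases i <;> rfl
  have e2 : ∀ H, Function.update ![B, C, D, E] 2 H = ![B, C, H, E] := fun H => by
    ext i; fin_cases i <;> rfl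
  have e3 : ∀ H, Function.update ![B, C, D, E] 3 H = ![B, C, D, H] := fun H => by
    ext i; fin_cases i <;> rfl
  rw [thomasD_eq nab φ w T hy]
  have e : Fin.tail ![A, B, C, D, E] = ![B, C, D, E] := rfl
  rw [e, Fin.sum_univ_four]
  simp [e0, e1, e2, e3, add_assoc]

lemma col₃_thomasD (w : ℝ) (T : TractorComp n 2 0) :
    col₃ (thomasD nab φ w T) y = gradD (w + 2) (coneForm₂ nab φ) (col₂ T) y := by
  ext ⟨A, B, C⟩ u
  simp only [col₃, gradD, covD, Matrix.of_apply, Matrix.sub_apply, coneForm₂, kronSum_mul_apply]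
  exact thomasD_two nab hy w T A B C

lemma col₄_thomasD (w : ℝ) (T : TractorComp n 3 0) :
    col₄ (thomasD nab φ w T) y = gradD (w + 3) (coneForm₃ nab φ) (col₃ T) y := by
  ext ⟨A, B, C, D⟩ u
  simp only [col₄, gradD, covD, Matrix.of_apply, Matrix.sub_apply, coneForm₂, coneForm₃,
    kronSum_mul_apply, kronSum_sum_mul]
  exact thomasD_three nab hy w T A B C D

end Forms

section Smooth

variable [T2Space M] (hn : 2 ≤ n) (nab : AffineConnection n M)
include hn

lemma smoothMat_coneForm₂ (φ : Chart n M) (A : Idx n) :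
    SmoothMat φ.1.target (coneForm₂ nab φ A) :=
  (smoothMat_coneForm hn nab φ A).kronSum (smoothMat_coneForm hn nab φ A)

lemma smoothMat_coneForm₃ (φ : Chart n M) (A : Idx n) :
    SmoothMat φ.1.target (coneForm₃ nab φ A) :=
  (smoothMat_coneForm hn nab φ A).kronSum (smoothMat_coneForm₂ hn nab φ A)

lemma isGauge_coneForm₂ (φ ψ : Chart n M) :
    IsGauge (overlap φ ψ) (fun y => coneJac φ ψ y ⊗ₖ coneJac φ ψ y) (coneForm₂ nab φ)
      (pullForm (coneJac φ ψ) (coordChange φ ψ) (coneForm₂ nab ψ)) := by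
  have h := (isGauge_coneForm hn nab φ ψ).kronecker (isOpen_overlap φ ψ)
    (isGauge_coneForm hn nab φ ψ) (smoothMat_coneJac φ ψ) (smoothMat_coneJac φ ψ)
  intro y hy A
  refine (h y hy A).trans (congrArg₂ (· + ·) rfl (congrArg₂ (· * ·) rfl ?_))
  exact (kronSum_pullForm _ _ _ _ A y).symm

lemma isGauge_coneForm₃ (φ ψ : Chart n M) :
    IsGauge (overlap φ ψ) (fun y => coneJac φ ψ y ⊗ₖ (coneJac φ ψ y ⊗ₖ coneJac φ ψ y))
      (coneForm₃ nab φ) (pullForm (coneJac φ ψ) (coordChange φ ψ) (coneForm₃ nab ψ)) := by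
  have h := (isGauge_coneForm hn nab φ ψ).kronecker (isOpen_overlap φ ψ)
    (isGauge_coneForm₂ hn nab φ ψ) (smoothMat_coneJac φ ψ)
    ((smoothMat_coneJac φ ψ).kronecker (isOpen_overlap φ ψ) (smoothMat_coneJac φ ψ))
  intro y hy A
  refine (h y hy A).trans (congrArg₂ (· + ·) rfl (congrArg₂ (· * ·) rfl ?_))
  exact (kronSum_pullForm _ _ _ _ A y).symm

end Smooth

lemma ProjEquiv.coneForm₂_eq [T2Space M] (hn : 2 ≤ n) {nab nab' : AffineConnection n M}
    (h : ProjEquiv nab nab') (φ : Chart n M) {y : Eucl n} (hy : y ∈ φ.1.target) (A : Idx n) :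
    coneForm₂ nab φ A y = coneForm₂ nab' φ A y := by
  simp only [coneForm₂]
  rw [h.coneForm_eq hn φ A hy]

lemma ProjEquiv.coneForm₃_eq [T2Space M] (hn : 2 ≤ n) {nab nab' : AffineConnection n M}
    (h : ProjEquiv nab nab') (φ : Chart n M) {y : Eucl n} (hy : y ∈ φ.1.target) (A : Idx n) :
    coneForm₃ nab φ A y = coneForm₃ nab' φ A y := by
  simp only [coneForm₃]
  rw [h.coneForm_eq hn φ A hy, h.coneForm₂_eq hn φ hy]

end ProjTractor

namespace ProjTractor

open scoped Kronecker

variable {n : ℕ} {M : Type*} [TopologicalSpace M] [ChartedSpace (Eucl n) M]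
  [IsManifold (𝓡 n) ∞ M]

/-! ### The splitting operator -/

lemma young22_apply (T : (Fin 4 → Idx n) → ℝ) (B C D E : Idx n) :
    young22 T ![B, C, D, E] =
      ((T ![B, C, D, E] - T ![B, E, D, C] - T ![D, C, B, E] + T ![D, E, B, C])
      + (T ![B, C, E, D] - T ![B, D, E, C] - T ![E, C, B, D] + T ![E, D, B, C])
      + (T ![C, B, D, E] - T ![C, E, D, B] - T ![D, B, C, E] + T ![D, E, C, B])
      + (T ![C, B, E, D] - T ![C, D, E, B] - T ![E, B, C, D] + T ![E, D, C, B])) / 16 := by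
  have e01 : ∀ B C D E : Idx n, ![B, C, D, E] ∘ Equiv.swap (0 : Fin 4) 1 = ![C, B, D, E] :=
    fun B C D E => by ext i; fin_cases i <;> rfl
  have e23 : ∀ B C D E : Idx n, ![B, C, D, E] ∘ Equiv.swap (2 : Fin 4) 3 = ![B, C, E, D] :=
    fun B C D E => by ext i; fin_cases i <;> rfl
  have e02 : ∀ B C D E : Idx n, ![B, C, D, E] ∘ Equiv.swap (0 : Fin 4) 2 = ![D, C, B, E] :=
    fun B C D E => by ext i; fin_cases i <;> rfl
  have e13 : ∀ B C D E : Idx n, ![B, C, D, E] ∘ Equiv.swap (1 : Fin 4) 3 = ![B, E, D, C] :=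
    fun B C D E => by ext i; fin_cases i <;> rfl
  simp only [young22, symmPos, altPos, e01, e23, e02, e13]
  ring

lemma hasYoung22_young22 (T : (Fin 4 → Idx n) → ℝ) : HasYoung22 (young22 T) := by
  refine ⟨fun B C D E => ?_, fun B C D E => ?_, fun B C D E => ?_⟩ <;>
    simp only [young22_apply] <;> ring

lemma young22_zero (J : Fin 4 → Idx n) : young22 (fun _ => (0 : ℝ)) J = 0 := by
  simp [young22, symmPos, altPos]

lemma eq_vec_four (J : Fin 4 → Idx n) : J = ![J 0, J 1, J 2, J 3] := by
  ext i
  fin_cases i <;> rfl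

/-- The action of a transition matrix on the components of a cotractor. -/
def frameChange (N : Idx n → Idx n → ℝ) {r : ℕ} (T : (Fin r → Idx n) → ℝ) (J : Fin r → Idx n) :
    ℝ := ∑ H : Fin r → Idx n, (∏ i, N (J i) (H i)) * T H

lemma frameChange_perm (N : Idx n → Idx n → ℝ) {r : ℕ} (T : (Fin r → Idx n) → ℝ)
    (σ : Equiv.Perm (Fin r)) (J : Fin r → Idx n) :
    frameChange N T (J ∘ σ) = frameChange N (fun H => T (H ∘ σ)) J := by
  refine Fintype.sum_equiv (Equiv.arrowCongr σ (Equiv.refl _)) _ _ fun H => ?_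
  have e : (Equiv.arrowCongr σ (Equiv.refl (Idx n)) H) ∘ σ = H := by
    ext i
    simp [Equiv.arrowCongr]
  change _ = _ * T (Equiv.arrowCongr σ (Equiv.refl (Idx n)) H ∘ σ)
  rw [e]
  congr 1
  refine Fintype.prod_equiv σ _ _ fun i => ?_
  rw [← congrFun e i]
  rfl

lemma frameChange_symmPos (N : Idx n → Idx n → ℝ) {r : ℕ} (T : (Fin r → Idx n) → ℝ)
    (i j : Fin r) : symmPos i j (frameChange N T) = frameChange N (symmPos i j T) := by
  ext J
  rw [symmPos, frameChange_perm]
  simp only [frameChange, symmPos, ← Finset.sum_add_distrib, Finset.sum_div]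
  exact Finset.sum_congr rfl fun H _ => by ring

lemma frameChange_altPos (N : Idx n → Idx n → ℝ) {r : ℕ} (T : (Fin r → Idx n) → ℝ)
    (i j : Fin r) : altPos i j (frameChange N T) = frameChange N (altPos i j T) := by
  ext J
  rw [altPos, frameChange_perm]
  simp only [frameChange, altPos, ← Finset.sum_sub_distrib, Finset.sum_div]
  exact Finset.sum_congr rfl fun H _ => by ring

lemma frameChange_young22 (N : Idx n → Idx n → ℝ) (T : (Fin 4 → Idx n) → ℝ) :
    young22 (frameChange N T) = frameChange N (young22 T) := by
  simp only [young22, frameChange_symmPos, frameChange_altPos]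

variable (n) in
/-- Four-tuples of indices as functions on `Fin 4`. -/
def tupleEquiv : Idx n × Idx n × Idx n × Idx n ≃ (Fin 4 → Idx n) where
  toFun p := ![p.1, p.2.1, p.2.2.1, p.2.2.2]
  invFun J := (J 0, J 1, J 2, J 3)
  left_inv _ := rfl
  right_inv J := (eq_vec_four J).symm

lemma frameChange_eq_kronecker (N : Matrix (Idx n) (Idx n) ℝ) (c : ℝ) (T : (Fin 4 → Idx n) → ℝ)
    (J : Fin 4 → Idx n) :
    frameChange (fun A B => c * N A B) T J
      = c ^ 4 * ((N ⊗ₖ (N ⊗ₖ (N ⊗ₖ N)))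
        * (Matrix.of fun p (_ : Unit) => T (tupleEquiv n p))) (J 0, J 1, J 2, J 3) () := by
  rw [frameChange, ← (tupleEquiv n).sum_comp, Matrix.mul_apply, Finset.mul_sum]
  refine Finset.sum_congr rfl fun p _ => ?_
  have e : ∏ i, c * N (J i) (tupleEquiv n p i) = c * N (J 0) p.1 * (c * N (J 1) p.2.1)
      * (c * N (J 2) p.2.2.1) * (c * N (J 3) p.2.2.2) := Fin.prod_univ_four _
  rw [e]
  simp only [Matrix.kroneckerMap_apply, Matrix.of_apply]
  ring

lemma tractorOf_zero_left (k : Fin n → Fin n → Eucl n → ℝ) (C : Idx n) (y : Eucl n) :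
    tractorOf k ![0, C] ![] y = 0 := by
  simp [tractorOf, inclZ, (Fin.succ_ne_zero _).symm]

lemma tractorOf_zero_right (k : Fin n → Fin n → Eucl n → ℝ) (B : Idx n) (y : Eucl n) :
    tractorOf k ![B, 0] ![] y = 0 := by
  simp [tractorOf, inclZ, (Fin.succ_ne_zero _).symm]

lemma tractorOf_succ_succ (k : Fin n → Fin n → Eucl n → ℝ) (a b : Fin n) (y : Eucl n) :
    tractorOf k ![a.succ, b.succ] ![] y = k a b y := by
  simp [tractorOf, inclZ, Fin.succ_inj]

lemma smoothMat_tractorOf {w : ℝ} {k : TensorFamily n M} (hk : IsSymTensor w k) (φ : Chart n M) :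
    SmoothMat φ.1.target (col₂ (tractorOf (k φ))) := fun p u => by
  simp only [col₂, Matrix.of_apply, tractorOf]
  exact ContDiffOn.sum fun a _ => ContDiffOn.sum fun b _ => contDiffOn_const.mul (hk.smooth φ a b)

lemma tractorOf_change {k : TensorFamily n M} (hk : IsSymTensor 4 k) {φ ψ : Chart n M}
    {y : Eucl n} (hy : y ∈ overlap φ ψ) :
    col₂ (tractorOf (k φ)) y = densityTrans φ ψ y ^ 4
      • ((coneJac φ ψ y ⊗ₖ coneJac φ ψ y) * col₂ (tractorOf (k ψ)) (coordChange φ ψ y)) := by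
  ext ⟨B, C⟩ u
  simp only [col₂, Matrix.of_apply, Matrix.smul_apply, Matrix.mul_apply, Fintype.sum_prod_type,
    Matrix.kroneckerMap_apply, Fin.sum_univ_succ, tractorOf_zero_left, tractorOf_zero_right,
    tractorOf_succ_succ, mul_zero, Finset.sum_const_zero, zero_add, smul_eq_mul]
  refine Fin.cases ?_ (fun b => ?_) B
  · simp [tractorOf_zero_left, coneJac_zero]
  refine Fin.cases ?_ (fun c => ?_) C
  · simp [tractorOf_zero_right, coneJac_zero]
  rw [tractorOf_succ_succ, hk.trans φ ψ y hy]
  simp only [coneJac_succ_succ]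
  rw [show (4 : ℝ) = ((4 : ℕ) : ℝ) by norm_num, Real.rpow_natCast]

section Splitting

variable [T2Space M] (hn : 2 ≤ n) {nab : AffineConnection n M} {k : TensorFamily n M}
include hn

lemma col₄_eq (φ : Chart n M) {y : Eucl n} (hy : y ∈ φ.1.target) :
    col₄ (thomasD nab φ 1 (thomasD nab φ 2 (tractorOf (k φ)))) y
      = gradD 4 (coneForm₃ nab φ) (gradD 4 (coneForm₂ nab φ) (col₂ (tractorOf (k φ)))) y := by
  rw [col₄_thomasD nab hy, show (1 : ℝ) + 3 = 4 by norm_num]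
  refine gradD_congr φ.1.open_target (fun _ _ _ => rfl) (fun z hz => ?_) 4 hy
  rw [col₃_thomasD nab hz, show (2 : ℝ) + 2 = 4 by norm_num]

lemma smoothMat_gradD_tractorOf (hk : IsSymTensor 4 k) (φ : Chart n M) :
    SmoothMat φ.1.target (gradD 4 (coneForm₂ nab φ) (col₂ (tractorOf (k φ)))) :=
  (smoothMat_tractorOf hk φ).gradD φ.1.open_target (smoothMat_coneForm₂ hn nab φ) 4

lemma smoothMat_gradD_gradD_tractorOf (hk : IsSymTensor 4 k) (φ : Chart n M) :
    SmoothMat φ.1.target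
      (gradD 4 (coneForm₃ nab φ) (gradD 4 (coneForm₂ nab φ) (col₂ (tractorOf (k φ))))) :=
  (smoothMat_gradD_tractorOf hn hk φ).gradD φ.1.open_target (smoothMat_coneForm₃ hn nab φ) 4

lemma col₄_change (hk : IsSymTensor 4 k) {φ ψ : Chart n M} {y : Eucl n} (hy : y ∈ overlap φ ψ) :
    col₄ (thomasD nab φ 1 (thomasD nab φ 2 (tractorOf (k φ)))) y = densityTrans φ ψ y ^ 4
      • ((coneJac φ ψ y ⊗ₖ (coneJac φ ψ y ⊗ₖ (coneJac φ ψ y ⊗ₖ coneJac φ ψ y)))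
        * col₄ (thomasD nab ψ 1 (thomasD nab ψ 2 (tractorOf (k ψ)))) (coordChange φ ψ y)) := by
  have ho := isOpen_overlap φ ψ
  have hN := smoothMat_coneJac φ ψ
  rw [col₄_eq hn φ (mem_overlap.1 hy).1, col₄_eq hn ψ (coordChange_mem_target hy)]
  exact_mod_cast gradD_change (isGauge_coneForm₃ hn nab φ ψ) (hN.kronecker ho (hN.kronecker ho hN))
    (smoothMat_gradD_tractorOf hn hk ψ) 4 (fun z hz => by
      exact_mod_cast gradD_change (isGauge_coneForm₂ hn nab φ ψ) (hN.kronecker ho hN)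
        (smoothMat_tractorOf hk ψ) 4 (fun x hx => tractorOf_change hk hx) hz) hy

theorem isYoungTractor_splitting (hk : IsSymTensor 4 k) : IsYoungTractor (splitting nab k) where
  young φ y := hasYoung22_young22 _
  smooth φ J := by
    have hs : ∀ J, ContDiffOn ℝ ∞ (fun y => thomasD nab φ 1 (thomasD nab φ 2 (tractorOf (k φ)))
        J ![] y) φ.1.target := fun J => by
      refine (smoothMat_gradD_gradD_tractorOf hn (nab := nab) hk φ (J 0, J 1, J 2, J 3) ()).congr
        fun z hz => ?_
      rw [← col₄_eq hn φ hz, eq_vec_four J]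
      rfl
    rw [eq_vec_four J]
    have h := fun B C D E => hs ![B, C, D, E]
    refine ContDiffOn.congr ?_ fun y _ => young22_apply _ _ _ _ _
    exact ContDiffOn.div_const (((((((h _ _ _ _).sub (h _ _ _ _)).sub (h _ _ _ _)).add
      (h _ _ _ _)).add ((((h _ _ _ _).sub (h _ _ _ _)).sub (h _ _ _ _)).add (h _ _ _ _))).add
      ((((h _ _ _ _).sub (h _ _ _ _)).sub (h _ _ _ _)).add (h _ _ _ _))).add
      ((((h _ _ _ _).sub (h _ _ _ _)).sub (h _ _ _ _)).add (h _ _ _ _))) _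
  zero_off φ J y hy := by
    have e : ∀ J, thomasD nab φ 1 (thomasD nab φ 2 (tractorOf (k φ))) J ![] y = 0 := fun J =>
      if_neg hy
    refine Eq.trans ?_ (young22_zero J)
    exact congrArg (fun T => young22 T J) (funext e)
  trans φ ψ y hy J := by
    change _ = frameChange (cotractorTrans φ ψ y) (fun H => splitting nab k ψ H _) J
    have e : (fun J' => thomasD nab φ 1 (thomasD nab φ 2 (tractorOf (k φ))) J' ![] y)
        = frameChange (cotractorTrans φ ψ y)
          (fun J' => thomasD nab ψ 1 (thomasD nab ψ 2 (tractorOf (k ψ))) J' ![]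
            (coordChange φ ψ y)) := by
      ext J
      have h := congrFun (congrFun (col₄_change (nab := nab) hn hk hy) (J 0, J 1, J 2, J 3)) ()
      have e1 : cotractorTrans φ ψ y
          = fun A B => densityTrans φ ψ y * coneJac φ ψ y A B := by
        ext A B
        exact cotractorTrans_eq hy A B
      rw [e1, frameChange_eq_kronecker]
      refine Eq.trans ?_ h
      simp only [col₄, Matrix.of_apply]
      rw [← eq_vec_four J]
    refine (congrArg (fun T => young22 T J) e).trans ?_
    rw [frameChange_young22]
    rfl

lemma splitting_eq {nab' : AffineConnection n M} (h : ProjEquiv nab nab') :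
    splitting nab k = splitting nab' k := by
  ext φ J y
  simp only [splitting]
  congr 1
  ext J
  by_cases hy : y ∈ φ.1.target
  · have e : col₄ (thomasD nab φ 1 (thomasD nab φ 2 (tractorOf (k φ)))) y
        = col₄ (thomasD nab' φ 1 (thomasD nab' φ 2 (tractorOf (k φ)))) y := by
      rw [col₄_eq hn φ hy, col₄_eq hn φ hy]
      exact gradD_congr φ.1.open_target (fun z hz A => h.coneForm₃_eq hn φ hz A) (fun z hz =>
        gradD_congr φ.1.open_target (fun x hx A => h.coneForm₂_eq hn φ hx A)
          (fun _ _ => rfl) 4 hz) 4 hy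
    have := congrFun (congrFun e (J 0, J 1, J 2, J 3)) ()
    simp only [col₄, Matrix.of_apply] at this
    rwa [← eq_vec_four J] at this
  · exact (if_neg hy).trans (if_neg hy).symm

end Splitting

end ProjTractor

namespace ProjTractor

open scoped Kronecker

variable {n : ℕ} {M : Type*} [TopologicalSpace M] [ChartedSpace (Eucl n) M]
  [IsManifold (𝓡 n) ∞ M] {ι κ : Type*} [Fintype ι] [DecidableEq ι] [Fintype κ] [DecidableEq κ]

/-! ### The `W`-curvature and its derivative -/

section Curvature

variable (nab : AffineConnection n M) {φ : Chart n M} {y : Eucl n} (hy : y ∈ φ.1.target)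
include hy

lemma thomasD_frame (D B C : Idx n) : thomasD nab φ 0 (frame D) ![B] ![C] y
    = coneForm nab φ B y D C - if B = 0 ∧ C = D then 1 else 0 := by
  have e0 : ∀ H, Function.update ![C] 0 H = ![H] := fun H => by
    ext i; fin_cases i; rfl
  have ef : ∀ B C, frame D B C = fun _ : Eucl n => if C 0 = D then (1 : ℝ) else 0 :=
    fun _ _ => rfl
  rw [thomasD_eq nab φ 0 _ hy]
  simp only [ef, Finset.univ_unique, Fin.default_eq_zero, Finset.sum_singleton, e0,
    Finset.univ_eq_empty, Finset.sum_empty]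
  refine Fin.cases ?_ (fun b => ?_) B
  · by_cases h : C = D <;> simp [h]
    ring
  · have : pd b (fun _ : Eucl n => if C = D then (1 : ℝ) else 0) y = 0 := pd_const _ _ _
    simp [coneD_succ, this]

lemma thomasD_one_one (w : ℝ) (T : TractorComp n 1 1) (A B C : Idx n) :
    thomasD nab φ w T ![A, B] ![C] y = coneD w A (T ![B] ![C]) y
      - ∑ H, coneForm nab φ A y B H * T ![H] ![C] y
      + ∑ H, coneForm nab φ A y H C * T ![B] ![H] y := by
  have e0 : ∀ C H : Idx n, Function.update ![C] 0 H = ![H] := fun C H => by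
    ext i; fin_cases i; rfl
  rw [thomasD_eq nab φ w T hy]
  have e : Fin.tail ![A, B] = ![B] := rfl
  simp [e, e0]

lemma thomasD_three_one (w : ℝ) (T : TractorComp n 3 1) (R A B D C : Idx n) :
    thomasD nab φ w T ![R, A, B, D] ![C] y = coneD (w + 2) R (T ![A, B, D] ![C]) y
      - (∑ H, coneForm nab φ R y A H * T ![H, B, D] ![C] y
        + ∑ H, coneForm nab φ R y B H * T ![A, H, D] ![C] y
        + ∑ H, coneForm nab φ R y D H * T ![A, B, H] ![C] y)
      + ∑ H, coneForm nab φ R y H C * T ![A, B, D] ![H] y := by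
  have e0 : ∀ H, Function.update ![A, B, D] 0 H = ![H, B, D] := fun H => by
    ext i; fin_cases i <;> rfl
  have e1 : ∀ H, Function.update ![A, B, D] 1 H = ![A, H, D] := fun H => by
    ext i; fin_cases i <;> rfl
  have e2 : ∀ H, Function.update ![A, B, D] 2 H = ![A, B, H] := fun H => by
    ext i; fin_cases i <;> rfl
  have e3 : ∀ H, Function.update ![C] 0 H = ![H] := fun H => by
    ext i; fin_cases i; rfl
  rw [thomasD_eq nab φ w T hy]
  have e : Fin.tail ![R, A, B, D] = ![A, B, D] := rfl
  have ew : w + (3 : ℕ) - (1 : ℕ) = w + 2 := by push_cast; ring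
  rw [e, Fin.sum_univ_three, ew]
  simp [e0, e1, e2, e3]

variable [T2Space M] (hn : 2 ≤ n)
include hn

/-- The `W`-curvature is the curvature of the connection on the cone. -/
lemma curvW_eq (A B D C : Idx n) :
    curvW nab φ ![A, B, D] ![C] y = curv (coneForm nab φ) A B y D C := by
  have h : ∀ A B, thomasD nab φ (-1) (thomasD nab φ 0 (frame D)) ![A, B] ![C] y
      = coneD (-1) A (fun z => coneForm nab φ B z D C - if B = 0 ∧ C = D then 1 else 0) y
        - (∑ H, coneForm nab φ A y B H * thomasD nab φ 0 (frame D) ![H] ![C] y)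
        + ((coneForm nab φ B y * coneForm nab φ A y) D C
          - if B = 0 then coneForm nab φ A y D C else 0) := by
    intro A B
    rw [thomasD_one_one nab hy, coneD_congr φ.1.open_target
      (fun z hz => thomasD_frame nab hz D B C) hy]
    congr 1
    simp only [thomasD_frame nab hy, mul_sub, Finset.sum_sub_distrib, Matrix.mul_apply]
    congr 1
    · exact Finset.sum_congr rfl fun H _ => mul_comm _ _
    · by_cases hB : B = 0 <;> simp [hB]
  have e : curvW nab φ ![A, B, D] ![C] y
      = thomasD nab φ (-1) (thomasD nab φ 0 (frame D)) ![A, B] ![C] y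
        - thomasD nab φ (-1) (thomasD nab φ 0 (frame D)) ![B, A] ![C] y := rfl
  rw [e, h, h]
  have es : ∀ H, coneForm nab φ A y B H = coneForm nab φ B y A H := fun H =>
    coneForm_symm hn nab φ hy A B H
  simp only [es]
  have hconst : ∀ a, pd a (fun _ : Eucl n => (1 : Matrix (Idx n) (Idx n) ℝ) D C
      - if C = D then 1 else 0) y = 0 := fun a => pd_const _ _ _
  refine Fin.cases ?_ (fun a => ?_) A
  · rw [curv_coneForm_zero_left nab φ hy]
    refine Fin.cases ?_ (fun b => ?_) B
    · simp
    · simp only [coneD_succ, coneD_zero, if_true, true_and, hconst, Fin.succ_ne_zero, false_and,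
        if_false, coneForm_zero, mul_one, one_mul, Matrix.zero_apply]
      ring
  · refine Fin.cases ?_ (fun b => ?_) B
    · rw [curv_coneForm_zero_right nab φ hy]
      simp only [coneD_succ, coneD_zero, if_true, true_and, hconst, Fin.succ_ne_zero, false_and,
        if_false, coneForm_zero, mul_one, one_mul, Matrix.zero_apply]
      ring
    · simp [curv, matD]
      ring

lemma derivW_eq (R A B D C : Idx n) :
    derivW nab φ ![R, A, B, D] ![C] y = endD (coneForm nab φ) R (curv (coneForm nab φ) A B) y D C
      - (∑ H, coneForm nab φ R y A H * curv (coneForm nab φ) H B y D C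
        + ∑ H, coneForm nab φ R y B H * curv (coneForm nab φ) A H y D C) := by
  rw [derivW, thomasD_three_one nab hy, coneD_congr φ.1.open_target
      (fun z hz => curvW_eq nab hz hn A B D C) hy]
  simp only [curvW_eq nab hy hn, endD, Matrix.sub_apply, Matrix.mul_apply, matD, Matrix.of_apply]
  -- `W` has weight `-2`, three lower indices and one upper index, hence cone degree `0`.
  rw [show (-2 : ℝ) + 2 = 0 by norm_num]
  simp only [mul_comm (curv _ _ _ _ _ _)]
  ring

lemma curvW_antisymm (A B D C : Idx n) :
    curvW nab φ ![A, B, D] ![C] y = - curvW nab φ ![B, A, D] ![C] y := by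
  rw [curvW_eq nab hy hn, curvW_eq nab hy hn, curv_antisymm, Matrix.neg_apply]

lemma curvW_apply_zero (A B C : Idx n) : curvW nab φ ![A, B, 0] ![C] y = 0 := by
  rw [curvW_eq nab hy hn, curv_coneForm_apply_zero hn nab φ hy]

lemma curvW_zero_left (B D C : Idx n) : curvW nab φ ![0, B, D] ![C] y = 0 := by
  rw [curvW_eq nab hy hn, curv_coneForm_zero_left nab φ hy, Matrix.zero_apply]

lemma curvW_zero_right (A D C : Idx n) : curvW nab φ ![A, 0, D] ![C] y = 0 := by
  rw [curvW_antisymm nab hy hn, curvW_zero_left nab hy hn, neg_zero]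

lemma derivW_antisymm (R A B D C : Idx n) :
    derivW nab φ ![R, A, B, D] ![C] y = - derivW nab φ ![R, B, A, D] ![C] y := by
  have hd : DifferentiableAt ℝ (fun z => curv (coneForm nab φ) B A z D C) y :=
    (SmoothMat.curv φ.1.open_target (smoothMat_coneForm hn nab φ) B A).diffAt φ.1.open_target hy D C
  have e1 : matD 0 R (curv (coneForm nab φ) A B) y D C
      = - matD 0 R (curv (coneForm nab φ) B A) y D C := by
    simp only [matD, Matrix.of_apply]
    rw [coneD_congr φ.1.open_target (g := fun z => (-1) * curv (coneForm nab φ) B A z D C)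
      (fun z _ => by rw [curv_antisymm, Matrix.neg_apply, neg_one_mul]) hy, coneD_const_mul hd,
      neg_one_mul]
  rw [derivW_eq nab hy hn, derivW_eq nab hy hn]
  simp only [endD, Matrix.sub_apply, e1, curv_antisymm (coneForm nab φ) A,
    Matrix.neg_mul, Matrix.neg_apply, mul_neg, Finset.sum_neg_distrib]
  simp only [fun H => curv_antisymm (coneForm nab φ) B H, Matrix.neg_apply, mul_neg,
    Finset.sum_neg_distrib, Matrix.neg_mul]
  ring

/-- The Euler field acts on the curvature by its weight. -/
lemma derivW_zero (P Q D C : Idx n) :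
    derivW nab φ ![0, P, Q, D] ![C] y = - 2 * curvW nab φ ![P, Q, D] ![C] y := by
  rw [derivW, thomasD_three_one nab hy]
  simp [coneForm_zero, Matrix.one_apply]
  ring

/-- The contraction of `W` with `X` vanishes and `𝔻_R X^A = δ_R^A`, hence
`X^P 𝔻_R W_{PQ} = - W_{RQ}`. -/
lemma derivW_zero_left (R Q D C : Idx n) :
    derivW nab φ ![R, 0, Q, D] ![C] y = - curvW nab φ ![R, Q, D] ![C] y := by
  rw [derivW, thomasD_three_one nab hy, coneD_congr φ.1.open_target (g := fun _ => 0 * 0)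
    (fun z hz => by rw [curvW_zero_left nab hz hn, zero_mul]) hy, coneD_const_mul (by fun_prop)]
  simp [curvW_zero_left nab hy hn, coneForm_apply_zero]

lemma derivW_apply_zero (R P Q C : Idx n) :
    derivW nab φ ![R, P, Q, 0] ![C] y = - curvW nab φ ![P, Q, R] ![C] y := by
  rw [derivW, thomasD_three_one nab hy, coneD_congr φ.1.open_target (g := fun _ => 0 * 0)
    (fun z hz => by rw [curvW_apply_zero nab hz hn, zero_mul]) hy, coneD_const_mul (by fun_prop)]
  simp [curvW_apply_zero nab hy hn, coneForm_apply_zero]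

lemma derivW_zero_right (R P D C : Idx n) :
    derivW nab φ ![R, P, 0, D] ![C] y = - curvW nab φ ![P, R, D] ![C] y := by
  rw [derivW_antisymm nab hy hn, derivW_zero_left nab hy hn, curvW_antisymm nab hy hn P R]

end Curvature

/-! ### Commutators of iterated derivatives -/

section Commutator

variable [T2Space M] (hn : 2 ≤ n) (nab : AffineConnection n M) {φ : Chart n M} {y : Eucl n}
  (hy : y ∈ φ.1.target) {𝒜 : Idx n → Eucl n → Matrix ι ι ℝ} (h𝒜 : ∀ A, SmoothMat φ.1.target (𝒜 A))
  {T : Eucl n → Matrix ι κ ℝ} (hT : SmoothMat φ.1.target T) (m : ℝ)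
include hy hn h𝒜 hT

/-- The second covariant derivatives on the cone commute up to the curvature, because the cone
connection is torsion-free. -/
lemma gradD_gradD_commutator (A B : Idx n) (i : ι) (j : κ) :
    gradD m (fun C z => kronSum (coneForm nab φ C z) (𝒜 C z)) (gradD m 𝒜 T) y (A, B, i) j
      - gradD m (fun C z => kronSum (coneForm nab φ C z) (𝒜 C z)) (gradD m 𝒜 T) y (B, A, i) j
      = - (curv 𝒜 A B y * T y) i j := by
  have e : ∀ A B, gradD m (fun C z => kronSum (coneForm nab φ C z) (𝒜 C z)) (gradD m 𝒜 T) y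
      (A, B, i) j = covD m 𝒜 A (covD m 𝒜 B T) y i j
        - ∑ H, coneForm nab φ A y B H * covD m 𝒜 H T y i j := by
    intro A B
    change matD m A (gradD m 𝒜 T) y (B, i) j
      - (kronSum (coneForm nab φ A y) (𝒜 A y) * gradD m 𝒜 T y) (B, i) j = _
    rw [kronSum_mul_apply, sub_add_eq_sub_sub_swap]
    rfl
  rw [e, e, ← Matrix.neg_apply, ← covD_commutator φ.1.open_target hy h𝒜 hT m A B, Matrix.sub_apply]
  have es : ∀ H, coneForm nab φ A y B H = coneForm nab φ B y A H := fun H =>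
    coneForm_symm hn nab φ hy A B H
  simp only [es]
  ring

/-- The derivative of the commutation relation of second covariant derivatives. -/
lemma gradD_commutator_deriv (F A B : Idx n) (i : ι) (j : κ)
    {𝒟 : Matrix ι ι ℝ}
    (h𝒟 : 𝒟 = endD 𝒜 F (curv 𝒜 A B) y - (∑ H, coneForm nab φ F y A H • curv 𝒜 H B y
      + ∑ H, coneForm nab φ F y B H • curv 𝒜 A H y)) :
    gradD m (fun C z => kronSum (coneForm nab φ C z) (kronSum (coneForm nab φ C z) (𝒜 C z)))
        (gradD m (fun C z => kronSum (coneForm nab φ C z) (𝒜 C z)) (gradD m 𝒜 T)) y (F, A, B, i) j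
      - gradD m (fun C z => kronSum (coneForm nab φ C z) (kronSum (coneForm nab φ C z) (𝒜 C z)))
        (gradD m (fun C z => kronSum (coneForm nab φ C z) (𝒜 C z)) (gradD m 𝒜 T)) y (F, B, A, i) j
      = - ((𝒟 * T y) i j + (curv 𝒜 A B y * covD m 𝒜 F T y) i j) := by
  set S := gradD m (fun C z => kronSum (coneForm nab φ C z) (𝒜 C z)) (gradD m 𝒜 T) with hS
  have hSs : SmoothMat φ.1.target S := (hT.gradD φ.1.open_target h𝒜 m).gradD φ.1.open_target
    (fun C => (smoothMat_coneForm hn nab φ C).kronSum (h𝒜 C)) m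
  have hcom : ∀ z ∈ φ.1.target, ∀ A B i j, S z (A, B, i) j - S z (B, A, i) j
      = - (curv 𝒜 A B z * T z) i j := fun z hz A B i j =>
    gradD_gradD_commutator hn nab hz h𝒜 hT m A B i j
  have e : ∀ A B, gradD m (fun C z => kronSum (coneForm nab φ C z)
      (kronSum (coneForm nab φ C z) (𝒜 C z))) S y (F, A, B, i) j
      = coneD m F (fun z => S z (A, B, i) j) y - (∑ H, coneForm nab φ F y A H * S y (H, B, i) j
        + (∑ H, coneForm nab φ F y B H * S y (A, H, i) j
        + ∑ i', 𝒜 F y i i' * S y (A, B, i') j)) := by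
    intro A B
    change coneD m F (fun z => S z (A, B, i) j) y
      - (kronSum (coneForm nab φ F y) (kronSum (coneForm nab φ F y) (𝒜 F y)) * S y) (A, B, i) j = _
    rw [kronSum_mul_apply, kronSum_sum_mul]
  have hc := SmoothMat.curv φ.1.open_target h𝒜 A B
  have hd : coneD m F (fun z => S z (A, B, i) j) y - coneD m F (fun z => S z (B, A, i) j) y
      = - matD m F (fun z => curv 𝒜 A B z * T z) y i j := by
    rw [← coneD_sub (hSs.diffAt φ.1.open_target hy _ _) (hSs.diffAt φ.1.open_target hy _ _),
      coneD_congr φ.1.open_target (g := fun z => (-1) * (curv 𝒜 A B z * T z) i j)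
        (fun z hz => by rw [hcom z hz, neg_one_mul]) hy,
      coneD_const_mul ((hc.mul hT).diffAt φ.1.open_target hy i j), neg_one_mul]
    rfl
  have h1 : ∀ H, S y (B, H, i) j = S y (H, B, i) j + (curv 𝒜 H B y * T y) i j := fun H => by
    linarith [hcom y hy H B i j]
  have h2 : ∀ H, S y (H, A, i) j = S y (A, H, i) j + (curv 𝒜 A H y * T y) i j := fun H => by
    linarith [hcom y hy A H i j]
  have h3 : ∀ i', S y (B, A, i') j = S y (A, B, i') j + (curv 𝒜 A B y * T y) i' j := fun i' => by
    linarith [hcom y hy A B i' j]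
  have hm := congrFun (congrFun (covD_mul (𝒜 := 𝒜) φ.1.open_target hy hc hT m F) i) j
  simp only [covD, Matrix.sub_apply, Matrix.add_apply] at hm
  rw [e, e]
  simp only [h1, h2, h3, mul_add, Finset.sum_add_distrib, h𝒟, covD, Matrix.sub_mul,
    Matrix.add_mul, Matrix.sub_apply, Matrix.add_apply, Matrix.sum_mul, Matrix.sum_apply,
    Matrix.smul_mul, Matrix.smul_apply, smul_eq_mul]
  have e4 : (𝒜 F y * (curv 𝒜 A B y * T y)) i j = ∑ i', 𝒜 F y i i' * (curv 𝒜 A B y * T y) i' j :=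
    Matrix.mul_apply
  rw [e4] at hm
  simp only [Matrix.mul_sub, Matrix.sub_apply] at hm ⊢
  linarith

end Commutator

end ProjTractor

namespace ProjTractor

open scoped Kronecker

variable {n : ℕ} {M : Type*} [TopologicalSpace M] [ChartedSpace (Eucl n) M]
  [IsManifold (𝓡 n) ∞ M] {ι κ : Type*} [Fintype ι] [DecidableEq ι] [Fintype κ] [DecidableEq κ]

/-! ### The algebra behind the prolonged equation -/

section Algebra

variable (t v u : Idx n → Idx n → Idx n → Idx n → Idx n → ℝ)

/-- The part of the prolonged equation that remains when its symmetrisations are undone: an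
unsymmetrised identity whose average over `D ↔ E`, `A ↔ B` and the exchange of the two pairs is the
prolonged equation. -/
lemma prolong_core
    (h₁ : ∀ a b c d e, t a b c d e - t b a c d e
      = v a b c d e + v a b c e d - v a b d c e - v a b e c d)
    (h₂ : ∀ a b c d e, t e a b c d - t e b a c d
      = - (u e a b c d + u e a b d c + v a b c e d + v a b d e c))
    (h₃ : ∀ a b c d e, t a b c d e + t a b d e c + t a b e c d = 0) (C D E A B : Idx n) :
    - 2 * u B A C D E - 2 * u B A C E D - 4 * u B A D C E - 4 * u B A D E C - 2 * u E C A B D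
      - 2 * u E C A D B + 2 * t A B C D E + 2 * t A B D E C + 2 * t A B E C D - 2 * t A C B D E
      + 2 * t A C D E B - 2 * t A D B E C - 3 * t A D C B E - 3 * t A D C E B - 2 * t B A C D E
      - 2 * t B A D C E - 2 * t B A D E C + 2 * t B C A D E + 2 * t B D A C E + 2 * t B D A E C
      + 2 * t C A B D E - 2 * t C A D E B + t D A C B E + 3 * t D A C E B - 2 * t D A E C B
      + 2 * t E A C B D - 2 * t E C A B D - 2 * v A C B D E - 2 * v A C B E D - 4 * v A D B C E
      + 2 * v A D B E C + 6 * v A D C E B - 6 * v A D E B C - 6 * v A D E C B - 6 * v C A B D E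
      - 6 * v C A B E D + 6 * v C A D B E + 4 * v C A E B D - 2 * v C A E D B = 0 := by
  -- The coefficients solve the linear system for expressing the identity through instances of
  -- the three relations.
  linear_combination -1 * h₁ A D C B E + -2 * h₁ C A D E B + -3 * h₁ A D C E B
    + 2 * h₁ A C B D E + 2 * h₁ A D E C B + 4 * h₁ C A B D E + -2 * h₂ A C D E B
    + -2 * h₂ A D C E B + -2 * h₂ A D E C B + -2 * h₂ C A B D E + -2 * h₃ A D B E C
    + 2 * h₃ A B C D E

/-- The prolonged equation as a formal consequence of the commutation relations of third
derivatives: `t` stands for `𝔻𝔻𝔻K`, `v` for the contraction of the curvature with the second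
index of `𝔻K`, `u` for the contraction of the derivative of the curvature with `K`, and `S` and
`DS` for the terms `X^F W ♯ L` and `X^F X^G 𝔻W ♯ L`. -/
lemma prolong_algebra
    (h₁ : ∀ a b c d e, t a b c d e - t b a c d e
      = v a b c d e + v a b c e d - v a b d c e - v a b e c d)
    (h₂ : ∀ a b c d e, t e a b c d - t e b a c d
      = - (u e a b c d + u e a b d c + v a b c e d + v a b d e c))
    (h₃ : ∀ a b c d e, t a b c d e + t a b d e c + t a b e c d = 0)
    (S DS : Idx n → Idx n → Idx n → Idx n → Idx n → ℝ)
    (hS : ∀ P Q G I J, S P Q G I J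
      = 3 / 4 * (v P Q G I J + v P Q G J I - v P Q I G J - v P Q J G I))
    (hDS : ∀ R P Q G H, DS R P Q G H
      = - (3 / 2) * (u R P Q G H + u R P Q H G + v P Q R G H + v P Q R H G))
    (C D E A B : Idx n) :
    young22 (fun J => t C (J 0) (J 1) (J 2) (J 3)) ![D, E, A, B]
      = (sym (fun D E => S C D E A B) D E + sym (fun A B => S C A B E D) A B)
      + (sym (fun D E => sym (fun A B => S D A B E C) A B) D E
        + sym (fun A B => sym (fun D E => S A D E B C) D E) A B)
      - 1 / 6 * (sym (fun D E => DS D E C A B) D E + sym (fun A B => DS A B C D E) A B)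
      - 1 / 3 * (sym (fun D E => sym (fun A B => DS D E A B C) A B) D E
        + sym (fun A B => sym (fun D E => DS A B D E C) D E) A B)
      - 1 / 6 * (sym (fun A B => sym (fun D E => DS A C D E B) D E) A B
        + sym (fun D E => sym (fun A B => DS D C A B E) A B) D E) := by
  have core := prolong_core t v u h₁ h₂ h₃
  rw [young22_apply]
  simp only [sym, hS, hDS, Matrix.cons_val_zero, Matrix.cons_val_one, Matrix.cons_val]
  -- The orbit of the core identity under the symmetries of `L_{DEAB}`.
  linear_combination (core C D E A B + core C A B D E + core C D E B A + core C B A D E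
    + core C E D A B + core C A B E D + core C E D B A + core C B A E D) / 32

end Algebra

/-! ### Derivatives of two-index cotractors -/

section Jets

variable (nab : AffineConnection n M) (φ : Chart n M)

lemma gradD_two_apply (m : ℝ) (T : Eucl n → Matrix (Idx n × Idx n) Unit ℝ) (y : Eucl n)
    (A B C : Idx n) : gradD m (coneForm₂ nab φ) T y (A, B, C) ()
      = coneD m A (fun z => T z (B, C) ()) y - (∑ H, coneForm nab φ A y B H * T y (H, C) ()
        + ∑ H, coneForm nab φ A y C H * T y (B, H) ()) := by
  rw [← kronSum_mul_apply]
  rfl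

lemma gradD_three_apply (m : ℝ) (T : Eucl n → Matrix (Idx n × Idx n × Idx n) Unit ℝ) (y : Eucl n)
    (A B C D : Idx n) : gradD m (coneForm₃ nab φ) T y (A, B, C, D) ()
      = coneD m A (fun z => T z (B, C, D) ()) y
        - (∑ H, coneForm nab φ A y B H * T y (H, C, D) ()
        + (∑ H, coneForm nab φ A y C H * T y (B, H, D) ()
        + ∑ H, coneForm nab φ A y D H * T y (B, C, H) ())) := by
  rw [← kronSum_sum_mul (coneForm nab φ A y) (coneForm nab φ A y) (fun p => T y (B, p) ()) C D,
    ← coneForm₂, ← kronSum_mul_apply (coneForm nab φ A y) (coneForm₂ nab φ A y)]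
  rfl

lemma gradD_four_apply (m : ℝ) (T : Eucl n → Matrix (Idx n × Idx n × Idx n × Idx n) Unit ℝ)
    (y : Eucl n) (A B C D E : Idx n) : gradD m (coneForm₄ nab φ) T y (A, B, C, D, E) ()
      = coneD m A (fun z => T z (B, C, D, E) ()) y
        - (∑ H, coneForm nab φ A y B H * T y (H, C, D, E) ()
        + (∑ H, coneForm nab φ A y C H * T y (B, H, D, E) ()
        + (∑ H, coneForm nab φ A y D H * T y (B, C, H, E) ()
        + ∑ H, coneForm nab φ A y E H * T y (B, C, D, H) ()))) := by
  rw [← kronSum_sum_mul (coneForm nab φ A y) (coneForm nab φ A y) (fun p => T y (B, C, p) ()) D E,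
    ← coneForm₂, ← kronSum_sum_mul (coneForm nab φ A y) (coneForm₂ nab φ A y)
      (fun p => T y (B, p) ()) C (D, E), ← coneForm₃,
    ← kronSum_mul_apply (coneForm nab φ A y) (coneForm₃ nab φ A y)]
  rfl

variable {φ} {y : Eucl n} (hy : y ∈ φ.1.target)
include hy

lemma gradD_two_symm {T : Eucl n → Matrix (Idx n × Idx n) Unit ℝ}
    (h : ∀ z ∈ φ.1.target, ∀ B C, T z (B, C) () = T z (C, B) ()) (m : ℝ) (A B C : Idx n) :
    gradD m (coneForm₂ nab φ) T y (A, B, C) () = gradD m (coneForm₂ nab φ) T y (A, C, B) () := by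
  rw [gradD_two_apply, gradD_two_apply, coneD_congr φ.1.open_target (fun z hz => h z hz B C) hy]
  simp only [fun H => h y hy H C, fun H => h y hy B H]
  ring

lemma gradD_three_symm {T : Eucl n → Matrix (Idx n × Idx n × Idx n) Unit ℝ}
    (h : ∀ z ∈ φ.1.target, ∀ B C D, T z (B, C, D) () = T z (B, D, C) ()) (m : ℝ)
    (A B C D : Idx n) : gradD m (coneForm₃ nab φ) T y (A, B, C, D) ()
      = gradD m (coneForm₃ nab φ) T y (A, B, D, C) () := by
  rw [gradD_three_apply, gradD_three_apply,
    coneD_congr φ.1.open_target (fun z hz => h z hz B C D) hy]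
  simp only [fun H => h y hy H C D, fun H => h y hy B H D, fun H => h y hy B C H]
  ring

lemma gradD_three_cyclic {T : Eucl n → Matrix (Idx n × Idx n × Idx n) Unit ℝ}
    (hT : SmoothMat φ.1.target T)
    (h : ∀ z ∈ φ.1.target, ∀ B C D,
      T z (B, C, D) () + T z (C, D, B) () + T z (D, B, C) () = 0) (m : ℝ) (A B C D : Idx n) :
    gradD m (coneForm₃ nab φ) T y (A, B, C, D) () + gradD m (coneForm₃ nab φ) T y (A, C, D, B) ()
      + gradD m (coneForm₃ nab φ) T y (A, D, B, C) () = 0 := by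
  have hd := fun p => hT.diffAt φ.1.open_target hy p ()
  have h' : ∀ z ∈ φ.1.target, ∀ B C D,
      T z (B, C, D) () = (-1) * (T z (C, D, B) () + T z (D, B, C) ()) := fun z hz B C D => by
    linarith [h z hz B C D]
  have e : coneD m A (fun z => T z (B, C, D) ()) y
      = - (coneD m A (fun z => T z (C, D, B) ()) y + coneD m A (fun z => T z (D, B, C) ()) y) := by
    rw [coneD_congr φ.1.open_target (fun z hz => h' z hz B C D) hy]
    refine (coneD_const_mul (f := fun z => T z (C, D, B) () + T z (D, B, C) ())
      ((hd _).add (hd _)) (-1) m A).trans ?_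
    rw [coneD_add (hd _) (hd _), neg_one_mul]
  rw [gradD_three_apply, gradD_three_apply, gradD_three_apply, e]
  simp only [fun H => h' y hy H C D, fun H => h' y hy B H D, fun H => h' y hy B C H, mul_add,
    neg_mul, one_mul, mul_neg, neg_add, Finset.sum_add_distrib, Finset.sum_neg_distrib]
  ring

lemma gradD_four_cyclic {T : Eucl n → Matrix (Idx n × Idx n × Idx n × Idx n) Unit ℝ}
    (hT : SmoothMat φ.1.target T)
    (h : ∀ z ∈ φ.1.target, ∀ E B C D,
      T z (E, B, C, D) () + T z (E, C, D, B) () + T z (E, D, B, C) () = 0) (m : ℝ)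
    (A E B C D : Idx n) :
    gradD m (coneForm₄ nab φ) T y (A, E, B, C, D) ()
      + gradD m (coneForm₄ nab φ) T y (A, E, C, D, B) ()
      + gradD m (coneForm₄ nab φ) T y (A, E, D, B, C) () = 0 := by
  have hd := fun p => hT.diffAt φ.1.open_target hy p ()
  have h' : ∀ z ∈ φ.1.target, ∀ E B C D,
      T z (E, B, C, D) () = (-1) * (T z (E, C, D, B) () + T z (E, D, B, C) ()) :=
    fun z hz E B C D => by linarith [h z hz E B C D]
  have e : coneD m A (fun z => T z (E, B, C, D) ()) y
      = - (coneD m A (fun z => T z (E, C, D, B) ()) y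
        + coneD m A (fun z => T z (E, D, B, C) ()) y) := by
    rw [coneD_congr φ.1.open_target (fun z hz => h' z hz E B C D) hy]
    refine (coneD_const_mul (f := fun z => T z (E, C, D, B) () + T z (E, D, B, C) ())
      ((hd _).add (hd _)) (-1) m A).trans ?_
    rw [coneD_add (hd _) (hd _), neg_one_mul]
  rw [gradD_four_apply, gradD_four_apply, gradD_four_apply, e]
  simp only [fun H => h' y hy H B C D, fun H => h' y hy E H C D, fun H => h' y hy E B H D,
    fun H => h' y hy E B C H, mul_add,
    neg_mul, one_mul, mul_neg, neg_add, Finset.sum_add_distrib, Finset.sum_neg_distrib]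
  ring

end Jets

end ProjTractor

namespace ProjTractor

open scoped Kronecker

variable {n : ℕ} {M : Type*} [TopologicalSpace M] [ChartedSpace (Eucl n) M]
  [IsManifold (𝓡 n) ∞ M] {ι κ : Type*} [Fintype ι] [DecidableEq ι] [Fintype κ] [DecidableEq κ]

/-! ### Young projections and the Thomas operator -/

lemma differentiableAt_symmPos {r s : ℕ} {T : TractorComp n r s} {y : Eucl n} (i j : Fin r)
    (hT : ∀ J C, DifferentiableAt ℝ (T J C) y) (J : Fin r → Idx n) (C : Fin s → Idx n) :
    DifferentiableAt ℝ (fun z => symmPos i j (fun J' => T J' C z) J) y := by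
  unfold symmPos
  exact (DifferentiableAt.fun_add (hT J C) (hT (J ∘ Equiv.swap i j) C)).mul_const (2 : ℝ)⁻¹

lemma differentiableAt_altPos {r s : ℕ} {T : TractorComp n r s} {y : Eucl n} (i j : Fin r)
    (hT : ∀ J C, DifferentiableAt ℝ (T J C) y) (J : Fin r → Idx n) (C : Fin s → Idx n) :
    DifferentiableAt ℝ (fun z => altPos i j (fun J' => T J' C z) J) y := by
  unfold altPos
  exact (DifferentiableAt.fun_sub (hT J C) (hT (J ∘ Equiv.swap i j) C)).mul_const (2 : ℝ)⁻¹

section ThomasLinear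

variable (nab : AffineConnection n M) {φ : Chart n M} {y : Eucl n} (hy : y ∈ φ.1.target)
include hy

lemma thomasD_permute (w : ℝ) {r s : ℕ} {T : TractorComp n r s} (ε : ℝ) (σ : Equiv.Perm (Fin r))
    (hT : ∀ J C, DifferentiableAt ℝ (T J C) y) (A : Idx n) (J : Fin r → Idx n)
    (C : Fin s → Idx n) :
    thomasD nab φ w (fun J C z => (T J C z + ε * T (J ∘ σ) C z) / 2) (Fin.cons A J) C y
      = (thomasD nab φ w T (Fin.cons A J) C y
        + ε * thomasD nab φ w T (Fin.cons A (J ∘ σ)) C y) / 2 := by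
  rw [thomasD_eq nab φ w _ hy, thomasD_eq nab φ w _ hy, thomasD_eq nab φ w _ hy]
  simp only [Fin.cons_zero, Fin.tail_cons]
  have e1 : coneD (w + r - s) A (fun z => (T J C z + ε * T (J ∘ σ) C z) / 2) y
      = (coneD (w + r - s) A (T J C) y + ε * coneD (w + r - s) A (T (J ∘ σ) C) y) / 2 := by
    simp only [div_eq_inv_mul]
    refine (coneD_const_mul (f := fun z => T J C z + ε * T (J ∘ σ) C z)
      ((hT J C).add ((hT (J ∘ σ) C).const_mul ε)) _ _ A).trans ?_
    rw [coneD_add (hT J C) ((hT (J ∘ σ) C).const_mul ε), coneD_const_mul (hT (J ∘ σ) C)]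
  have e2 : ∑ i, ∑ H, coneForm nab φ A y ((J ∘ σ) i) H * T (Function.update (J ∘ σ) i H) C y
      = ∑ i, ∑ H, coneForm nab φ A y (J i) H * T (Function.update J i H ∘ σ) C y := by
    refine Fintype.sum_equiv σ _ _ fun i => Finset.sum_congr rfl fun H _ => ?_
    rw [Function.update_comp_equiv, Equiv.symm_apply_apply]
    rfl
  rw [e1, e2]
  have e3 : ∀ (x a b : ℝ), x * ((a + ε * b) / 2) = x * a / 2 + ε * (x * b) / 2 := fun _ _ _ => by
    ring
  simp only [e3, Finset.sum_add_distrib, ← Finset.sum_div, ← Finset.mul_sum]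
  ring

lemma thomasD_symmPos (w : ℝ) {r s : ℕ} {T : TractorComp n r s} (i j : Fin r)
    (hT : ∀ J C, DifferentiableAt ℝ (T J C) y) (A : Idx n) (J : Fin r → Idx n)
    (C : Fin s → Idx n) :
    thomasD nab φ w (fun J C z => symmPos i j (fun J' => T J' C z) J) (Fin.cons A J) C y
      = symmPos i j (fun J' => thomasD nab φ w T (Fin.cons A J') C y) J := by
  have h := thomasD_permute nab hy w 1 (Equiv.swap i j) hT A J C
  simp only [one_mul] at h
  exact h

lemma thomasD_altPos (w : ℝ) {r s : ℕ} {T : TractorComp n r s} (i j : Fin r)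
    (hT : ∀ J C, DifferentiableAt ℝ (T J C) y) (A : Idx n) (J : Fin r → Idx n)
    (C : Fin s → Idx n) :
    thomasD nab φ w (fun J C z => altPos i j (fun J' => T J' C z) J) (Fin.cons A J) C y
      = altPos i j (fun J' => thomasD nab φ w T (Fin.cons A J') C y) J := by
  have h := thomasD_permute nab hy w (-1) (Equiv.swap i j) hT A J C
  simp only [neg_one_mul, ← sub_eq_add_neg] at h
  exact h

lemma thomasD_young22 (w : ℝ) {s : ℕ} {T : TractorComp n 4 s}
    (hT : ∀ J C, DifferentiableAt ℝ (T J C) y) (A : Idx n) (J : Fin 4 → Idx n)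
    (C : Fin s → Idx n) :
    thomasD nab φ w (fun J C z => young22 (fun J' => T J' C z) J) (Fin.cons A J) C y
      = young22 (fun J' => thomasD nab φ w T (Fin.cons A J') C y) J := by
  have h1 := fun J C => differentiableAt_altPos 1 3 hT J C
  have h2 := fun J C => differentiableAt_altPos 0 2 h1 J C
  have h3 := fun J C => differentiableAt_symmPos 2 3 h2 J C
  have e := thomasD_symmPos nab hy w 0 1 h3 A J C
  refine e.trans ?_
  rw [young22]
  congr 1
  ext J
  refine (thomasD_symmPos nab hy w 2 3 h2 A J C).trans ?_
  congr 1
  ext J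
  refine (thomasD_altPos nab hy w 0 2 h1 A J C).trans ?_
  congr 1
  ext J
  exact thomasD_altPos nab hy w 1 3 hT A J C

end ThomasLinear

/-! ### The right-hand side of the prolonged equation -/

lemma contrX_eq (f : Idx n → ℝ) : contrX f = f 0 := by
  simp [contrX, canonX]

lemma contrXX_eq (f : Idx n → Idx n → ℝ) : contrXX f = f 0 0 := by
  simp [contrXX, canonX]

lemma HasYoung22.pair_symm {T : (Fin 4 → Idx n) → ℝ} (h : HasYoung22 T) (B C D E : Idx n) :
    T ![B, C, D, E] = T ![D, E, B, C] := by
  obtain ⟨h1, h2, h3⟩ := h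
  linarith [h3 B C D E, h3 B C E D, h3 B D E C, h3 C D E B, h1 B C D E, h1 B C E D, h1 D E B C,
    h1 D E C B, h2 B C D E, h2 D E B C, h1 B D C E, h1 B D E C, h2 B D C E, h1 C E B D,
    h1 C E D B, h2 C E B D, h1 B E C D, h1 B E D C, h2 B E C D, h1 C D B E, h1 C D E B,
    h2 C D B E]

section RHS

variable (nab : AffineConnection n M) {φ : Chart n M} {y : Eucl n}

lemma prolongRHS_eq (L : CotractorFamily n M) (C D E A B : Idx n) :
    prolongRHS nab L φ C D E A B y
      = (sym (fun D E => wSharp nab L φ y C D E 0 A B) D E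
        + sym (fun A B => wSharp nab L φ y C A B 0 E D) A B)
      + (sym (fun D E => sym (fun A B => wSharp nab L φ y D A B 0 E C) A B) D E
        + sym (fun A B => sym (fun D E => wSharp nab L φ y A D E 0 B C) D E) A B)
      - 1 / 6 * (sym (fun D E => dwSharp nab L φ y D E C A B 0 0) D E
        + sym (fun A B => dwSharp nab L φ y A B C D E 0 0) A B)
      - 1 / 3 * (sym (fun D E => sym (fun A B => dwSharp nab L φ y D E A B C 0 0) A B) D E
        + sym (fun A B => sym (fun D E => dwSharp nab L φ y A B D E C 0 0) D E) A B)
      - 1 / 6 * (sym (fun A B => sym (fun D E => dwSharp nab L φ y A C D E B 0 0) D E) A B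
        + sym (fun D E => sym (fun A B => dwSharp nab L φ y D C A B E 0 0) A B) D E) := by
  simp only [prolongRHS, contrX_eq, contrXX_eq]

lemma sharp_four (N : Idx n → Idx n → ℝ) (T : (Fin 4 → Idx n) → ℝ) (G H I J : Idx n) :
    sharp N T ![G, H, I, J] = - (∑ E, N E G * T ![E, H, I, J] + ∑ E, N E H * T ![G, E, I, J]
      + ∑ E, N E I * T ![G, H, E, J] + ∑ E, N E J * T ![G, H, I, E]) := by
  have e0 : ∀ X, Function.update ![G, H, I, J] 0 X = ![X, H, I, J] := fun X => by
    ext i; fin_cases i <;> rfl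
  have e1 : ∀ X, Function.update ![G, H, I, J] 1 X = ![G, X, I, J] := fun X => by
    ext i; fin_cases i <;> rfl
  have e2 : ∀ X, Function.update ![G, H, I, J] 2 X = ![G, H, X, J] := fun X => by
    ext i; fin_cases i <;> rfl
  have e3 : ∀ X, Function.update ![G, H, I, J] 3 X = ![G, H, I, X] := fun X => by
    ext i; fin_cases i <;> rfl
  rw [sharp, Fin.sum_univ_four]
  simp [e0, e1, e2, e3]

variable (hy : y ∈ φ.1.target) [T2Space M] (hn : 2 ≤ n) {L : CotractorFamily n M}
  (hL : HasYoung22 (fun J => L φ J y))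
include hy hn hL

lemma wSharp_eq (P Q G I J : Idx n) : wSharp nab L φ y P Q G 0 I J
    = - (∑ E, curvW nab φ ![P, Q, G] ![E] y * L φ ![0, E, I, J] y
      + ∑ E, curvW nab φ ![P, Q, I] ![E] y * L φ ![0, G, E, J] y
      + ∑ E, curvW nab φ ![P, Q, J] ![E] y * L φ ![0, G, I, E] y) := by
  rw [wSharp, sharp_four]
  simp only [curvW_apply_zero nab hy hn, zero_mul, Finset.sum_const_zero]
  have h := hL.1
  simp only [fun E => h E 0 I J, fun E => h G 0 E J, fun E => h G 0 I E]
  ring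

/-- Both `L` and the derivative of the curvature contribute to the contraction with `X`, since
`X^F 𝔻_R W_{PQ}{}^E{}_F = - W_{PQ}{}^E{}_R`. -/
lemma dwSharp_eq (R P Q G H : Idx n) : dwSharp nab L φ y R P Q G H 0 0
    = - (∑ E, derivW nab φ ![R, P, Q, G] ![E] y * L φ ![0, 0, E, H] y
      + ∑ E, derivW nab φ ![R, P, Q, H] ![E] y * L φ ![0, 0, G, E] y)
      + 2 * ∑ E, curvW nab φ ![P, Q, R] ![E] y * L φ ![0, E, G, H] y := by
  rw [dwSharp, sharp_four]
  simp only [derivW_apply_zero nab hy hn, neg_mul, Finset.sum_neg_distrib]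
  have h1 := hL.1
  have h2 := hL.2.1
  have h3 := hL.pair_symm
  simp only [fun E => h2 G H E 0, fun E => h3 G H 0 E, fun E => h3 E H 0 0, fun E => h3 G E 0 0]
  ring

end RHS

end ProjTractor

namespace ProjTractor

open scoped Kronecker

variable {n : ℕ} {M : Type*} [TopologicalSpace M] [ChartedSpace (Eucl n) M]
  [IsManifold (𝓡 n) ∞ M] {ι κ : Type*} [Fintype ι] [DecidableEq ι] [Fintype κ] [DecidableEq κ]

/-! ### Killing fields on the cone -/

section Forward

variable (nab : AffineConnection n M) (φ : Chart n M)
  (K : Eucl n → Matrix (Idx n × Idx n) Unit ℝ)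

/-- The first derivative `𝔻K`. The cone degree is `4`, the weight `2` plus the rank `2`, and it is
preserved by `𝔻`, which lowers the weight and raises the rank. -/
def jet₁ : Eucl n → Matrix (Idx n × Idx n × Idx n) Unit ℝ := gradD 4 (coneForm₂ nab φ) K

/-- The second derivative `𝔻𝔻K`. -/
def jet₂ : Eucl n → Matrix (Idx n × Idx n × Idx n × Idx n) Unit ℝ :=
  gradD 4 (coneForm₃ nab φ) (jet₁ nab φ K)

/-- The third derivative `𝔻𝔻𝔻K`. -/
def jet₃ : Eucl n → Matrix (Idx n × Idx n × Idx n × Idx n × Idx n) Unit ℝ :=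
  gradD 4 (coneForm₄ nab φ) (jet₂ nab φ K)

/-- `K` is a smooth symmetric two-index cotractor field of weight two with `X^A K_{AB} = 0` and
`𝔻_{(A} K_{BC)} = 0`. -/
structure IsConeKilling : Prop where
  smooth : SmoothMat φ.1.target K
  symm : ∀ z ∈ φ.1.target, ∀ B C, K z (B, C) () = K z (C, B) ()
  zero : ∀ z ∈ φ.1.target, ∀ C, K z (0, C) () = 0
  cyclic : ∀ z ∈ φ.1.target, ∀ B C D, jet₁ nab φ K z (B, C, D) () + jet₁ nab φ K z (C, D, B) ()
    + jet₁ nab φ K z (D, B, C) () = 0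

variable {nab φ K}

lemma coneD_eq_zero {f : Eucl n → ℝ} (hf : ∀ z ∈ φ.1.target, f z = 0) {y : Eucl n}
    (hy : y ∈ φ.1.target) (m : ℝ) (A : Idx n) : coneD m A f y = 0 := by
  refine (coneD_congr φ.1.open_target (g := fun _ => 0 * 0) (fun z hz => by rw [hf z hz, zero_mul])
    hy m A).trans ?_
  rw [coneD_const_mul (by fun_prop), zero_mul]

lemma jet₁_zero (y : Eucl n) (B C : Idx n) : jet₁ nab φ K y (0, B, C) () = 2 * K y (B, C) () := by
  rw [jet₁, gradD_two_apply, coneForm_zero]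
  simp only [coneD_zero, Matrix.one_apply, ite_mul, one_mul, zero_mul, Finset.sum_ite_eq,
    Finset.mem_univ, if_true]
  ring

lemma jet₂_zero (y : Eucl n) (B C D : Idx n) :
    jet₂ nab φ K y (0, B, C, D) () = jet₁ nab φ K y (B, C, D) () := by
  rw [jet₂, gradD_three_apply, coneForm_zero]
  simp only [coneD_zero, Matrix.one_apply, ite_mul, one_mul, zero_mul, Finset.sum_ite_eq,
    Finset.mem_univ, if_true]
  ring

variable [T2Space M] {y : Eucl n} (hy : y ∈ φ.1.target) (h : IsConeKilling nab φ K)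
include hy h

lemma IsConeKilling.jet₁_symm (A B C : Idx n) :
    jet₁ nab φ K y (A, B, C) () = jet₁ nab φ K y (A, C, B) () :=
  gradD_two_symm nab hy h.symm 4 A B C

lemma IsConeKilling.jet₁_mid (A C : Idx n) : jet₁ nab φ K y (A, 0, C) () = - K y (A, C) () := by
  have h0 : ∀ z ∈ φ.1.target, ∀ C, K z (0, C) () = 0 := h.zero
  rw [jet₁, gradD_two_apply, coneD_eq_zero (fun z hz => h0 z hz C) hy]
  simp only [coneForm_apply_zero, h0 y hy, ite_mul, one_mul, zero_mul, Finset.sum_ite_eq',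
    Finset.mem_univ, if_true, mul_zero, Finset.sum_const_zero]
  ring

lemma IsConeKilling.jet₂_symm (A B C D : Idx n) :
    jet₂ nab φ K y (A, B, C, D) () = jet₂ nab φ K y (A, B, D, C) () :=
  gradD_three_symm nab hy (fun _ hz B C D => h.jet₁_symm hz B C D) 4 A B C D

lemma IsConeKilling.jet₂_second (A C D : Idx n) :
    jet₂ nab φ K y (A, 0, C, D) () = jet₁ nab φ K y (A, C, D) () := by
  have e : coneD 4 A (fun z => jet₁ nab φ K z (0, C, D) ()) y
      = 2 * coneD 4 A (fun z => K z (C, D) ()) y := by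
    rw [coneD_congr φ.1.open_target (fun z _ => jet₁_zero z C D) hy,
      coneD_const_mul (h.smooth.diffAt φ.1.open_target hy _ _)]
  have e' : jet₁ nab φ K y (A, C, D) () = _ := gradD_two_apply nab φ 4 K y A C D
  rw [jet₂, gradD_three_apply, e]
  simp only [coneForm_apply_zero, jet₁_zero, ite_mul, one_mul, zero_mul, Finset.sum_ite_eq',
    Finset.mem_univ, if_true, mul_left_comm _ (2 : ℝ), ← Finset.mul_sum]
  linarith

lemma IsConeKilling.jet₂_third (A B D : Idx n) : jet₂ nab φ K y (A, B, 0, D) ()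
    = - jet₁ nab φ K y (A, B, D) () - jet₁ nab φ K y (B, A, D) () := by
  have e : coneD 4 A (fun z => jet₁ nab φ K z (B, 0, D) ()) y
      = - coneD 4 A (fun z => K z (B, D) ()) y := by
    rw [coneD_congr φ.1.open_target (g := fun z => (-1) * K z (B, D) ())
      (fun z hz => by rw [h.jet₁_mid hz, neg_one_mul]) hy,
      coneD_const_mul (h.smooth.diffAt φ.1.open_target hy _ _), neg_one_mul]
  have e' : jet₁ nab φ K y (A, B, D) () = _ := gradD_two_apply nab φ 4 K y A B D
  rw [jet₂, gradD_three_apply, e]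
  simp only [coneForm_apply_zero, fun A D => h.jet₁_mid hy A D, ite_mul, one_mul, zero_mul,
    Finset.sum_ite_eq', Finset.mem_univ, if_true, mul_neg, Finset.sum_neg_distrib]
  linarith

lemma IsConeKilling.jet₂_fourth (A B C : Idx n) : jet₂ nab φ K y (A, B, C, 0) ()
    = - jet₁ nab φ K y (A, B, C) () - jet₁ nab φ K y (B, A, C) () := by
  rw [h.jet₂_symm hy, h.jet₂_third hy]

/-- The contraction of the splitting operator with one `X` recovers `𝔻K`: the contractions of
`𝔻𝔻K` with `X` in each of its slots are multiples of `𝔻K`, which the cyclic symmetry combines. -/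
lemma IsConeKilling.young22_zero (B C D : Idx n) :
    young22 (fun J => jet₂ nab φ K y (J 0, J 1, J 2, J 3) ()) ![0, B, C, D]
      = 3 / 4 * jet₁ nab φ K y (B, C, D) () := by
  rw [young22_apply]
  simp only [Matrix.cons_val_zero, Matrix.cons_val_one, Matrix.cons_val]
  simp only [jet₂_zero, h.jet₂_second hy, h.jet₂_third hy, h.jet₂_fourth hy]
  have hs := fun A B C => h.jet₁_symm hy A B C
  have hc := h.cyclic y hy
  linarith [hs B C D, hs C B D, hs D B C, hc B C D]

lemma IsConeKilling.young22_zero_zero (C D : Idx n) :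
    young22 (fun J => jet₂ nab φ K y (J 0, J 1, J 2, J 3) ()) ![0, 0, C, D]
      = 3 / 2 * K y (C, D) () := by
  rw [h.young22_zero hy, jet₁_zero]
  ring

variable (hn : 2 ≤ n)
include hn

lemma IsConeKilling.smooth_jet₁ : SmoothMat φ.1.target (jet₁ nab φ K) :=
  h.smooth.gradD φ.1.open_target (smoothMat_coneForm₂ hn nab φ) 4

lemma IsConeKilling.smooth_jet₂ : SmoothMat φ.1.target (jet₂ nab φ K) :=
  (h.smooth_jet₁ hy hn).gradD φ.1.open_target (smoothMat_coneForm₃ hn nab φ) 4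

lemma IsConeKilling.jet₃_cyclic (a b c d e : Idx n) : jet₃ nab φ K y (a, b, c, d, e) ()
    + jet₃ nab φ K y (a, b, d, e, c) () + jet₃ nab φ K y (a, b, e, c, d) () = 0 :=
  gradD_four_cyclic nab hy (h.smooth_jet₂ hy hn) (fun _ hz E B C D =>
    gradD_three_cyclic nab hz (h.smooth_jet₁ hy hn) h.cyclic 4 E B C D) 4 a b c d e

/-- The commutation relation of the two outer derivatives of `𝔻𝔻𝔻K`. -/
lemma IsConeKilling.jet₃_commutator (a b c d e : Idx n) :
    jet₃ nab φ K y (a, b, c, d, e) () - jet₃ nab φ K y (b, a, c, d, e) ()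
      = - (∑ H, curvW nab φ ![a, b, c] ![H] y * jet₁ nab φ K y (H, d, e) ()
        + (∑ H, curvW nab φ ![a, b, d] ![H] y * jet₁ nab φ K y (c, H, e) ()
        + ∑ H, curvW nab φ ![a, b, e] ![H] y * jet₁ nab φ K y (c, d, H) ())) := by
  have ho := φ.1.open_target
  have hΩ := smoothMat_coneForm hn nab φ
  have e1 := gradD_gradD_commutator hn nab hy (smoothMat_coneForm₃ hn nab φ)
    (h.smooth_jet₁ hy hn) 4 a b (c, d, e) ()
  have e2 : curv (coneForm₃ nab φ) a b y = kronSum (curv (coneForm nab φ) a b y)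
      (kronSum (curv (coneForm nab φ) a b y) (curv (coneForm nab φ) a b y)) :=
    (curv_kronSum ho hy hΩ (smoothMat_coneForm₂ hn nab φ) a b).trans
      (congrArg _ (curv_kronSum ho hy hΩ hΩ a b))
  rw [e2, kronSum_mul_apply, kronSum_sum_mul] at e1
  simp only [curvW_eq nab hy hn]
  exact e1

/-- The commutation relation of the two inner derivatives of `𝔻𝔻𝔻K`, in which the outer one also
acts on the curvature. -/
lemma IsConeKilling.jet₃_commutator_deriv (e a b c d : Idx n) :
    jet₃ nab φ K y (e, a, b, c, d) () - jet₃ nab φ K y (e, b, a, c, d) ()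
      = - ((∑ H, derivW nab φ ![e, a, b, c] ![H] y * K y (H, d) ()
        + ∑ H, derivW nab φ ![e, a, b, d] ![H] y * K y (c, H) ())
        + (∑ H, curvW nab φ ![a, b, c] ![H] y * jet₁ nab φ K y (e, H, d) ()
        + ∑ H, curvW nab φ ![a, b, d] ![H] y * jet₁ nab φ K y (e, c, H) ())) := by
  have ho := φ.1.open_target
  have hΩ := smoothMat_coneForm hn nab φ
  set D : Matrix (Idx n) (Idx n) ℝ := Matrix.of fun S H => derivW nab φ ![e, a, b, S] ![H] y
    with hD
  have hD' : D = endD (coneForm nab φ) e (curv (coneForm nab φ) a b) y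
      - (∑ H, coneForm nab φ e y a H • curv (coneForm nab φ) H b y
        + ∑ H, coneForm nab φ e y b H • curv (coneForm nab φ) a H y) := by
    ext S H
    simp only [hD, Matrix.of_apply, derivW_eq nab hy hn, Matrix.sub_apply, Matrix.add_apply,
      Matrix.sum_apply, Matrix.smul_apply, smul_eq_mul]
  have e2 : ∀ z ∈ φ.1.target, ∀ a b, curv (coneForm₂ nab φ) a b z
      = kronSum (curv (coneForm nab φ) a b z) (curv (coneForm nab φ) a b z) := fun z hz a b =>
    curv_kronSum ho hz hΩ hΩ a b
  have hsum : ∀ (f : Idx n → ℝ) (X : Idx n → Matrix (Idx n) (Idx n) ℝ),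
      ∑ H, f H • kronSum (X H) (X H) = kronSum (∑ H, f H • X H) (∑ H, f H • X H) := by
    intro f X
    ext ⟨i, j⟩ ⟨i', j'⟩
    simp only [kronSum, Matrix.sum_apply, Matrix.smul_apply, Matrix.add_apply,
      Matrix.kroneckerMap_apply, smul_eq_mul, Finset.sum_mul, Finset.mul_sum,
      ← Finset.sum_add_distrib]
    exact Finset.sum_congr rfl fun _ _ => by ring
  have h𝒟 : kronSum D D = endD (coneForm₂ nab φ) e (curv (coneForm₂ nab φ) a b) y
      - (∑ H, coneForm nab φ e y a H • curv (coneForm₂ nab φ) H b y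
        + ∑ H, coneForm nab φ e y b H • curv (coneForm₂ nab φ) a H y) := by
    have e3 : endD (coneForm₂ nab φ) e (curv (coneForm₂ nab φ) a b) y
        = endD (coneForm₂ nab φ) e
          (fun z => kronSum (curv (coneForm nab φ) a b z) (curv (coneForm nab φ) a b z)) y := by
      rw [endD, endD, matD_congr ho hy (fun z hz => e2 z hz a b), e2 y hy]
    have hc := SmoothMat.curv ho hΩ a b
    rw [e3]
    refine Eq.trans ?_ (congrArg (· - _) (endD_kronSum ho hy hc hc e).symm)
    simp only [e2 y hy]
    rw [hsum, hsum, ← kronSum_add, ← kronSum_sub, hD']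
  have e1 := gradD_commutator_deriv hn nab hy (smoothMat_coneForm₂ hn nab φ) h.smooth 4 e a b
    (c, d) () h𝒟
  rw [e2 y hy, kronSum_mul_apply, kronSum_mul_apply] at e1
  simp only [curvW_eq nab hy hn]
  exact e1

end Forward

end ProjTractor

namespace ProjTractor

variable {n : ℕ} {M : Type*} [TopologicalSpace M] [ChartedSpace (Eucl n) M]
  [IsManifold (𝓡 n) ∞ M]

/-! ### From Killing tensors to solutions of the prolonged equation -/

section KillingForward

variable [T2Space M] (hn : 2 ≤ n) {nab : AffineConnection n M} {φ : Chart n M} {y : Eucl n}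

/-- In the slots of `T*M`, the derivative `𝔻K` agrees with `∇k` up to terms which cancel under
symmetrisation. -/
lemma jet₁_tractorOf (nab : AffineConnection n M) (φ : Chart n M) (k : Fin n → Fin n → Eucl n → ℝ)
    (y : Eucl n) (a b c : Fin n) :
    jet₁ nab φ (col₂ (tractorOf k)) y (a.succ, b.succ, c.succ) ()
      = tensorNabla nab φ 4 k a b c y - 2 * densityForm nab φ a y * k b c y
        + densityForm nab φ b y * k a c y + densityForm nab φ c y * k b a y := by
  rw [jet₁, gradD_two_apply]
  simp only [col₂, Matrix.of_apply, Fin.sum_univ_succ, tractorOf_zero_left, tractorOf_zero_right,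
    tractorOf_succ_succ, mul_zero, zero_add, coneD_succ, coneForm_succ, tractorForm_succ_succ,
    thomasCoeff, tensorNabla]
  change pd a (k b c) y - _ = _
  simp only [sub_mul, ite_mul, mul_ite, mul_one, mul_zero, zero_mul, Finset.sum_sub_distrib,
    Finset.sum_ite_eq', Finset.mem_univ, if_true]
  ring

lemma killingEq_iff_cyclic {k : TensorFamily n M} (hs : ∀ φ a b y, k φ a b y = k φ b a y)
    (nab : AffineConnection n M) (φ : Chart n M) (y : Eucl n) (a b c : Fin n) :
    jet₁ nab φ (col₂ (tractorOf (k φ))) y (a.succ, b.succ, c.succ) ()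
      + jet₁ nab φ (col₂ (tractorOf (k φ))) y (b.succ, c.succ, a.succ) ()
      + jet₁ nab φ (col₂ (tractorOf (k φ))) y (c.succ, a.succ, b.succ) ()
      = tensorNabla nab φ 4 (k φ) a b c y + tensorNabla nab φ 4 (k φ) b c a y
        + tensorNabla nab φ 4 (k φ) c a b y := by
  simp only [jet₁_tractorOf, hs φ c b y, hs φ b a y, hs φ c a y]
  ring

lemma tractorOf_symm {k : Fin n → Fin n → Eucl n → ℝ} (hs : ∀ a b y, k a b y = k b a y)
    (B C : Idx n) (y : Eucl n) : tractorOf k ![B, C] ![] y = tractorOf k ![C, B] ![] y := by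
  refine Fin.cases ?_ (fun b => ?_) B
  · rw [tractorOf_zero_left, tractorOf_zero_right]
  refine Fin.cases ?_ (fun c => ?_) C
  · rw [tractorOf_zero_left, tractorOf_zero_right]
  · rw [tractorOf_succ_succ, tractorOf_succ_succ, hs]

include hn

lemma isConeKilling_tractorOf {k : TensorFamily n M} (hk : IsSymTensor 4 k)
    (hK : KillingEq nab k) (φ : Chart n M) : IsConeKilling nab φ (col₂ (tractorOf (k φ))) where
  smooth := smoothMat_tractorOf hk φ
  symm z _ B C := tractorOf_symm (hk.symm φ) B C z
  zero z _ C := tractorOf_zero_left (k φ) C z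
  cyclic z hz B C D := by
    have hs : ∀ B C, col₂ (tractorOf (k φ)) z (B, C) () = col₂ (tractorOf (k φ)) z (C, B) () :=
      fun B C => tractorOf_symm (hk.symm φ) B C z
    have h1 := fun A B C => gradD_two_symm nab hz (T := col₂ (tractorOf (k φ)))
      (fun z _ B C => tractorOf_symm (hk.symm φ) B C z) 4 A B C
    have h2 : ∀ A C, jet₁ nab φ (col₂ (tractorOf (k φ))) z (A, 0, C) ()
        = - col₂ (tractorOf (k φ)) z (A, C) () := by
      intro A C
      rw [jet₁, gradD_two_apply,
        coneD_eq_zero (φ := φ) (f := fun z => col₂ (tractorOf (k φ)) z (0, C) ())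
          (fun z _ => tractorOf_zero_left (k φ) C z) hz]
      have h0 : ∀ C, col₂ (tractorOf (k φ)) z (0, C) () = 0 := fun C =>
        tractorOf_zero_left (k φ) C z
      simp [coneForm_apply_zero, h0]
    have h3 : ∀ A C, jet₁ nab φ (col₂ (tractorOf (k φ))) z (A, C, 0) ()
        = - col₂ (tractorOf (k φ)) z (A, C) () := fun A C => (h1 A C 0).trans (h2 A C)
    refine Fin.cases ?_ (fun b => ?_) B
    · rw [jet₁_zero, h3, h2]
      linarith [hs C D]
    refine Fin.cases ?_ (fun c => ?_) C
    · rw [jet₁_zero, h3, h2]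
      linarith [hs D b.succ]
    refine Fin.cases ?_ (fun d => ?_) D
    · rw [jet₁_zero, h3, h2]
      linarith [hs b.succ c.succ]
    · rw [killingEq_iff_cyclic hk.symm]
      exact hK φ z hz b c d

/-- The components of `𝔻𝔻K` in the two notations. -/
lemma thomasD_thomasD_tractorOf (k : TensorFamily n M) (hy : y ∈ φ.1.target) (J : Fin 4 → Idx n) :
    thomasD nab φ 1 (thomasD nab φ 2 (tractorOf (k φ))) J ![] y
      = jet₂ nab φ (col₂ (tractorOf (k φ))) y (J 0, J 1, J 2, J 3) () := by
  have := congrFun (congrFun (col₄_eq hn (nab := nab) (k := k) φ hy) (J 0, J 1, J 2, J 3)) ()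
  rw [jet₂, jet₁, ← this]
  simp only [col₄, Matrix.of_apply]
  rw [← eq_vec_four J]

lemma splitting_apply (k : TensorFamily n M) (hy : y ∈ φ.1.target) (J : Fin 4 → Idx n) :
    splitting nab k φ J y = young22 (fun J =>
      jet₂ nab φ (col₂ (tractorOf (k φ))) y (J 0, J 1, J 2, J 3) ()) J := by
  rw [splitting]
  congr 1
  ext J
  exact thomasD_thomasD_tractorOf hn k hy J

lemma derivL_splitting {k : TensorFamily n M} (hk : IsSymTensor 4 k) (hy : y ∈ φ.1.target)
    (C D E A B : Idx n) : derivL nab (splitting nab k) φ C D E A B y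
      = young22 (fun J => jet₃ nab φ (col₂ (tractorOf (k φ))) y (C, J 0, J 1, J 2, J 3) ())
        ![D, E, A, B] := by
  have hs := smoothMat_gradD_gradD_tractorOf hn (nab := nab) hk φ
  have hT : ∀ (J : Fin 4 → Idx n) (z : Fin 0 → Idx n), DifferentiableAt ℝ (fun z =>
      thomasD nab φ 1 (thomasD nab φ 2 (tractorOf (k φ))) J ![] z) y := fun J _ =>
    diffAt_of_contDiffOn φ.1.open_target ((hs (J 0, J 1, J 2, J 3) ()).congr fun z hz =>
      thomasD_thomasD_tractorOf hn k hz J) hy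
  refine (thomasD_young22 nab hy 0 (T := fun J _ z =>
    thomasD nab φ 1 (thomasD nab φ 2 (tractorOf (k φ))) J ![] z) hT C ![D, E, A, B] ![]).trans ?_
  congr 1
  ext J
  rw [eq_vec_four J]
  refine (thomasD_four nab hy 0 _ C (J 0) (J 1) (J 2) (J 3)).trans ?_
  rw [jet₃, gradD_four_apply, zero_add,
    coneD_congr φ.1.open_target (fun z hz => thomasD_thomasD_tractorOf hn k hz _) hy]
  simp only [thomasD_thomasD_tractorOf hn k hy]
  rfl

theorem prolongEq_splitting {k : TensorFamily n M} (hk : IsSymTensor 4 k)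
    (hK : KillingEq nab k) : ProlongEq nab (splitting nab k) := by
  intro φ y hy C D E A B
  have h := isConeKilling_tractorOf hn hk hK φ
  set K := col₂ (tractorOf (k φ)) with hKdef
  have hL := (isYoungTractor_splitting hn (nab := nab) hk).young φ y
  rw [derivL_splitting hn hk hy, prolongRHS_eq]
  have l1 : ∀ B C D, splitting nab k φ ![0, B, C, D] y = 3 / 4 * jet₁ nab φ K y (B, C, D) () :=
    fun B C D => (splitting_apply hn k hy _).trans (h.young22_zero hy B C D)
  have l2 : ∀ C D, splitting nab k φ ![0, 0, C, D] y = 3 / 2 * K y (C, D) () :=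
    fun C D => (splitting_apply hn k hy _).trans (h.young22_zero_zero hy C D)
  have hs := fun A B C => h.jet₁_symm hy A B C
  have hKs := h.symm y hy
  set v : Idx n → Idx n → Idx n → Idx n → Idx n → ℝ := fun P Q R d e =>
    ∑ H, curvW nab φ ![P, Q, R] ![H] y * jet₁ nab φ K y (d, H, e) () with hv
  set u : Idx n → Idx n → Idx n → Idx n → Idx n → ℝ := fun R P Q S e =>
    ∑ H, derivW nab φ ![R, P, Q, S] ![H] y * K y (H, e) () with hu
  have hv1 : ∀ P Q R d e, ∑ H, curvW nab φ ![P, Q, R] ![H] y * jet₁ nab φ K y (H, d, e) ()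
      = - v P Q R d e - v P Q R e d := by
    intro P Q R d e
    simp only [hv, ← Finset.sum_neg_distrib, ← Finset.sum_sub_distrib]
    refine Finset.sum_congr rfl fun H _ => ?_
    linear_combination curvW nab φ ![P, Q, R] ![H] y * (h.cyclic y hy H d e + hs d H e)
  have hv2 : ∀ P Q R d e, ∑ H, curvW nab φ ![P, Q, R] ![H] y * jet₁ nab φ K y (d, e, H) ()
      = v P Q R d e := fun P Q R d e => Finset.sum_congr rfl fun H _ => by rw [hs d e H]
  have hu2 : ∀ R P Q S e, ∑ H, derivW nab φ ![R, P, Q, S] ![H] y * K y (e, H) ()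
      = u R P Q S e := fun R P Q S e => Finset.sum_congr rfl fun H _ => by rw [hKs e H]
  refine prolong_algebra (fun a b c d e => jet₃ nab φ K y (a, b, c, d, e) ()) v u ?_ ?_ ?_
    (fun P Q G I J => wSharp nab (splitting nab k) φ y P Q G 0 I J)
    (fun R P Q G H => dwSharp nab (splitting nab k) φ y R P Q G H 0 0) ?_ ?_ C D E A B
  · intro a b c d e
    refine (h.jet₃_commutator hy hn a b c d e).trans ?_
    rw [hv1, hv2]
    simp only [hv]
    ring
  · intro a b c d e
    refine (h.jet₃_commutator_deriv hy hn e a b c d).trans ?_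
    rw [hv2, hu2]
    simp only [hv, hu]
    ring
  · exact h.jet₃_cyclic hy hn
  · intro P Q G I J
    refine (wSharp_eq nab hy hn hL P Q G I J).trans ?_
    simp only [l1, mul_left_comm _ (3 / 4 : ℝ), ← Finset.mul_sum]
    rw [hv1, hv2]
    simp only [hv]
    ring
  · intro R P Q G H
    refine (dwSharp_eq nab hy hn hL R P Q G H).trans ?_
    simp only [l2]
    simp only [l1, mul_left_comm _ (3 / 4 : ℝ), mul_left_comm _ (3 / 2 : ℝ), ← Finset.mul_sum]
    rw [hv1, hu2]
    simp only [hu]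
    ring

end KillingForward

end ProjTractor

namespace ProjTractor

variable {n : ℕ} {M : Type*} [TopologicalSpace M] [ChartedSpace (Eucl n) M]
  [IsManifold (𝓡 n) ∞ M]

/-! ### From solutions of the prolonged equation to Killing tensors -/

section Young

variable {T : (Fin 4 → Idx n) → ℝ} (h : HasYoung22 T)
include h

lemma HasYoung22.cyclic_last (B C D E : Idx n) :
    T ![B, C, D, E] + T ![B, D, E, C] + T ![B, E, C, D] = 0 := by
  rw [h.pair_symm B C D E, h.pair_symm B D E C, h.pair_symm B E C D, h.2.1 D E B C,
    h.2.1 E C B D, h.2.1 C D B E]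
  exact h.2.2 D E C B

lemma HasYoung22.zero_zero_zero (C : Idx n) : T ![0, 0, 0, C] = 0 := by
  linarith [h.2.2 0 0 0 C]

lemma HasYoung22.zero_zero_zero' (C : Idx n) : T ![0, 0, C, 0] = 0 := by
  rw [h.2.1, h.zero_zero_zero]

lemma HasYoung22.zero_mid (B C : Idx n) : T ![0, B, 0, C] = - (1 / 2) * T ![0, 0, B, C] := by
  linarith [h.2.2 0 0 B C, h.1 B 0 0 C]

lemma HasYoung22.zero_last (B C : Idx n) : T ![0, B, C, 0] = - (1 / 2) * T ![0, 0, B, C] := by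
  rw [h.2.1, h.zero_mid]

/-- The composition of symmetrisers in the definition of the Young projection is not idempotent:
it acts on its image as multiplication by `3/4`. -/
lemma HasYoung22.young22_eq (B C D E : Idx n) :
    young22 T ![B, C, D, E] = 3 / 4 * T ![B, C, D, E] := by
  obtain ⟨h1, h2, h3⟩ := h
  have hp := HasYoung22.pair_symm ⟨h1, h2, h3⟩
  have e1 : T ![B, E, D, C] = T ![B, E, C, D] := h2 _ _ _ _
  have e2 : T ![D, C, B, E] = T ![B, E, C, D] := by rw [h1, hp]
  have e3 : T ![D, E, B, C] = T ![B, C, D, E] := hp _ _ _ _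
  have e4 : T ![B, D, E, C] = T ![B, D, C, E] := h2 _ _ _ _
  have e5 : T ![E, C, B, D] = T ![B, D, C, E] := by rw [h1, hp]
  have e6 : T ![E, D, B, C] = T ![B, C, D, E] := by rw [h1, hp]
  have e7 : T ![B, C, E, D] = T ![B, C, D, E] := h2 _ _ _ _
  have e8 : T ![C, B, D, E] = T ![B, C, D, E] := h1 _ _ _ _
  have e9 : T ![C, E, D, B] = T ![B, D, C, E] := by rw [h2, hp]
  have e10 : T ![D, B, C, E] = T ![B, D, C, E] := h1 _ _ _ _
  have e11 : T ![D, E, C, B] = T ![B, C, D, E] := by rw [h2, hp]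
  have e12 : T ![C, B, E, D] = T ![B, C, D, E] := by rw [h1, h2]
  have e13 : T ![C, D, E, B] = T ![B, E, C, D] := by rw [h2, hp]
  have e14 : T ![E, B, C, D] = T ![B, E, C, D] := h1 _ _ _ _
  have e15 : T ![E, D, C, B] = T ![B, C, D, E] := by rw [h1, h2, hp]
  have e16 := HasYoung22.cyclic_last ⟨h1, h2, h3⟩ B C D E
  rw [e4] at e16
  rw [young22_apply]
  simp only [e1, e2, e3, e4, e5, e6, e7, e8, e9, e10, e11, e12, e13, e14, e15]
  linarith

end Young

section Contractions

variable (nab : AffineConnection n M) {φ : Chart n M} {y : Eucl n} (hy : y ∈ φ.1.target)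
  [T2Space M] (hn : 2 ≤ n) {L : CotractorFamily n M} (hL : HasYoung22 (fun J => L φ J y))

/-- The contraction of the curvature with `X^F X^G L_{FGAB}`. -/
def curvContr (nab : AffineConnection n M) (L : CotractorFamily n M) (φ : Chart n M) (y : Eucl n)
    (P Q R S : Idx n) : ℝ := ∑ E, curvW nab φ ![P, Q, R] ![E] y * L φ ![0, 0, E, S] y

include hy hn

lemma curvContr_antisymm (P Q R S : Idx n) :
    curvContr nab L φ y P Q R S = - curvContr nab L φ y Q P R S := by
  simp only [curvContr, curvW_antisymm nab hy hn P Q R, neg_mul, Finset.sum_neg_distrib]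

lemma curvContr_zero_left (Q R S : Idx n) : curvContr nab L φ y 0 Q R S = 0 := by
  simp [curvContr, curvW_zero_left nab hy hn]

lemma curvContr_apply_zero (P Q S : Idx n) : curvContr nab L φ y P Q 0 S = 0 := by
  simp [curvContr, curvW_apply_zero nab hy hn]

include hL

lemma curvContr_last (P Q R : Idx n) : curvContr nab L φ y P Q R 0 = 0 := by
  have h : ∀ C, L φ ![0, 0, C, 0] y = 0 := hL.zero_zero_zero'
  simp [curvContr, h]

lemma curvContr_eq (P Q R S : Idx n) :
    ∑ E, curvW nab φ ![P, Q, R] ![E] y * L φ ![0, 0, S, E] y = curvContr nab L φ y P Q R S :=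
  Finset.sum_congr rfl fun E _ => congrArg _ (hL.2.1 0 0 S E)

lemma wSharp_zero_left (Q G I J : Idx n) : wSharp nab L φ y 0 Q G 0 I J = 0 := by
  rw [wSharp_eq nab hy hn hL]
  simp [curvW_zero_left nab hy hn]

lemma wSharp_zero_right (P G I J : Idx n) : wSharp nab L φ y P 0 G 0 I J = 0 := by
  rw [wSharp_eq nab hy hn hL]
  simp [curvW_zero_right nab hy hn]

lemma wSharp_zero_first (P Q I J : Idx n) : wSharp nab L φ y P Q 0 0 I J
    = - (curvContr nab L φ y P Q I J + curvContr nab L φ y P Q J I) := by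
  rw [wSharp_eq nab hy hn hL, curvContr_eq nab hy hn hL]
  simp [curvW_apply_zero nab hy hn, curvContr]

lemma wSharp_zero_third (P Q G J : Idx n) : wSharp nab L φ y P Q G 0 0 J
    = 1 / 2 * (curvContr nab L φ y P Q G J + curvContr nab L φ y P Q J G) := by
  have h : ∀ B C, L φ ![0, B, 0, C] y = - (1 / 2) * L φ ![0, 0, B, C] y := hL.zero_mid
  rw [wSharp_eq nab hy hn hL]
  simp only [h, curvW_apply_zero nab hy hn, zero_mul, Finset.sum_const_zero,
    mul_left_comm _ (-(1 / 2) : ℝ), ← Finset.mul_sum, curvContr_eq nab hy hn hL]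
  simp only [curvContr]
  ring

lemma wSharp_zero_fourth (P Q G I : Idx n) : wSharp nab L φ y P Q G 0 I 0
    = 1 / 2 * (curvContr nab L φ y P Q G I + curvContr nab L φ y P Q I G) := by
  have h : ∀ B C, L φ ![0, B, C, 0] y = - (1 / 2) * L φ ![0, 0, B, C] y := hL.zero_last
  rw [wSharp_eq nab hy hn hL]
  simp only [h, curvW_apply_zero nab hy hn, zero_mul, Finset.sum_const_zero,
    mul_left_comm _ (-(1 / 2) : ℝ), ← Finset.mul_sum, curvContr_eq nab hy hn hL]
  simp only [curvContr]
  ring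

lemma dwSharp_zero (P Q G H : Idx n) : dwSharp nab L φ y 0 P Q G H 0 0
    = 2 * (curvContr nab L φ y P Q G H + curvContr nab L φ y P Q H G) := by
  rw [dwSharp_eq nab hy hn hL]
  simp only [derivW_zero nab hy hn, curvW_apply_zero nab hy hn, zero_mul, Finset.sum_const_zero,
    mul_assoc, ← Finset.mul_sum, curvContr_eq nab hy hn hL]
  simp only [curvContr]
  ring

lemma dwSharp_zero_left (R Q G H : Idx n) : dwSharp nab L φ y R 0 Q G H 0 0
    = curvContr nab L φ y R Q G H + curvContr nab L φ y R Q H G := by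
  rw [dwSharp_eq nab hy hn hL]
  simp only [derivW_zero_left nab hy hn, curvW_zero_left nab hy hn, zero_mul,
    Finset.sum_const_zero, neg_mul, Finset.sum_neg_distrib, curvContr_eq nab hy hn hL]
  simp only [curvContr]
  ring

lemma dwSharp_zero_right (R P G H : Idx n) : dwSharp nab L φ y R P 0 G H 0 0
    = curvContr nab L φ y P R G H + curvContr nab L φ y P R H G := by
  rw [dwSharp_eq nab hy hn hL]
  simp only [derivW_zero_right nab hy hn, curvW_zero_right nab hy hn, zero_mul,
    Finset.sum_const_zero, neg_mul, Finset.sum_neg_distrib, curvContr_eq nab hy hn hL]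
  simp only [curvContr]
  ring

/-- The contraction of `𝔻W ♯ L` with three `X` vanishes: the contribution of `L` and that of
`X^F 𝔻_R W_{PQ}{}^E{}_F = - W_{PQ}{}^E{}_R` cancel. -/
lemma dwSharp_zero_first (R P Q H : Idx n) : dwSharp nab L φ y R P Q 0 H 0 0 = 0 := by
  have h : ∀ C, L φ ![0, 0, 0, C] y = 0 := hL.zero_zero_zero
  have h' : ∀ B C, L φ ![0, B, 0, C] y = - (1 / 2) * L φ ![0, 0, B, C] y := hL.zero_mid
  rw [dwSharp_eq nab hy hn hL]
  simp only [derivW_apply_zero nab hy hn, h, h', neg_mul, mul_neg,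
    Finset.sum_neg_distrib, mul_zero, Finset.sum_const_zero, mul_left_comm _ (1 / 2 : ℝ),
    ← Finset.mul_sum]
  ring

lemma dwSharp_zero_second (R P Q G : Idx n) : dwSharp nab L φ y R P Q G 0 0 0 = 0 := by
  have h : ∀ C, L φ ![0, 0, C, 0] y = 0 := hL.zero_zero_zero'
  have h' : ∀ B C, L φ ![0, B, C, 0] y = - (1 / 2) * L φ ![0, 0, B, C] y := hL.zero_last
  rw [dwSharp_eq nab hy hn hL]
  simp only [derivW_apply_zero nab hy hn, h, h', neg_mul, mul_neg,
    Finset.sum_neg_distrib, mul_zero, Finset.sum_const_zero, mul_left_comm _ (1 / 2 : ℝ),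
    ← Finset.mul_sum, curvContr_eq nab hy hn hL]
  simp only [curvContr]
  ring

/-- The contraction of the prolonged equation with `X^D X^E` has vanishing right-hand side. -/
lemma prolongRHS_zero_zero (C A B : Idx n) : prolongRHS nab L φ C 0 0 A B y = 0 := by
  rw [prolongRHS_eq]
  simp only [sym, wSharp_zero_left nab hy hn hL, wSharp_zero_right nab hy hn hL,
    wSharp_zero_third nab hy hn hL, dwSharp_zero nab hy hn hL, dwSharp_zero_first nab hy hn hL,
    curvContr_zero_left nab hy hn, curvContr_apply_zero nab hy hn, curvContr_last nab hy hn hL]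
  ring

/-- The contraction of the right-hand side of the prolonged equation with `X^D` is a sum of
tensors which are skew in one pair of indices and symmetric in the other pair, and
`Λ² ⊗ S²` contains no component of Young type `(2,2)`. -/
lemma young22_prolongRHS_zero (C E A B : Idx n) :
    young22 (fun J => prolongRHS nab L φ (J 0) 0 (J 1) (J 2) (J 3) y) ![C, E, A, B] = 0 := by
  have e : ∀ C E A B, prolongRHS nab L φ C 0 E A B y = _ := fun C E A B =>
    prolongRHS_eq nab L C 0 E A B
  simp only [sym, wSharp_zero_left nab hy hn hL, wSharp_zero_right nab hy hn hL,
    wSharp_zero_first nab hy hn hL,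
    wSharp_zero_third nab hy hn hL, wSharp_zero_fourth nab hy hn hL, dwSharp_zero nab hy hn hL,
    dwSharp_zero_left nab hy hn hL, dwSharp_zero_right nab hy hn hL,
    dwSharp_zero_first nab hy hn hL, dwSharp_zero_second nab hy hn hL] at e
  rw [young22_apply]
  simp only [Matrix.cons_val_zero, Matrix.cons_val_one, Matrix.cons_val, e]
  -- An explicitly skew form of the contraction reduces the claim to an identity of polynomials.
  obtain ⟨x, hx⟩ : ∃ x : Idx n → Idx n → Idx n → Idx n → ℝ, ∀ P Q R S,
      curvContr nab L φ y P Q R S = x P Q R S - x Q P R S :=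
    ⟨fun P Q R S => curvContr nab L φ y P Q R S / 2, fun P Q R S => by
      linarith [curvContr_antisymm nab hy hn (L := L) P Q R S]⟩
  simp only [hx]
  ring

end Contractions

end ProjTractor

namespace ProjTractor

variable {n : ℕ} {M : Type*} [TopologicalSpace M] [ChartedSpace (Eucl n) M]
  [IsManifold (𝓡 n) ∞ M]

/-! ### Recovering a section from its Killing tensor -/

/-- The tensor `k_{ab} = 2/3 X^A X^B L_{AB ab}` of a section `L` of `𝒯_{(2,2)}`; the factor inverts
`X^A X^B 𝓛(k)_{AB ab} = 3/2 k_{ab}`. -/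
def toKilling (L : CotractorFamily n M) : TensorFamily n M :=
  fun φ a b y => 2 / 3 * L φ ![0, 0, a.succ, b.succ] y

lemma cotractorTrans_zero (φ ψ : Chart n M) (y : Eucl n) (B : Idx n) :
    cotractorTrans φ ψ y 0 B = if B = 0 then densityTrans φ ψ y else 0 := by
  refine Fin.cases ?_ (fun b => ?_) B
  · simp [cotractorTrans]
  · simp [cotractorTrans, Fin.succ_ne_zero]

lemma cotractorTrans_succ_succ (φ ψ : Chart n M) (y : Eucl n) (a b : Fin n) :
    cotractorTrans φ ψ y a.succ b.succ = densityTrans φ ψ y * jacobian φ ψ y a b := rfl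

lemma isSymTensor_toKilling {L : CotractorFamily n M} (hL : IsYoungTractor L) :
    IsSymTensor 4 (toKilling L) where
  symm φ a b y := congrArg _ ((hL.young φ y).2.1 0 0 a.succ b.succ)
  smooth φ a b := contDiffOn_const.mul (hL.smooth φ _)
  zero_off φ a b y hy := by rw [toKilling, hL.zero_off φ _ y hy, mul_zero]
  trans φ ψ y hy a b := by
    have h0 : ∀ B, L ψ ![0, 0, 0, B] (coordChange φ ψ y) = 0 :=
      (hL.young ψ (coordChange φ ψ y)).zero_zero_zero
    have h0' : ∀ B, L ψ ![0, 0, B, 0] (coordChange φ ψ y) = 0 :=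
      (hL.young ψ (coordChange φ ψ y)).zero_zero_zero'
    have e : L φ ![0, 0, a.succ, b.succ] y = ∑ p : Idx n × Idx n × Idx n × Idx n,
        cotractorTrans φ ψ y 0 p.1 * (cotractorTrans φ ψ y 0 p.2.1
          * (cotractorTrans φ ψ y a.succ p.2.2.1 * (cotractorTrans φ ψ y b.succ p.2.2.2
            * L ψ ![p.1, p.2.1, p.2.2.1, p.2.2.2] (coordChange φ ψ y)))) := by
      rw [hL.trans φ ψ y hy, ← (tupleEquiv n).sum_comp]
      refine Finset.sum_congr rfl fun p _ => ?_
      have e' : ∏ i, cotractorTrans φ ψ y (![0, 0, a.succ, b.succ] i) (tupleEquiv n p i)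
          = cotractorTrans φ ψ y 0 p.1 * cotractorTrans φ ψ y 0 p.2.1
            * cotractorTrans φ ψ y a.succ p.2.2.1 * cotractorTrans φ ψ y b.succ p.2.2.2 :=
        Fin.prod_univ_four _
      rw [e', mul_assoc, mul_assoc, mul_assoc]
      rfl
    rw [toKilling, e]
    simp only [Fintype.sum_prod_type, cotractorTrans_zero, ite_mul, zero_mul,
      Finset.sum_ite_eq', Finset.mem_univ, if_true, ← Finset.mul_sum, Finset.sum_ite_irrel,
      Finset.sum_const_zero]
    simp only [Fin.sum_univ_succ (n := n), h0, h0', mul_zero, zero_add, Finset.sum_const_zero,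
      cotractorTrans_succ_succ, toKilling]
    rw [show (4 : ℝ) = ((4 : ℕ) : ℝ) by norm_num, Real.rpow_natCast]
    simp only [Finset.mul_sum]
    exact Finset.sum_congr rfl fun c _ => Finset.sum_congr rfl fun d _ => by ring

lemma col₂_toKilling {L : CotractorFamily n M} (hL : IsYoungTractor L) (φ : Chart n M)
    (y : Eucl n) (B C : Idx n) :
    col₂ (tractorOf (toKilling L φ)) y (B, C) () = 2 / 3 * L φ ![0, 0, B, C] y := by
  change tractorOf (toKilling L φ) ![B, C] ![] y = _
  refine Fin.cases ?_ (fun b => ?_) B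
  · have h0 : L φ ![0, 0, 0, C] y = 0 := (hL.young φ y).zero_zero_zero C
    rw [tractorOf_zero_left, h0, mul_zero]
  refine Fin.cases ?_ (fun c => ?_) C
  · have h0 : L φ ![0, 0, b.succ, 0] y = 0 := (hL.young φ y).zero_zero_zero' b.succ
    rw [tractorOf_zero_right, h0, mul_zero]
  · rw [tractorOf_succ_succ, toKilling]

section Backward

variable [T2Space M] (hn : 2 ≤ n) {nab : AffineConnection n M} {L : CotractorFamily n M}
  (hL : IsYoungTractor L)

lemma derivL_eq (L : CotractorFamily n M) {φ : Chart n M} {y : Eucl n} (hy : y ∈ φ.1.target)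
    (C D E A B : Idx n) : derivL nab L φ C D E A B y = coneD 4 C (L φ ![D, E, A, B]) y
      - (∑ H, coneForm nab φ C y D H * L φ ![H, E, A, B] y
        + (∑ H, coneForm nab φ C y E H * L φ ![D, H, A, B] y
        + (∑ H, coneForm nab φ C y A H * L φ ![D, E, H, B] y
        + ∑ H, coneForm nab φ C y B H * L φ ![D, E, A, H] y))) := by
  refine (thomasD_four nab hy 0 (fun J _ => L φ J) C D E A B).trans ?_
  rw [zero_add]

include hL hn

/-- By the prolonged equation contracted with `X^D X^E`, the derivative `𝔻_A (X^D X^E L_{DEBC})`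
consists of the terms from `𝔻_A X^D = δ_A^D`. -/
lemma jet₁_toKilling (hP : ProlongEq nab L) {φ : Chart n M} {y : Eucl n} (hy : y ∈ φ.1.target)
    (A B C : Idx n) : jet₁ nab φ (col₂ (tractorOf (toKilling L φ))) y (A, B, C) ()
      = 4 / 3 * L φ ![0, A, B, C] y := by
  have h := hP φ y hy A 0 0 B C
  rw [prolongRHS_zero_zero nab hy hn (hL.young φ y), derivL_eq L hy] at h
  have hs : ∀ H, L φ ![H, 0, B, C] y = L φ ![0, H, B, C] y := fun H => (hL.young φ y).1 H 0 B C
  have hd := diffAt_of_contDiffOn φ.1.open_target (hL.smooth φ ![0, 0, B, C]) hy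
  rw [jet₁, gradD_two_apply, coneD_congr φ.1.open_target
    (fun z _ => col₂_toKilling hL φ z B C) hy, coneD_const_mul hd]
  simp only [col₂_toKilling hL, coneForm_apply_zero, hs, ite_mul, one_mul, zero_mul,
    Finset.sum_ite_eq', Finset.mem_univ, if_true, mul_left_comm _ (2 / 3 : ℝ),
    ← Finset.mul_sum] at h ⊢
  linarith

lemma killingEq_toKilling (hP : ProlongEq nab L) : KillingEq nab (toKilling L) := by
  intro φ y hy a b c
  rw [← killingEq_iff_cyclic (isSymTensor_toKilling hL).symm]
  have h : L φ ![0, a.succ, b.succ, c.succ] y + L φ ![0, b.succ, c.succ, a.succ] y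
    + L φ ![0, c.succ, a.succ, b.succ] y = 0 :=
    (hL.young φ y).cyclic_last 0 a.succ b.succ c.succ
  simp only [jet₁_toKilling hn hL hP hy]
  linarith

/-- The prolonged equation contracted with one `X` expresses `L` through `𝔻𝔻K`, up to terms which
the Young projection annihilates. -/
lemma jet₂_toKilling (hP : ProlongEq nab L) {φ : Chart n M} {y : Eucl n} (hy : y ∈ φ.1.target)
    (A B C D : Idx n) : jet₂ nab φ (col₂ (tractorOf (toKilling L φ))) y (A, B, C, D) ()
      = 4 / 3 * (L φ ![A, B, C, D] y + prolongRHS nab L φ A 0 B C D y) := by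
  have h := hP φ y hy A 0 B C D
  rw [derivL_eq L hy] at h
  have hd := diffAt_of_contDiffOn φ.1.open_target (hL.smooth φ ![0, B, C, D]) hy
  rw [jet₂, gradD_three_apply, coneD_congr φ.1.open_target
    (fun z hz => jet₁_toKilling hn hL hP hz B C D) hy, coneD_const_mul hd, ← h]
  simp only [jet₁_toKilling hn hL hP hy, coneForm_apply_zero, ite_mul, one_mul, zero_mul,
    Finset.sum_ite_eq', Finset.mem_univ, if_true, mul_left_comm _ (4 / 3 : ℝ), ← Finset.mul_sum]
  ring

theorem splitting_toKilling (hP : ProlongEq nab L) : splitting nab (toKilling L) = L := by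
  ext φ J y
  by_cases hy : y ∈ φ.1.target
  · rw [splitting_apply hn _ hy, eq_vec_four J]
    have h1 := (hL.young φ y).young22_eq (J 0) (J 1) (J 2) (J 3)
    have h2 := young22_prolongRHS_zero nab hy hn (hL.young φ y) (J 0) (J 1) (J 2) (J 3)
    rw [young22_apply] at h1 h2 ⊢
    simp only [Matrix.cons_val_zero, Matrix.cons_val_one, Matrix.cons_val] at h1 h2 ⊢
    simp only [jet₂_toKilling hn hL hP hy]
    -- The factor `4/3` in `𝔻𝔻K` cancels the eigenvalue `3/4` of the Young projection.
    linear_combination (4 / 3 : ℝ) * h1 + (4 / 3 : ℝ) * h2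
  · rw [hL.zero_off φ J y hy]
    exact (isYoungTractor_splitting hn (isSymTensor_toKilling hL)).zero_off φ J y hy

end Backward

section Linear

variable [T2Space M] (hn : 2 ≤ n) {nab : AffineConnection n M}

lemma toKilling_splitting (hn : 2 ≤ n) {k : TensorFamily n M} (hk : IsSymTensor 4 k)
    (hK : KillingEq nab k) : toKilling (splitting nab k) = k := by
  ext φ a b y
  by_cases hy : y ∈ φ.1.target
  · have h := (isConeKilling_tractorOf hn hk hK φ).young22_zero_zero hy a.succ b.succ
    rw [← splitting_apply hn k hy] at h
    have e : col₂ (tractorOf (k φ)) y (a.succ, b.succ) () = k φ a b y :=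
      tractorOf_succ_succ (k φ) a b y
    rw [toKilling, h, e]
    ring
  · rw [hk.zero_off φ a b y hy]
    exact (isSymTensor_toKilling (isYoungTractor_splitting hn hk)).zero_off φ a b y hy

/-! ### Linearity -/

lemma IsSymTensor.add_smul {w : ℝ} {k k' : TensorFamily n M} (hk : IsSymTensor w k)
    (hk' : IsSymTensor w k') (c : ℝ) : IsSymTensor w (k + c • k') where
  symm φ a b y := by
    simp only [Pi.add_apply, Pi.smul_apply, hk.symm φ a b, hk'.symm φ a b]
  smooth φ a b := (hk.smooth φ a b).add (contDiffOn_const.mul (hk'.smooth φ a b))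
  zero_off φ a b y hy := by
    simp only [Pi.add_apply, Pi.smul_apply, hk.zero_off φ a b y hy, hk'.zero_off φ a b y hy,
      smul_zero, add_zero]
  trans φ ψ y hy a b := by
    simp only [Pi.add_apply, Pi.smul_apply, hk.trans φ ψ y hy a b, hk'.trans φ ψ y hy a b,
      smul_eq_mul, mul_add, Finset.sum_add_distrib, Finset.mul_sum]
    congr 1
    exact Finset.sum_congr rfl fun _ _ => Finset.sum_congr rfl fun _ _ => by ring

lemma isSymTensor_zero (w : ℝ) : IsSymTensor w (0 : TensorFamily n M) where
  symm _ _ _ _ := rfl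
  smooth _ _ _ := contDiffOn_const
  zero_off _ _ _ _ _ := rfl
  trans _ _ _ _ _ _ := by simp

lemma KillingEq.add_smul {k k' : TensorFamily n M} (hk : IsSymTensor 4 k) (hk' : IsSymTensor 4 k')
    (h : KillingEq nab k) (h' : KillingEq nab k') (c : ℝ) : KillingEq nab (k + c • k') := by
  intro φ y hy a b d
  have e : ∀ a b d, tensorNabla nab φ 4 ((k + c • k') φ) a b d y
      = tensorNabla nab φ 4 (k φ) a b d y + c * tensorNabla nab φ 4 (k' φ) a b d y := by
    intro a b d
    have hd := diffAt_of_contDiffOn φ.1.open_target (hk.smooth φ b d) hy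
    have hd' := diffAt_of_contDiffOn φ.1.open_target (hk'.smooth φ b d) hy
    have e1 : pd a (k φ b d + c • k' φ b d) y = pd a (k φ b d) y + c * pd a (k' φ b d) y := by
      refine (pd_add (f := k φ b d) (g := fun z => c * k' φ b d z) hd (hd'.const_mul c) a).trans ?_
      rw [pd_const_mul hd']
    simp only [tensorNabla, e1, Pi.add_apply, Pi.smul_apply, smul_eq_mul, mul_add,
      Finset.sum_add_distrib, mul_left_comm _ c, ← Finset.mul_sum]
    ring
  rw [e, e, e]
  linear_combination h φ y hy a b d + c * h' φ y hy a b d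

lemma killingEq_zero : KillingEq nab (0 : TensorFamily n M) := by
  intro φ y hy a b c
  have e : ∀ a, pd a (0 : Eucl n → ℝ) y = 0 := fun a => pd_const 0 y a
  simp [tensorNabla, e]

lemma gradD_add_smul {ι κ : Type*} [Fintype ι] [DecidableEq ι] [Fintype κ] [DecidableEq κ]
    {U : Set (Eucl n)} (hU : IsOpen U) {𝒜 : Idx n → Eucl n → Matrix ι ι ℝ}
    {T T' : Eucl n → Matrix ι κ ℝ} (hT : SmoothMat U T) (hT' : SmoothMat U T') (c m : ℝ)
    {y : Eucl n} (hy : y ∈ U) :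
    gradD m 𝒜 (fun z => T z + c • T' z) y = gradD m 𝒜 T y + c • gradD m 𝒜 T' y := by
  have e : ∀ A, matD m A (fun z => c • T' z) y = c • matD m A T' y := fun A => by
    ext i j
    exact coneD_const_mul (hT'.diffAt hU hy i j) c m A
  ext ⟨A, i⟩ j
  simp only [gradD, Matrix.of_apply, covD, Matrix.add_apply, Matrix.smul_apply]
  rw [matD_add hU hy hT (SmoothMat.smul contDiffOn_const hT'), e, Matrix.mul_add, Matrix.mul_smul]
  simp only [Matrix.sub_apply, Matrix.add_apply, Matrix.smul_apply, smul_eq_mul]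
  ring

lemma splitting_add_smul (hn : 2 ≤ n) {k k' : TensorFamily n M} (hk : IsSymTensor 4 k)
    (hk' : IsSymTensor 4 k') (c : ℝ) :
    splitting nab (k + c • k') = splitting nab k + c • splitting nab k' := by
  ext φ J y
  by_cases hy : y ∈ φ.1.target
  · have ho := φ.1.open_target
    have e0 : ∀ z, col₂ (tractorOf ((k + c • k') φ)) z
        = col₂ (tractorOf (k φ)) z + c • col₂ (tractorOf (k' φ)) z := by
      intro z
      ext p j
      simp only [col₂, tractorOf, Matrix.of_apply, Matrix.add_apply, Matrix.smul_apply,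
        Pi.add_apply, Pi.smul_apply, smul_eq_mul, mul_add, Finset.sum_add_distrib, Finset.mul_sum]
      congr 1
      exact Finset.sum_congr rfl fun _ _ => Finset.sum_congr rfl fun _ _ => by ring
    have e : jet₂ nab φ (col₂ (tractorOf ((k + c • k') φ))) y
        = jet₂ nab φ (col₂ (tractorOf (k φ))) y + c • jet₂ nab φ (col₂ (tractorOf (k' φ))) y := by
      refine Eq.trans (gradD_congr ho (fun _ _ _ => rfl) (fun z hz => ?_) 4 hy)
        (gradD_add_smul ho (smoothMat_gradD_tractorOf hn hk φ)
          (smoothMat_gradD_tractorOf hn hk' φ) c 4 hy)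
      exact Eq.trans (gradD_congr ho (fun _ _ _ => rfl) (fun x _ => e0 x) 4 hz)
        (gradD_add_smul ho (smoothMat_tractorOf hk φ) (smoothMat_tractorOf hk' φ) c 4 hz)
    simp only [Pi.add_apply, Pi.smul_apply]
    rw [splitting_apply hn _ hy, splitting_apply hn _ hy, splitting_apply hn _ hy, eq_vec_four J]
    simp only [young22_apply, e, Matrix.add_apply, Matrix.smul_apply, smul_eq_mul]
    ring
  · simp only [Pi.add_apply, Pi.smul_apply]
    rw [(isYoungTractor_splitting hn hk).zero_off φ J y hy,
      (isYoungTractor_splitting hn hk').zero_off φ J y hy,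
      (isYoungTractor_splitting hn (hk.add_smul hk' c)).zero_off φ J y hy]
    simp

/-! ### The correspondence -/

variable {p : ProjectiveStructure n M}

lemma splitting_eq_of_mem (hn : 2 ≤ n) {nab nab' : AffineConnection n M} (h : nab ∈ p.carrier)
    (h' : nab' ∈ p.carrier) (k : TensorFamily n M) : splitting nab k = splitting nab' k :=
  splitting_eq hn ((p.isClass nab h nab').1 h')

lemma IsKillingTensor.isProlongSolution_splitting (hn : 2 ≤ n) {k : TensorFamily n M}
    (hk : IsKillingTensor p k) (h : nab ∈ p.carrier) : IsProlongSolution p (splitting nab k) := by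
  refine ⟨isYoungTractor_splitting hn hk.1, fun nab' h' => ?_⟩
  rw [splitting_eq_of_mem hn h h' k]
  exact prolongEq_splitting hn hk.1 (hk.2 nab' h')

lemma IsProlongSolution.isKillingTensor_toKilling (hn : 2 ≤ n) {L : CotractorFamily n M}
    (hL : IsProlongSolution p L) : IsKillingTensor p (toKilling L) :=
  ⟨isSymTensor_toKilling hL.1, fun nab h => killingEq_toKilling hn hL.1 (hL.2 nab h)⟩

lemma IsKillingTensor.add_smul {k k' : TensorFamily n M} (hk : IsKillingTensor p k)
    (hk' : IsKillingTensor p k') (c : ℝ) : IsKillingTensor p (k + c • k') :=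
  ⟨hk.1.add_smul hk'.1 c, fun nab h =>
    KillingEq.add_smul hk.1 hk'.1 (hk.2 nab h) (hk'.2 nab h) c⟩

lemma isKillingTensor_zero : IsKillingTensor p 0 :=
  ⟨isSymTensor_zero 4, fun _ _ => killingEq_zero⟩

lemma IsProlongSolution.add_smul (hn : 2 ≤ n) {L L' : CotractorFamily n M}
    (hL : IsProlongSolution p L) (hL' : IsProlongSolution p L') (c : ℝ) :
    IsProlongSolution p (L + c • L') := by
  obtain ⟨nab, h⟩ := p.nonempty
  have hk := hL.isKillingTensor_toKilling hn
  have hk' := hL'.isKillingTensor_toKilling hn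
  rw [← splitting_toKilling hn hL.1 (hL.2 nab h), ← splitting_toKilling hn hL'.1 (hL'.2 nab h),
    ← splitting_add_smul hn hk.1 hk'.1 c]
  exact (hk.add_smul hk' c).isProlongSolution_splitting hn h

lemma isProlongSolution_zero (hn : 2 ≤ n) : IsProlongSolution p 0 := by
  obtain ⟨nab, h⟩ := p.nonempty
  have e := splitting_add_smul hn (nab := nab) (isSymTensor_zero 4)
    (isSymTensor_zero 4 (M := M)) (-1)
  rw [neg_one_smul, neg_one_smul, add_neg_cancel, add_neg_cancel] at e
  rw [← e]
  exact isKillingTensor_zero.isProlongSolution_splitting hn h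

end Linear

variable [T2Space M]

/-- The space of weighted Killing tensors of rank two. -/
def killingSubmodule (p : ProjectiveStructure n M) : Submodule ℝ (TensorFamily n M) where
  carrier := {k | IsKillingTensor p k}
  add_mem' {k k'} hk hk' := by
    have := hk.add_smul hk' 1
    rwa [one_smul] at this
  zero_mem' := isKillingTensor_zero
  smul_mem' c k hk := by
    have := isKillingTensor_zero.add_smul hk c
    rwa [zero_add] at this

/-- The space of solutions of the prolonged equation. -/
def prolongSubmodule (hn : 2 ≤ n) (p : ProjectiveStructure n M) :
    Submodule ℝ (CotractorFamily n M) where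
  carrier := {L | IsProlongSolution p L}
  add_mem' {L L'} hL hL' := by
    have := hL.add_smul hn hL' 1
    rwa [one_smul] at this
  zero_mem' := isProlongSolution_zero hn
  smul_mem' c L hL := by
    have := (isProlongSolution_zero hn).add_smul hn hL c
    rwa [zero_add] at this

/-- The splitting operator of a connection in the projective class, as an isomorphism from Killing
tensors to solutions of the prolonged equation. -/
def splittingEquiv (hn : 2 ≤ n) (p : ProjectiveStructure n M) {nab : AffineConnection n M}
    (h : nab ∈ p.carrier) : killingSubmodule p ≃ₗ[ℝ] prolongSubmodule hn p where
  toFun k := ⟨splitting nab k.1, IsKillingTensor.isProlongSolution_splitting hn k.2 h⟩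
  map_add' k k' := Subtype.ext <| by
    have := splitting_add_smul hn (nab := nab) k.2.1 k'.2.1 1
    rwa [one_smul, one_smul] at this
  map_smul' c k := Subtype.ext <| by
    have e := splitting_add_smul hn (nab := nab) (isSymTensor_zero 4) (isSymTensor_zero 4 (M := M))
      (-1)
    rw [neg_one_smul, neg_one_smul, add_neg_cancel, add_neg_cancel] at e
    have := splitting_add_smul hn (nab := nab) (isSymTensor_zero 4) k.2.1 c
    rwa [e, zero_add, zero_add] at this
  invFun L := ⟨toKilling L.1, IsProlongSolution.isKillingTensor_toKilling hn L.2⟩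
  left_inv k := Subtype.ext (toKilling_splitting hn k.2.1 (k.2.2 nab h))
  right_inv L := Subtype.ext (splitting_toKilling hn L.2.1 (L.2.2 nab h))

end ProjTractor

end

theorem theorem4p9 (n : ℕ) (hn : 2 ≤ n) (M : Type*) [TopologicalSpace M] [T2Space M]
    [SecondCountableTopology M] [ChartedSpace (ProjTractor.Eucl n) M]
    [IsManifold (𝓡 n) ∞ M] (p : ProjTractor.ProjectiveStructure n M) :
    (∀ k : ProjTractor.TensorFamily n M, ProjTractor.IsSymTensor 4 k →
      ∀ nab ∈ p.carrier, ProjTractor.IsYoungTractor (ProjTractor.splitting nab k) ∧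
        ∀ nab' ∈ p.carrier, ProjTractor.splitting nab k = ProjTractor.splitting nab' k) ∧
    ∃ (kill : Submodule ℝ (ProjTractor.TensorFamily n M))
      (sol : Submodule ℝ (ProjTractor.CotractorFamily n M))
      (e : kill ≃ₗ[ℝ] sol),
      (∀ k, k ∈ kill ↔ ProjTractor.IsKillingTensor p k) ∧
      (∀ L, L ∈ sol ↔ ProjTractor.IsProlongSolution p L) ∧
      ∀ nab ∈ p.carrier, ∀ k : kill,
        (e k : ProjTractor.CotractorFamily n M) = ProjTractor.splitting nab k := by
  refine ⟨fun k hk nab h => ⟨ProjTractor.isYoungTractor_splitting hn hk, fun nab' h' =>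
    ProjTractor.splitting_eq_of_mem hn h h' k⟩, ?_⟩
  obtain ⟨nab, h⟩ := p.nonempty
  exact ⟨ProjTractor.killingSubmodule p, ProjTractor.prolongSubmodule hn p,
    ProjTractor.splittingEquiv hn p h, fun _ => Iff.rfl, fun _ => Iff.rfl, fun nab' h' k =>
    ProjTractor.splitting_eq_of_mem hn h h' k.1⟩
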